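/- Let $\Omega\subset\mathbb R^3$ be a bounded open set with smooth boundary, $d_\Omega(x)=\operatorname{dist}(x,\partial\Omega)$, $\Gamma_\delta=\{x\in\Omega: d_\Omega(x)<\delta\}$, and let $n$ be the unit outward normal on $\partial\Omega$, extended to a neighbourhood of $\partial\Omega$ as the gradient of the signed distance to $\partial\Omega$ (negative in $\Omega$), so that $n=-\nabla d_\Omega$ in $\Gamma_\delta$ for small $\delta$. Let $\gamma>\frac32$, $\mu>0$, $\eta\ge 0$, $c>0$, $T>0$, and $$\mathbb S(\nabla u)=\mu\Big(\nabla u+(\nabla u)^T-\tfrac23(\operatorname{div}u)\,\mathrm{Id}\Big)+\eta(\operatorname{div}u)\,\mathrm{Id}.$$ **Navier–Stokes.** Let $\varepsilon>0$ and let $(\rho_0,u_0)$ satisfy $\rho_0\ge0$, $\rho_0\in L^\gamma(\Omega)$, $\rho_0|u_0|^2\in L^1(\Omega)$. A pair $(\rho,u)$ with $\rho\ge0$ is a *finite energy weak solution* on $[0,T]$ with viscosity scale $\varepsilon$ and data $(\rho_0,u_0)$ if * $\rho\in C_w([0,T];L^\gamma(\Omega))$, $\rho u\in C_w([0,T];L^{2\gamma/(\gamma+1)}(\Omega))$,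 $u\in L^2(0,T;H^1_0(\Omega))$, $\rho|u|^2\in C_w([0,T];L^1(\Omega))$; * for all $\phi\in C_c^\infty([0,T]\times\overline\Omega;\mathbb R)$, $$\int_\Omega\rho(T)\phi(T)\,dx-\int_\Omega\rho_0\phi(0)\,dx=\int_0^T\!\!\int_\Omega(\rho\,\partial_t\phi+\rho u\cdot\nabla\phi)\,dx\,dt;$$ * for all $\phi\in C_c^\infty([0,T]\times\Omega;\mathbb R^3)$, $$\int_\Omega\rho(T)u(T)\cdot\phi(T)\,dx-\int_\Omega\rho_0u_0\cdot\phi(0)\,dx=\int_0^T\!\!\int_\Omega\big(\rho u\cdot\partial_t\phi+\rho u\otimes u:\nabla\phi+\rho^\gamma\operatorname{div}\phi-\varepsilon\,\mathbb S(\nabla u):\nabla\phi\big)\,dx\,dt;$$ * for almost every $\tau\in[0,T]$, $$\int_\Omega\Big(\tfrac12\rho|u|^2+\tfrac{\rho^\gamma}{\gamma-1}\Big)(\tau)\,dx+\varepsilon\int_0^\tau\!\!\int_\Omega\mathbb S(\nabla u):\nabla u\,dx\,dt\le\int_\Omega\Big(\tfrac12\rho_0|u_0|^2+\tfrac{\rho_0^\gamma}{\gamma-1}\Big)dx.$$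 Here $u$ is represented so that $\rho(t)u(t)$ is the weakly continuous momentum at every $t\in[0,T]$. **Euler.** Let $(\rho^E,u^E)$ be smooth on $[0,T]\times\overline\Omega$, with $0<\inf_{(0,T)\times\Omega}\rho^E$, $\sup_{(0,T)\times\Omega}\rho^E<\infty$, and $$\partial_t\rho^E+\operatorname{div}(\rho^Eu^E)=0,\qquad \partial_t(\rho^Eu^E)+\operatorname{div}(\rho^Eu^E\otimes u^E)+\nabla(\rho^E)^\gamma=0\quad\text{in }(0,T)\times\Omega,$$ $u^E\cdot n=0$ on $\partial\Omega$; put $(\rho^E_0,u^E_0)=(\rho^E,u^E)|_{t=0}$. **Theorem.** For each $\varepsilon\in(0,1)$ let $(\rho_0^\varepsilon,u_0^\varepsilon)$ be data as above and $(\rho^\varepsilon,u^\varepsilon)$ an associated finite energy weak solution on $[0,T]$ with viscosity scale $\varepsilon$. Assume that, as $\varepsilon\to0$, $$\|\rho_0^\varepsilon-\rho_0^E\|_{L^\gamma(\Omega)}+\int_\Omega\rho_0^\varepsilon|u_0^\varepsilon-u_0^E|^2\,dx\to0$$ and $$\varepsilon\int_{(0,T)\times\Gamma_{c\varepsilon}}\Big(\frac{\rho^\varepsilon|u^\varepsilon|^2}{d_\Omega^2}+\frac{(\rho^\varepsilon)^2(u^\varepsilon\cdot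 n)^2}{d_\Omega^2}+|\nabla u^\varepsilon|^2\Big)dx\,dt\to0.$$ Then, as $\varepsilon\to0$, $$\sup_{t\in(0,T)}\Big(\|\rho^\varepsilon(t)-\rho^E(t)\|_{L^\gamma(\Omega)}+\int_\Omega\rho^\varepsilon(t)|u^\varepsilon(t)-u^E(t)|^2\,dx\Big)\to0.$$ -/

import Mathlib

open MeasureTheory Filter Topology Set
open scoped ENNReal ContDiff

namespace CompressibleFlow

noncomputable section

/-- The physical space `ℝ³` with its Euclidean norm. -/
abbrev E3 : Type := EuclideanSpace ℝ (Fin 3)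

/-- The `i`-th vector of the canonical basis of `ℝ³`. -/
def e (i : Fin 3) : E3 := EuclideanSpace.single i (1 : ℝ)

/-! ### Geometry of the domain -/

/-- A bounded open set with smooth boundary: near each boundary point it is the strict sublevel
set of a smooth function with nonvanishing differential. Connectedness is not required. -/
structure IsSmoothBoundedOpen (Ω : Set E3) : Prop where
  isOpen : IsOpen Ω
  isBounded : Bornology.IsBounded Ω
  smooth_boundary : ∀ x ∈ frontier Ω, ∃ U ∈ 𝓝 x, ∃ φ : E3 → ℝ,
    ContDiff ℝ ∞ φ ∧ fderiv ℝ φ x ≠ 0 ∧ ∀ y ∈ U, (y ∈ Ω ↔ φ y < 0)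

/-- The distance `d_Ω(x) = dist(x, ∂Ω)`. -/
def bdryDist (Ω : Set E3) (x : E3) : ℝ := Metric.infDist x (frontier Ω)

/-- The boundary layer `Γ_δ = {x ∈ Ω : d_Ω(x) < δ}`. -/
def boundaryLayer (Ω : Set E3) (δ : ℝ) : Set E3 := {x | x ∈ Ω ∧ bdryDist Ω x < δ}

/-- The signed distance to `∂Ω`: it is `-d_Ω` in `Ω` and `d_Ω` outside. -/
def signedBdryDist (Ω : Set E3) (x : E3) : ℝ := Metric.infDist x Ω - Metric.infDist x Ωᶜ

/-- The unit outward normal `n`, extended from `∂Ω` to a neighbourhood of `∂Ω` as usual: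
constant along normal lines, that is, `n = ∇ (signed distance)`; thus `n = -∇ d_Ω` in
`Γ_δ` for small `δ`. (When `∂Ω` is smooth the signed distance is smooth near `∂Ω`.) -/
def outwardNormal (Ω : Set E3) (x : E3) : E3 := gradient (signedBdryDist Ω) x

/-! ### Tensor algebra and differential operators -/

/-- The trace of a Jacobian `∇v`, that is, the divergence. -/
def tr (A : E3 →L[ℝ] E3) : ℝ := ∑ i, (A (e i)) i

/-- The Frobenius product `A : B`. -/
def frob (A B : E3 →L[ℝ] E3) : ℝ := ∑ i, ∑ j, (A (e j)) i * (B (e j)) i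

/-- The divergence of a vector field on `ℝ³`. -/
def div (v : E3 → E3) (x : E3) : ℝ := tr (fderiv ℝ v x)

/-- The viscous stress `𝕊(A) = μ (A + Aᵀ - (2/3) tr A Id) + η tr A Id`. -/
def stress (μ η : ℝ) (A : E3 →L[ℝ] E3) : E3 →L[ℝ] E3 :=
  μ • (A + ContinuousLinearMap.adjoint A - (2 / 3 * tr A) • ContinuousLinearMap.id ℝ E3)
    + (η * tr A) • ContinuousLinearMap.id ℝ E3

/-! ### Function spaces -/

/-- `f ∈ C_w([0,T]; L^p(Ω))`: `f t ∈ L^p(Ω)` for every `t ∈ [0,T]`, and `t ↦ ∫_Ω f t · g` is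
continuous on `[0,T]` for each `g ∈ L^{p'}(Ω)`. -/
def WeaklyContinuousLp {F : Type*} [NormedAddCommGroup F] [InnerProductSpace ℝ F]
    (Ω : Set E3) (T : ℝ) (p : ℝ≥0∞) (f : ℝ → E3 → F) : Prop :=
  (∀ t ∈ Icc 0 T, MemLp (f t) p (volume.restrict Ω)) ∧
  ∀ q : ℝ≥0∞, ENNReal.HolderConjugate p q →
    ∀ g : E3 → F, MemLp g q (volume.restrict Ω) →
      ContinuousOn (fun t => ∫ x in Ω, inner ℝ (f t x) (g x)) (Icc 0 T)

/-- `v ∈ H¹₀(Ω; ℝ³)` with weak gradient (Jacobian) `G`: the pair `(v, G)` is a limit in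
`L² × L²` of pairs `(φ, ∇φ)` with `φ ∈ C_c^∞(Ω; ℝ³)`. -/
def IsH10WithGradient (Ω : Set E3) (v : E3 → E3) (G : E3 → E3 →L[ℝ] E3) : Prop :=
  MemLp v 2 (volume.restrict Ω) ∧ MemLp G 2 (volume.restrict Ω) ∧
  ∃ φ : ℕ → E3 → E3,
    (∀ k, ContDiff ℝ ∞ (φ k) ∧ HasCompactSupport (φ k) ∧ tsupport (φ k) ⊆ Ω) ∧
    Tendsto (fun k => eLpNorm (fun x => φ k x - v x) 2 (volume.restrict Ω)) atTop (𝓝 0) ∧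
    Tendsto (fun k => eLpNorm (fun x => fderiv ℝ (φ k) x - G x) 2 (volume.restrict Ω))
      atTop (𝓝 0)

/-- `u ∈ L²(0,T; H¹₀(Ω; ℝ³))` with spatial weak gradient `Du`. -/
def IsL2H10WithGradient (Ω : Set E3) (T : ℝ) (u : ℝ → E3 → E3)
    (Du : ℝ → E3 → E3 →L[ℝ] E3) : Prop :=
  MemLp (fun z : ℝ × E3 => u z.1 z.2) 2 (volume.restrict (Ioo 0 T ×ˢ Ω)) ∧
  MemLp (fun z : ℝ × E3 => Du z.1 z.2) 2 (volume.restrict (Ioo 0 T ×ˢ Ω)) ∧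
  ∀ᵐ t ∂(volume.restrict (Ioo 0 T)), IsH10WithGradient Ω (u t) (Du t)

/-- Test functions in `C_c^∞([0,T] × closure Ω; ℝ)` (the set is compact for bounded `Ω`). -/
def IsScalarTest (Ω : Set E3) (T : ℝ) (φ : ℝ → E3 → ℝ) : Prop :=
  ContDiffOn ℝ ∞ (fun z : ℝ × E3 => φ z.1 z.2) (Icc 0 T ×ˢ closure Ω)

/-- Test functions in `C_c^∞([0,T] × Ω; ℝ³)`. -/
def IsVectorTest (Ω : Set E3) (T : ℝ) (φ : ℝ → E3 → E3) : Prop :=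
  ContDiffOn ℝ ∞ (fun z : ℝ × E3 => φ z.1 z.2) (Icc 0 T ×ˢ Ω) ∧
  ∃ K : Set E3, IsCompact K ∧ K ⊆ Ω ∧ ∀ t ∈ Icc 0 T, ∀ x ∈ Ω \ K, φ t x = 0

/-! ### The compressible Navier-Stokes system -/

/-- Admissible initial data: `ρ₀ ≥ 0`, `ρ₀ ∈ L^γ(Ω)`, `ρ₀ |u₀|² ∈ L¹(Ω)`. -/
structure IsInitialData (Ω : Set E3) (γ : ℝ) (ρ₀ : E3 → ℝ) (u₀ : E3 → E3) : Prop where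
  nonneg : ∀ᵐ x ∂(volume.restrict Ω), 0 ≤ ρ₀ x
  memLp : MemLp ρ₀ (ENNReal.ofReal γ) (volume.restrict Ω)
  meas : AEStronglyMeasurable u₀ (volume.restrict Ω)
  kinetic : Integrable (fun x => ρ₀ x * ‖u₀ x‖ ^ 2) (volume.restrict Ω)

/-- The energy `∫_Ω (ρ |u|² / 2 + ρ^γ / (γ - 1))`. -/
def energy (Ω : Set E3) (γ : ℝ) (ρ : E3 → ℝ) (u : E3 → E3) : ℝ :=
  ∫ x in Ω, (1 / 2 * ρ x * ‖u x‖ ^ 2 + ρ x ^ γ / (γ - 1))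

/-- `(ρ, u)` is a finite energy weak solution on `[0,T]`, with no-slip boundary condition, of
`∂ₜρ + div(ρu) = 0`, `∂ₜ(ρu) + div(ρu ⊗ u) + ∇ρ^γ = ε div 𝕊(∇u)`, with initial data `(ρ₀, u₀)`;
`Du` is the spatial weak gradient of `u`. The representatives are such that `ρ t` and
`ρ t • u t` are the weakly continuous density and momentum at every time `t ∈ [0,T]`. -/
structure IsFiniteEnergyWeakSolution (Ω : Set E3) (T γ μ η ε : ℝ) (ρ₀ : E3 → ℝ) (u₀ : E3 → E3)
    (ρ : ℝ → E3 → ℝ) (u : ℝ → E3 → E3) (Du : ℝ → E3 → E3 →L[ℝ] E3) : Prop where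
  density_meas : AEStronglyMeasurable (fun z : ℝ × E3 => ρ z.1 z.2)
    (volume.restrict (Ioo 0 T ×ˢ Ω))
  density_nonneg : ∀ t ∈ Icc 0 T, ∀ᵐ x ∂(volume.restrict Ω), 0 ≤ ρ t x
  density_cw : WeaklyContinuousLp Ω T (ENNReal.ofReal γ) ρ
  momentum_cw : WeaklyContinuousLp Ω T (ENNReal.ofReal (2 * γ / (γ + 1)))
    (fun t x => ρ t x • u t x)
  velocity : IsL2H10WithGradient Ω T u Du
  /-- `ρ |u|²` has a representative in `C_w([0,T]; L¹(Ω))`. -/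
  kinetic_cw : ∃ k : ℝ → E3 → ℝ, WeaklyContinuousLp Ω T 1 k ∧
    ∀ᵐ t ∂(volume.restrict (Icc 0 T)), ∀ᵐ x ∂(volume.restrict Ω),
      k t x = ρ t x * ‖u t x‖ ^ 2
  continuity_eq : ∀ φ : ℝ → E3 → ℝ, IsScalarTest Ω T φ →
    (∫ x in Ω, ρ T x * φ T x) - (∫ x in Ω, ρ₀ x * φ 0 x)
      = ∫ z in Ioo 0 T ×ˢ Ω,
          (ρ z.1 z.2 * deriv (fun s => φ s z.2) z.1
            + ρ z.1 z.2 * fderiv ℝ (φ z.1) z.2 (u z.1 z.2))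
  momentum_eq : ∀ φ : ℝ → E3 → E3, IsVectorTest Ω T φ →
    (∫ x in Ω, inner ℝ (ρ T x • u T x) (φ T x)) - (∫ x in Ω, inner ℝ (ρ₀ x • u₀ x) (φ 0 x))
      = ∫ z in Ioo 0 T ×ˢ Ω,
          (inner ℝ (ρ z.1 z.2 • u z.1 z.2) (deriv (fun s => φ s z.2) z.1)
            + ρ z.1 z.2 * inner ℝ (u z.1 z.2) (fderiv ℝ (φ z.1) z.2 (u z.1 z.2))
            + ρ z.1 z.2 ^ γ * div (φ z.1) z.2
            - ε * frob (stress μ η (Du z.1 z.2)) (fderiv ℝ (φ z.1) z.2))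
  energy_ineq : ∀ᵐ τ ∂(volume.restrict (Icc 0 T)),
    energy Ω γ (ρ τ) (u τ)
      + ε * (∫ z in Ioo 0 τ ×ˢ Ω, frob (stress μ η (Du z.1 z.2)) (Du z.1 z.2))
      ≤ energy Ω γ ρ₀ u₀

/-! ### The compressible Euler system -/

/-- `(ρ, u)` is a solution, smooth on `[0,T] × closure Ω` and with density bounded above and
away from zero, of `∂ₜρ + div(ρu) = 0`, `∂ₜ(ρu) + div(ρu ⊗ u) + ∇ρ^γ = 0` in `(0,T) × Ω`,
`u · n = 0` on `∂Ω`. -/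
structure IsSmoothEulerSolution (Ω : Set E3) (T γ : ℝ) (ρ : ℝ → E3 → ℝ) (u : ℝ → E3 → E3) :
    Prop where
  density_smooth : ContDiffOn ℝ ∞ (fun z : ℝ × E3 => ρ z.1 z.2) (Icc 0 T ×ˢ closure Ω)
  velocity_smooth : ContDiffOn ℝ ∞ (fun z : ℝ × E3 => u z.1 z.2) (Icc 0 T ×ˢ closure Ω)
  density_bounds : ∃ a b : ℝ, 0 < a ∧ ∀ t ∈ Ioo 0 T, ∀ x ∈ Ω, a ≤ ρ t x ∧ ρ t x ≤ b
  continuity_eq : ∀ t ∈ Ioo 0 T, ∀ x ∈ Ω,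
    deriv (fun s => ρ s x) t + div (fun y => ρ t y • u t y) x = 0
  momentum_eq : ∀ t ∈ Ioo 0 T, ∀ x ∈ Ω,
    deriv (fun s => ρ s x • u s x) t
      + ∑ j, fderiv ℝ (fun y => (ρ t y * u t y j) • u t y) x (e j)
      + gradient (fun y => ρ t y ^ γ) x = 0
  boundary : ∀ t ∈ Icc 0 T, ∀ x ∈ frontier Ω, inner ℝ (u t x) (outwardNormal Ω x) = 0

/-! ### The quantities in the criterion -/

/-- The density error plus the kinetic energy error, `‖ρ - r‖_{L^γ(Ω)} + ∫_Ω ρ |u - U|²`,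
with values in `[0,∞]`. -/
def flowError (Ω : Set E3) (γ : ℝ) (ρ : E3 → ℝ) (u : E3 → E3) (r : E3 → ℝ) (U : E3 → E3) :
    ℝ≥0∞ :=
  eLpNorm (fun x => ρ x - r x) (ENNReal.ofReal γ) (volume.restrict Ω)
    + ∫⁻ x in Ω, ENNReal.ofReal (ρ x * ‖u x - U x‖ ^ 2)

/-- `∫_{(0,T) × Γ_δ} (ρ |u|² / d_Ω² + ρ² (u·n)² / d_Ω² + |∇u|²)`, with values in `[0,∞]`. -/
def layerDissipation (Ω : Set E3) (T δ : ℝ) (ρ : ℝ → E3 → ℝ) (u : ℝ → E3 → E3)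
    (Du : ℝ → E3 → E3 →L[ℝ] E3) : ℝ≥0∞ :=
  ∫⁻ z in Ioo 0 T ×ˢ boundaryLayer Ω δ, ENNReal.ofReal
    (ρ z.1 z.2 * ‖u z.1 z.2‖ ^ 2 / bdryDist Ω z.2 ^ 2
      + ρ z.1 z.2 ^ 2 * (inner ℝ (u z.1 z.2) (outwardNormal Ω z.2)) ^ 2 / bdryDist Ω z.2 ^ 2
      + frob (Du z.1 z.2) (Du z.1 z.2))

end

end CompressibleFlow

open CompressibleFlow

/-! The argument is the relative energy method. Write `(r, U)` for the Euler flow and measure the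
distance to it by `relEnergy`: half of `ρ|u - U|²` plus the convexity gap of `ρ^γ` at `r`, divided
by `γ - 1`. Expanding the square, its integral is the energy of `(ρ, u)`, plus `∫ ρ q - ρu·U` with
`q = |U|²/2 - γ/(γ-1) r^(γ-1)`, plus `∫ r^γ`. The energy inequality controls the first piece and the
weak equations the second, except that `U` does not vanish on `∂Ω` and so is not admissible in the
momentum equation. It is replaced by `χU`, where `χ` is a cutoff vanishing near `∂Ω` with transition
layer of width `δ = cε`; the leftover momentum `∫ ρu·(1-χ)U` lives in the layer and is small because
the layer is thin and the energy bounded.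

With the Euler equations inserted (`relEnergy_rate_eq`, `weakRate_add_eq`), the bulk terms are
quadratic in the error, hence bounded by the relative energy, apart from a viscous term paid for by
part of the dissipation plus `O(ε)`. Three layer terms contain `∇χ = O(1/δ)`. The pressure term only
sees `U·∇χ`, which is bounded: `U` is tangent to `∂Ω`, so its normal part is `O(δ)` in the layer.
The convective term is at most `(C/δ) ρ|u|²`; as `d_Ω < δ` in the layer, this is at most `Cδ
ρ|u|²/d_Ω²`, which the Kato-type hypothesis makes small. The viscous term is split by Young's
inequality with a weight `l`: one part is `(C/l) ε|∇u|²` in the layer, again controlled by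
hypothesis, the other is `C l ε/δ²` times the layer volume `O(δ)`, that is `O(l)`. Gronwall closes
the estimate (`exists_ae_relEnergy_le`); `l` is fixed first, and then the remaining parameters
(`exists_parameters`).

Three points need separate work. The cutoffs are built from local defining functions and glued by
compactness (`hasCutoffs_local`, `HasCutoffs.union`), so that only the differential of the signed
distance at boundary points is needed (`hasFDerivAt_signedBdryDist`). The weak equations on `[0,T]`
are localised to almost every `[0,τ]` (`ae_weak_identity`). The conclusion concerns every time: the
relative energy is a supremum of functionals affine in `(ρ, ρu)`, so weak continuity carries an
almost everywhere bound to all times (`integral_tangent_le`, `lintegral_relEnergy_le`). Finally,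
relative energy and flow error control each other (`exists_integral_relEnergy_le`,
`exists_flowError_le`). -/

namespace CompressibleFlow

/-! ### The relative pressure potential -/

/-- The gap `s^γ - r^γ - γ r^(γ-1) (s - r)` between `s^γ` and its tangent at `r`. -/
noncomputable def relPressure (γ s r : ℝ) : ℝ := s ^ γ - γ * r ^ (γ - 1) * (s - r) - r ^ γ

lemma rpow_sub_one_mul_self {γ r : ℝ} (hr : 0 ≤ r) (hγ : 1 < γ) : r ^ (γ - 1) * r = r ^ γ := by
  rcases hr.eq_or_lt with rfl | hr
  · rw [Real.zero_rpow (by linarith), Real.zero_rpow (by linarith)]; simp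
  · rw [← Real.rpow_add_one hr.ne']; congr 1; ring

/-- By homogeneity the gap depends on `s / r` alone, up to the factor `r^γ`; its sign then becomes
Bernoulli's inequality. -/
lemma relPressure_eq_mul {γ s r : ℝ} (hγ : 1 < γ) (hs : 0 ≤ s) (hr : 0 < r) :
    relPressure γ s r = r ^ γ * ((1 + (s / r - 1)) ^ γ - (1 + γ * (s / r - 1))) := by
  have h1 : (1 + (s / r - 1)) = s / r := by ring
  rw [h1, Real.div_rpow hs hr.le, relPressure, ← rpow_sub_one_mul_self hr.le hγ]
  have : r ^ (γ - 1) ≠ 0 := (Real.rpow_pos_of_pos hr _).ne'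
  field_simp
  ring

lemma relPressure_nonneg {γ s r : ℝ} (hγ : 1 < γ) (hs : 0 ≤ s) (hr : 0 ≤ r) :
    0 ≤ relPressure γ s r := by
  rcases hr.eq_or_lt with rfl | hr
  · rw [relPressure, Real.zero_rpow (by linarith), Real.zero_rpow (by linarith)]
    simpa using Real.rpow_nonneg hs γ
  · rw [relPressure_eq_mul hγ hs hr]
    refine mul_nonneg (Real.rpow_nonneg hr.le _) (sub_nonneg.2 ?_)
    exact one_add_mul_self_le_rpow_one_add (by linarith [div_nonneg hs hr.le]) hγ.le

lemma relPressure_pos {γ s r : ℝ} (hγ : 1 < γ) (hs : 0 ≤ s) (hr : 0 < r) (h : s ≠ r) :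
    0 < relPressure γ s r := by
  rw [relPressure_eq_mul hγ hs hr]
  refine mul_pos (Real.rpow_pos_of_pos hr _) (sub_pos.2 ?_)
  refine one_add_mul_self_lt_rpow_one_add (by linarith [div_nonneg hs hr.le]) ?_ hγ
  rwa [sub_ne_zero, Ne, div_eq_one_iff_eq hr.ne']

/-- Truncation at height `K`: above it `x = x^(1-γ) x^γ` with `x^(1-γ) ≤ K^(1-γ)`. For large `K`
this is the uniform integrability that an `L^γ` bound gives. -/
lemma le_add_mul_rpow {γ K x : ℝ} (hγ : 1 < γ) (hK : 0 < K) (hx : 0 ≤ x) :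
    x ≤ K + K ^ (1 - γ) * x ^ γ := by
  have h0 : 0 ≤ K ^ (1 - γ) * x ^ γ := by positivity
  rcases le_total x K with h | h
  · linarith
  · have hx' : 0 < x := hK.trans_le h
    have : x ^ (1 - γ) ≤ K ^ (1 - γ) :=
      Real.rpow_le_rpow_of_nonpos hK h (by linarith)
    have h2 : x ^ (1 - γ) * x ^ γ = x := by
      rw [← Real.rpow_add hx']; simp
    have := mul_le_mul_of_nonneg_right this (Real.rpow_nonneg hx γ)
    linarith

/-- The tangent term is linear in `s` with slope bounded by `D`, so half of `s^γ` absorbs it up to a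
constant; the remaining `(γ - 1) r^γ` has the good sign. -/
lemma exists_rpow_le_relPressure {γ b : ℝ} (hγ : 1 < γ) (hb : 0 < b) :
    ∃ C, 0 ≤ C ∧ ∀ s r, 0 ≤ s → 0 ≤ r → r ≤ b → s ^ γ ≤ 2 * relPressure γ s r + C := by
  set D := γ * b ^ (γ - 1) with hD
  have hDpos : 0 < D := by positivity
  -- The truncation height for which `D * K^(1-γ)` is exactly `1/2`.
  set K := (2 * D) ^ (1 / (γ - 1)) with hK
  have hKpos : 0 < K := by positivity
  have hK2 : K ^ (1 - γ) = (2 * D)⁻¹ := by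
    rw [hK, ← Real.rpow_mul (by positivity), ← Real.rpow_neg_one]
    congr 1
    have : γ - 1 ≠ 0 := by linarith
    field_simp
    ring
  refine ⟨2 * (D * K), by positivity, fun s r hs hr hrb => ?_⟩
  have h1 := le_add_mul_rpow hγ hKpos hs
  rw [hK2] at h1
  have h2 : γ * r ^ (γ - 1) ≤ D := by
    have := Real.rpow_le_rpow hr hrb (by linarith : 0 ≤ γ - 1)
    exact mul_le_mul_of_nonneg_left this (by linarith)
  have h3 : γ * r ^ (γ - 1) * s ≤ D * s := mul_le_mul_of_nonneg_right h2 hs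
  have h4 : D * s ≤ D * K + s ^ γ / 2 := by
    have := mul_le_mul_of_nonneg_left h1 hDpos.le
    calc D * s ≤ _ := this
      _ = _ := by field_simp
  have h5 : 0 ≤ (γ - 1) * r ^ γ := mul_nonneg (by linarith) (Real.rpow_nonneg hr _)
  have h6 : relPressure γ s r = s ^ γ - γ * r ^ (γ - 1) * s + (γ - 1) * r ^ γ := by
    rw [relPressure, ← rpow_sub_one_mul_self hr hγ]; ring
  linarith

/-- The gaps at `(s, r)` and `(r, s)` add up to `γ (s^(γ-1) - r^(γ-1)) (s - r)`, and both are
nonnegative. In the difference of powers, `s` is at most `2b` or at most `2|s - r|`. -/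
lemma exists_relPressure_le {γ b : ℝ} (hγ : 1 < γ) (hb : 0 < b) :
    ∃ C, 0 ≤ C ∧ ∀ s r, 0 ≤ s → 0 ≤ r → r ≤ b →
      relPressure γ s r ≤ C * (|s - r| ^ γ + |s - r|) := by
  set D := (2 : ℝ) ^ (γ - 1) + (2 * b) ^ (γ - 1) with hD
  refine ⟨γ * D, by positivity, fun s r hs hr hrb => ?_⟩
  have hg : 0 ≤ γ - 1 := by linarith
  -- compare with the tangent at `s`
  have h0 := relPressure_nonneg hγ hr hs
  have h1 : relPressure γ s r ≤ γ * (s ^ (γ - 1) - r ^ (γ - 1)) * (s - r) := by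
    rw [relPressure] at h0 ⊢; nlinarith
  have hx : 0 ≤ |s - r| := abs_nonneg _
  have hss : s ^ (γ - 1) ≤ 2 ^ (γ - 1) * |s - r| ^ (γ - 1) + (2 * b) ^ (γ - 1) := by
    rcases le_total |s - r| b with h | h
    · have : s ≤ 2 * b := by linarith [le_abs_self (s - r)]
      have := Real.rpow_le_rpow hs this hg
      have : 0 ≤ (2 : ℝ) ^ (γ - 1) * |s - r| ^ (γ - 1) := by positivity
      linarith
    · have : s ≤ 2 * |s - r| := by linarith [le_abs_self (s - r)]
      have := Real.rpow_le_rpow hs this hg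
      rw [Real.mul_rpow (by norm_num) hx] at this
      have : 0 ≤ (2 * b) ^ (γ - 1) := by positivity
      linarith
  have hrr : r ^ (γ - 1) ≤ (2 * b) ^ (γ - 1) := Real.rpow_le_rpow hr (by linarith) hg
  have hdiff : |s ^ (γ - 1) - r ^ (γ - 1)| ≤ 2 ^ (γ - 1) * |s - r| ^ (γ - 1) + (2 * b) ^ (γ - 1) := by
    have : 0 ≤ (2 : ℝ) ^ (γ - 1) * |s - r| ^ (γ - 1) := by positivity
    have := Real.rpow_nonneg hs (γ - 1)
    have := Real.rpow_nonneg hr (γ - 1)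
    rw [abs_le]; constructor <;> linarith
  have h2 : γ * (s ^ (γ - 1) - r ^ (γ - 1)) * (s - r)
      ≤ γ * ((2 ^ (γ - 1) * |s - r| ^ (γ - 1) + (2 * b) ^ (γ - 1)) * |s - r|) := by
    rw [mul_assoc]
    refine mul_le_mul_of_nonneg_left ?_ (by linarith)
    refine (le_abs_self _).trans ?_
    rw [abs_mul]
    exact mul_le_mul_of_nonneg_right hdiff hx
  have h3 : |s - r| ^ (γ - 1) * |s - r| = |s - r| ^ γ := rpow_sub_one_mul_self hx hγ
  have h4 : (2 ^ (γ - 1) * |s - r| ^ (γ - 1) + (2 * b) ^ (γ - 1)) * |s - r|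
      ≤ D * (|s - r| ^ γ + |s - r|) := by
    have e1 : (2 ^ (γ - 1) * |s - r| ^ (γ - 1) + (2 * b) ^ (γ - 1)) * |s - r|
      = 2 ^ (γ - 1) * |s - r| ^ γ + (2 * b) ^ (γ - 1) * |s - r| := by rw [← h3]; ring
    have p1 : 0 ≤ (2 : ℝ) ^ (γ - 1) * |s - r| := by positivity
    have p2 : 0 ≤ (2 * b) ^ (γ - 1) * |s - r| ^ γ := by positivity
    rw [e1, hD]; nlinarith
  calc _ ≤ _ := h1.trans h2
    _ ≤ γ * (D * (|s - r| ^ γ + |s - r|)) := mul_le_mul_of_nonneg_left h4 (by linarith)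
    _ = _ := by ring

lemma continuousOn_relPressure {γ : ℝ} (hγ : 1 < γ) :
    Continuous (fun p : ℝ × ℝ => relPressure γ p.1 p.2) := by
  unfold relPressure
  have h1 := Real.continuous_rpow_const (by linarith : (0 : ℝ) ≤ γ)
  have h2 := Real.continuous_rpow_const (by linarith : (0 : ℝ) ≤ γ - 1)
  exact (((h1.comp continuous_fst).sub ((continuous_const.mul (h2.comp continuous_snd)).mul
    (continuous_fst.sub continuous_snd))).sub (h1.comp continuous_snd))

/-- Near the diagonal the gap is only quadratic, so for `γ < 2` it cannot bound `|s - r|^γ`; the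
slack `l` covers that region. Away from the diagonal the gap has a positive minimum on compact sets,
and for large `s` it dominates `s^γ`. -/
lemma exists_abs_sub_rpow_le {γ a b l : ℝ} (hγ : 1 < γ) (ha : 0 < a) (hab : a ≤ b) (hl : 0 < l) :
    ∃ C, 0 ≤ C ∧ ∀ s r, 0 ≤ s → a ≤ r → r ≤ b →
      |s - r| ^ γ ≤ l + C * relPressure γ s r := by
  have hb : 0 < b := ha.trans_le hab
  obtain ⟨C₁, hC₁, h₁⟩ := exists_rpow_le_relPressure hγ hb
  -- beyond `M` the potential dominates
  set M := max (2 * b) ((C₁ + 1) ^ (1 / γ)) with hM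
  set k := l ^ (1 / γ) with hk
  have hkpos : 0 < k := by positivity
  have hkγ : k ^ γ = l := by
    rw [hk, ← Real.rpow_mul hl.le, one_div_mul_cancel (by linarith), Real.rpow_one]
  let A : Set (ℝ × ℝ) := (Icc 0 M ×ˢ Icc a b) ∩ {p | k ≤ |p.1 - p.2|}
  have hA : IsCompact A := by
    refine (isCompact_Icc.prod isCompact_Icc).inter_right ?_
    exact isClosed_le continuous_const (by fun_prop)
  obtain ⟨m, hm, hmA⟩ : ∃ m, 0 < m ∧ ∀ p ∈ A, m ≤ relPressure γ p.1 p.2 := by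
    rcases A.eq_empty_or_nonempty with he | hne
    · exact ⟨1, one_pos, by simp [he]⟩
    · obtain ⟨p, hp, hpm⟩ := hA.exists_isMinOn hne (continuousOn_relPressure hγ).continuousOn
      refine ⟨_, ?_, fun q hq => hpm hq⟩
      refine relPressure_pos hγ hp.1.1.1 (ha.trans_le hp.1.2.1) ?_
      intro h
      have := hp.2
      simp [h] at this
      linarith
  have hMpos : 0 < M := lt_of_lt_of_le (by positivity) (le_max_left _ _)
  set C₂ := (M + b) ^ γ / m with hC₂
  refine ⟨C₂ + 2 * (C₁ + 1), by positivity, fun s r hs har hrb => ?_⟩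
  have hr : 0 < r := ha.trans_le har
  have hp := relPressure_nonneg hγ hs hr.le
  have hg : 0 ≤ γ := by linarith
  rcases lt_or_ge |s - r| k with h | h
  · have : |s - r| ^ γ ≤ l := by
      rw [← hkγ]; exact Real.rpow_le_rpow (abs_nonneg _) h.le hg
    have : 0 ≤ (C₂ + 2 * (C₁ + 1)) * relPressure γ s r := by positivity
    linarith
  rcases le_total s M with hsM | hsM
  · have h2 := hmA (s, r) ⟨⟨⟨hs, hsM⟩, har, hrb⟩, h⟩
    simp only at h2
    have h3 : |s - r| ^ γ ≤ (M + b) ^ γ := by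
      refine Real.rpow_le_rpow (abs_nonneg _) ?_ hg
      rw [abs_le]; constructor <;> linarith
    have h4 : (M + b) ^ γ ≤ C₂ * relPressure γ s r := by
      rw [hC₂, div_mul_eq_mul_div, le_div_iff₀ hm]
      exact mul_le_mul_of_nonneg_left h2 (by positivity)
    have : 0 ≤ (2 * (C₁ + 1)) * relPressure γ s r := by positivity
    linarith
  -- Beyond `M` the gap is at least `1/2`, so the additive constant `C₁` can be written as a
  -- multiple of it.
  · have h2 : C₁ + 1 ≤ s ^ γ := by
      have := Real.rpow_le_rpow (by positivity) ((le_max_right (2 * b) _).trans hsM) hg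
      rwa [← Real.rpow_mul (by positivity), one_div_mul_cancel (by linarith), Real.rpow_one] at this
    have h3 : |s - r| ^ γ ≤ s ^ γ := by
      refine Real.rpow_le_rpow (abs_nonneg _) ?_ hg
      have := (le_max_left (2 * b) ((C₁ + 1) ^ (1 / γ))).trans hsM
      rw [abs_le]; constructor <;> linarith
    have h4 := h₁ s r hs hr.le hrb
    have h5 : 1 ≤ 2 * relPressure γ s r := by linarith
    have h6 : s ^ γ ≤ 2 * (C₁ + 1) * relPressure γ s r := by nlinarith
    have : 0 ≤ C₂ * relPressure γ s r := by positivity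
    linarith

/-! ### Algebra of the viscous stress -/

lemma adjoint_apply_apply (A : E3 →L[ℝ] E3) (i j : Fin 3) :
    (ContinuousLinearMap.adjoint A (e j)) i = (A (e i)) j := by
  have h := ContinuousLinearMap.adjoint_inner_right A (e i) (e j)
  simpa [e, EuclideanSpace.inner_single_left, EuclideanSpace.inner_single_right] using h

lemma e_apply (i j : Fin 3) : (e j) i = if i = j then (1 : ℝ) else 0 := by
  simp [e]

lemma stress_apply (μ η : ℝ) (A : E3 →L[ℝ] E3) (i j : Fin 3) :
    (stress μ η A (e j)) i = μ * ((A (e j)) i + (A (e i)) j - 2 / 3 * tr A * (e j) i)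
      + η * tr A * (e j) i := by
  simp [stress, adjoint_apply_apply]

lemma frob_stress_self_nonneg {μ η : ℝ} (hμ : 0 ≤ μ) (hη : 0 ≤ η) (A : E3 →L[ℝ] E3) :
    0 ≤ frob (stress μ η A) A := by
  have : frob (stress μ η A) A = μ / 2 * (∑ i, ∑ j, ((A (e j)) i + (A (e i)) j
      - 2 / 3 * tr A * (e j) i) ^ 2) + η * tr A ^ 2 := by
    simp only [frob, stress_apply, e_apply, tr, Fin.sum_univ_three]
    simp
    ring
  rw [this]
  positivity

lemma frob_stress_add_smul (μ η s t : ℝ) (A B : E3 →L[ℝ] E3) :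
    frob (stress μ η (s • A + t • B)) (s • A + t • B) = s ^ 2 * frob (stress μ η A) A
      + 2 * (s * t) * frob (stress μ η A) B + t ^ 2 * frob (stress μ η B) B := by
  simp only [frob, stress_apply, e_apply, tr, Fin.sum_univ_three]
  simp
  ring

lemma frob_nonneg (A : E3 →L[ℝ] E3) : 0 ≤ frob A A := by
  unfold frob
  exact Finset.sum_nonneg fun i _ => Finset.sum_nonneg fun j _ => mul_self_nonneg _

lemma frob_stress_self_le {μ η : ℝ} (hμ : 0 ≤ μ) (hη : 0 ≤ η) (A : E3 →L[ℝ] E3) :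
    frob (stress μ η A) A ≤ (2 * μ + 3 * η) * frob A A := by
  have h1 : frob (stress μ η A) A + μ / 2 * (∑ i, ∑ j, ((A (e j)) i - (A (e i)) j) ^ 2)
      + 2 / 3 * μ * tr A ^ 2 = 2 * μ * frob A A + η * tr A ^ 2 := by
    simp only [frob, stress_apply, e_apply, tr, Fin.sum_univ_three]
    simp
    ring
  have h2 : tr A ^ 2 ≤ 3 * frob A A := by
    simp only [frob, tr, Fin.sum_univ_three]
    nlinarith [sq_nonneg ((A (e 0)) 0 - (A (e 1)) 1), sq_nonneg ((A (e 0)) 0 - (A (e 2)) 2),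
      sq_nonneg ((A (e 1)) 1 - (A (e 2)) 2), sq_nonneg ((A (e 0)) 1), sq_nonneg ((A (e 0)) 2),
      sq_nonneg ((A (e 1)) 0), sq_nonneg ((A (e 1)) 2), sq_nonneg ((A (e 2)) 0),
      sq_nonneg ((A (e 2)) 1)]
  have h3 : 0 ≤ μ / 2 * (∑ i, ∑ j, ((A (e j)) i - (A (e i)) j) ^ 2) := by positivity
  have h4 : 0 ≤ 2 / 3 * μ * tr A ^ 2 := by positivity
  have h5 := mul_le_mul_of_nonneg_left h2 hη
  linarith

/-- Weighted Cauchy–Schwarz for the nonnegative form `A ↦ 𝕊(A) : A`, read off from its values at `√s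
A ± B/√s`. -/
lemma abs_frob_stress_le {μ η s : ℝ} (hμ : 0 ≤ μ) (hη : 0 ≤ η) (hs : 0 < s)
    (A B : E3 →L[ℝ] E3) :
    2 * |frob (stress μ η A) B| ≤ s * frob (stress μ η A) A + s⁻¹ * frob (stress μ η B) B := by
  have hq : (√s) ^ 2 = s := Real.sq_sqrt hs.le
  have hq0 : √s ≠ 0 := (Real.sqrt_pos.2 hs).ne'
  have h1 := frob_stress_self_nonneg hμ hη (√s • A + (√s)⁻¹ • B)
  have h2 := frob_stress_self_nonneg hμ hη (√s • A + (-(√s)⁻¹) • B)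
  rw [frob_stress_add_smul] at h1 h2
  simp only [neg_sq, inv_pow, hq, mul_neg, mul_inv_cancel₀ hq0] at h1 h2
  have : |frob (stress μ η A) B| ≤
      (s * frob (stress μ η A) A + s⁻¹ * frob (stress μ η B) B) / 2 := by
    rw [abs_le]; constructor <;> linarith
  linarith

lemma abs_coord_le_norm (v : E3) (i : Fin 3) : |v i| ≤ ‖v‖ := by
  simpa using PiLp.norm_apply_le v i

lemma norm_e (i : Fin 3) : ‖e i‖ = 1 := by simp [e]

lemma abs_entry_le (A : E3 →L[ℝ] E3) (i j : Fin 3) : |(A (e j)) i| ≤ ‖A‖ := by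
  refine (abs_coord_le_norm _ i).trans ?_
  simpa [norm_e] using A.le_opNorm (e j)

lemma frob_self_le (A : E3 →L[ℝ] E3) : frob A A ≤ 9 * ‖A‖ ^ 2 := by
  have h : ∀ i j, (A (e j)) i * (A (e j)) i ≤ ‖A‖ ^ 2 := fun i j => by
    rw [← pow_two, ← sq_abs]
    exact pow_le_pow_left₀ (abs_nonneg _) (abs_entry_le A i j) 2
  calc frob A A ≤ ∑ _i : Fin 3, ∑ _j : Fin 3, ‖A‖ ^ 2 :=
        Finset.sum_le_sum fun i _ => Finset.sum_le_sum fun j _ => h i j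
    _ = 9 * ‖A‖ ^ 2 := by simp; ring

lemma abs_tr_le (A : E3 →L[ℝ] E3) : |tr A| ≤ 3 * ‖A‖ := by
  calc |tr A| ≤ ∑ i, |(A (e i)) i| := Finset.abs_sum_le_sum_abs _ _
    _ ≤ ∑ _i : Fin 3, ‖A‖ := Finset.sum_le_sum fun i _ => abs_entry_le A i i
    _ = 3 * ‖A‖ := by simp

end CompressibleFlow

namespace CompressibleFlow

/-! ### The signed distance at boundary points -/

/-- Near `x` the function `f` is Lipschitz with constant `1 + κ` and grows at rate at least `1 - κ`
along the unit vector `a`. Hence `S`, locally the set where `f` is positive up to its zero level,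
lies at distance between `-f y / (1 + κ)` and `-f y / (1 - κ)` from `y`. -/
lemma abs_infDist_add_le {f : E3 → ℝ} {L : E3 →L[ℝ] ℝ} {a x y : E3} {κ R : ℝ} {S : Set E3}
    (hκ : 0 < κ) (hκ' : κ ≤ 1 / 2) (hR : 0 < R) (ha : ‖a‖ = 1) (hLa : L a = 1)
    (hL : ∀ v, |L v| ≤ ‖v‖)
    (hf : ∀ z ∈ Metric.ball x R, ∀ z' ∈ Metric.ball x R,
      |f z - f z' - L (z - z')| ≤ κ * ‖z - z'‖)
    (hfx : f x = 0) (hS : S.Nonempty) (hS₀ : ∀ z ∈ Metric.ball x R, z ∈ S → 0 ≤ f z)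
    (hS₁ : ∀ z ∈ Metric.ball x R, 0 < f z → z ∈ S)
    (hy : y ∈ Metric.ball x (R / 8)) (hfy : f y ≤ 0) :
    |Metric.infDist y S + f y| ≤ 4 * κ * ‖y - x‖ := by
  have hyR : y ∈ Metric.ball x R := Metric.ball_subset_ball (by linarith) hy
  have hyx : ‖y - x‖ < R / 8 := by simpa [dist_eq_norm] using hy
  have h0 : -f y ≤ (1 + κ) * ‖y - x‖ := by
    have h1 := hf y hyR x (Metric.mem_ball_self hR)
    rw [hfx, sub_zero] at h1
    have h2 := hL (y - x)
    rw [abs_le] at h1 h2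
    linarith
  have hn := norm_nonneg (y - x)
  have hup : Metric.infDist y S ≤ -f y / (1 - κ) := by
    by_contra hcon
    push Not at hcon
    -- The radius `R / 8` and `κ ≤ 1/2` give at most `3R/8`, so the walk from `y` along `a` stays in
    -- the ball of radius `R`.
    have hlt : -f y / (1 - κ) < R / 2 := by
      rw [div_lt_iff₀ (by linarith)]
      nlinarith
    obtain ⟨s, hs1, hs2⟩ := exists_between (lt_min hcon hlt)
    have hs3 := hs2.trans_le (min_le_left _ _)
    have hs4 := hs2.trans_le (min_le_right _ _)
    rw [div_lt_iff₀ (by linarith)] at hs1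
    have hs0 : 0 < s := by
      by_contra h
      have : s * (1 - κ) ≤ 0 := mul_nonpos_of_nonpos_of_nonneg (by linarith) (by linarith)
      linarith
    have hz : y + s • a ∈ Metric.ball x R := by
      rw [mem_ball_iff_norm]
      calc ‖y + s • a - x‖ = ‖(y - x) + s • a‖ := by congr 1; abel
        _ ≤ ‖y - x‖ + ‖s • a‖ := norm_add_le _ _
        _ = ‖y - x‖ + s := by rw [norm_smul, ha, Real.norm_of_nonneg hs0.le, mul_one]
        _ < R := by linarith
    have h1 := hf _ hz y hyR
    simp only [add_sub_cancel_left, map_smul, hLa, norm_smul, ha, smul_eq_mul, mul_one,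
      Real.norm_of_nonneg hs0.le] at h1
    rw [abs_le] at h1
    have h2 : 0 < f (y + s • a) := by linarith
    have h3 := Metric.infDist_le_dist_of_mem (x := y) (hS₁ _ hz h2)
    rw [dist_self_add_right, norm_smul, ha, Real.norm_of_nonneg hs0.le, mul_one] at h3
    linarith
  have hlow : -f y / (1 + κ) ≤ Metric.infDist y S := by
    rw [Metric.le_infDist hS]
    intro z hz
    rw [div_le_iff₀ (by linarith), dist_comm, dist_eq_norm]
    by_cases hzR : z ∈ Metric.ball x R
    · have h1 := hf z hzR y hyR
      have h2 := hL (z - y)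
      have h3 := hS₀ z hzR hz
      rw [abs_le] at h1 h2
      linarith
    · have h1 : R ≤ ‖z - x‖ := by simpa [dist_eq_norm] using hzR
      have h2 : ‖z - x‖ ≤ ‖z - y‖ + ‖y - x‖ := norm_sub_le_norm_sub_add_norm_sub _ _ _
      nlinarith
  have e1 : -f y / (1 - κ) ≤ -f y + 2 * κ * (-f y) := by
    rw [div_le_iff₀ (by linarith)]
    have h : 0 ≤ (-f y) * κ * (1 - 2 * κ) :=
      mul_nonneg (mul_nonneg (by linarith) hκ.le) (by linarith)
    linarith
  have e2 : -f y - κ * (-f y) ≤ -f y / (1 + κ) := by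
    rw [le_div_iff₀ (by linarith)]
    have : 0 ≤ κ * κ * (-f y) := by have : 0 ≤ -f y := by linarith
                                    positivity
    linarith
  have e3 : κ * (-f y) ≤ κ * (2 * ‖y - x‖) := by
    refine mul_le_mul_of_nonneg_left ?_ hκ.le
    nlinarith
  have e4 : 0 ≤ κ * (-f y) := mul_nonneg hκ.le (by linarith)
  rw [abs_le]; constructor <;> linarith

/-- A boundary point is outside the open set, so `φ x` is not negative; were it positive, no nearby
point would belong to `Ω`. -/
lemma definingFunction_eq_zero {Ω Ud : Set E3} (hΩ : IsOpen Ω) {x : E3} (hx : x ∈ frontier Ω)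
    (hU : Ud ∈ 𝓝 x) {φ : E3 → ℝ} (hφ : Continuous φ) (h : ∀ y ∈ Ud, (y ∈ Ω ↔ φ y < 0)) :
    φ x = 0 := by
  have hxΩ : x ∉ Ω := by
    rw [hΩ.frontier_eq] at hx; exact hx.2
  have h0 : 0 ≤ φ x := by
    by_contra hc
    exact hxΩ ((h x (mem_of_mem_nhds hU)).2 (not_le.1 hc))
  refine le_antisymm ?_ h0
  by_contra hc
  have h1 : ∀ᶠ y in 𝓝 x, 0 < φ y := hφ.continuousAt.eventually (lt_mem_nhds (not_le.1 hc))
  have h2 : ∃ᶠ y in 𝓝 x, y ∈ Ω := mem_closure_iff_frequently.1 (frontier_subset_closure hx)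
  obtain ⟨y, hy, hy1, hy2⟩ := (h2.and_eventually (h1.and hU)).exists
  exact absurd ((h y hy2).1 hy) (not_lt.2 hy1.le)

/-- Strict differentiability of the normalised defining function `φ / ‖dφ‖` suffices:
`abs_infDist_add_le`, applied from inside with `Ωᶜ` and from outside with `Ω`, shows that the signed
distance agrees with it to first order at `x`. Thus `outwardNormal` on `∂Ω` is the normalised
gradient of any defining function, with no regularity of the distance off the boundary. -/
lemma hasFDerivAt_signedBdryDist {Ω Ud : Set E3} (hΩ : IsOpen Ω) {x : E3} (hx : x ∈ frontier Ω)
    (hU : Ud ∈ 𝓝 x) {φ : E3 → ℝ} (hφ : ContDiff ℝ 1 φ) (hd : fderiv ℝ φ x ≠ 0)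
    (h : ∀ y ∈ Ud, (y ∈ Ω ↔ φ y < 0)) :
    HasFDerivAt (signedBdryDist Ω) (‖fderiv ℝ φ x‖⁻¹ • fderiv ℝ φ x) x := by
  set N := ‖fderiv ℝ φ x‖ with hN
  have hNpos : 0 < N := norm_pos_iff.2 hd
  set L := N⁻¹ • fderiv ℝ φ x with hLdef
  set f : E3 → ℝ := fun y => N⁻¹ * φ y with hf
  have hφx := definingFunction_eq_zero hΩ hx hU hφ.continuous h
  have hxΩ : x ∉ Ω := by
    rw [hΩ.frontier_eq] at hx; exact hx.2
  have hfx : f x = 0 := by simp [hf, hφx]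
  have hLn : ‖L‖ = 1 := by
    rw [hLdef, norm_smul, norm_inv, Real.norm_of_nonneg hNpos.le, ← hN,
      inv_mul_cancel₀ hNpos.ne']
  have hL : ∀ v, |L v| ≤ ‖v‖ := fun v => by simpa [hLn] using L.le_opNorm v
  set a : E3 := (InnerProductSpace.toDual ℝ E3).symm L with ha
  have han : ‖a‖ = 1 := by rw [ha, LinearIsometryEquiv.norm_map, hLn]
  have hLa : L a = 1 := by
    have := InnerProductSpace.toDual_symm_apply (𝕜 := ℝ) (x := a) (y := L)
    rw [← ha, real_inner_self_eq_norm_sq, han] at this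
    rw [← this]; norm_num
  have hstrict : HasStrictFDerivAt f L x :=
    (hφ.hasStrictFDerivAt one_ne_zero).const_mul N⁻¹
  rw [hasFDerivAt_iff_isLittleO_nhds_zero, Asymptotics.isLittleO_iff]
  have hsx : signedBdryDist Ω x = 0 := by
    have h1 : x ∈ closure Ω := frontier_subset_closure hx
    have h2 : Metric.infDist x Ω = 0 := by
      rw [← Metric.infDist_closure]; exact Metric.infDist_zero_of_mem h1
    have h3 : Metric.infDist x Ωᶜ = 0 := Metric.infDist_zero_of_mem hxΩ
    simp [signedBdryDist, h2, h3]
  intro c hc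
  -- The error is `4κ` from comparing the distance with `f`, plus `κ` from linearising `f`.
  set κ := min (c / 5) (1 / 2) with hκ
  have hκpos : 0 < κ := lt_min (by positivity) (by norm_num)
  have hκc : 5 * κ ≤ c := by linarith [min_le_left (c / 5) (1 / 2)]
  have hκ2 : κ ≤ 1 / 2 := min_le_right _ _
  have hev := (Asymptotics.isLittleO_iff.1 hstrict.isLittleO) hκpos
  obtain ⟨p, hp, q, hq, hp2⟩ := Filter.eventually_prod_iff.1 (by rwa [nhds_prod_eq] at hev)
  obtain ⟨R, hR, hRsub⟩ := Metric.mem_nhds_iff.1 (Filter.inter_mem (hp.and hq) hU)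
  have hfR : ∀ z ∈ Metric.ball x R, ∀ z' ∈ Metric.ball x R,
      |f z - f z' - L (z - z')| ≤ κ * ‖z - z'‖ := fun z hz z' hz' =>
    hp2 (hRsub hz).1.1 (hRsub hz').1.2
  have hiff : ∀ y ∈ Metric.ball x R, (y ∈ Ω ↔ f y < 0) := fun y hy => by
    rw [h y (hRsub hy).2, hf]
    constructor
    · exact fun h => mul_neg_of_pos_of_neg (by positivity) h
    · intro h
      by_contra hc
      have : 0 ≤ N⁻¹ * φ y := mul_nonneg (by positivity) (not_lt.1 hc)
      exact absurd h (not_lt.2 this)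
  have hball : Metric.ball (0 : E3) (R / 8) ∈ 𝓝 (0 : E3) := Metric.ball_mem_nhds _ (by positivity)
  filter_upwards [hball] with v hv
  have hy : x + v ∈ Metric.ball x (R / 8) := by simpa using hv
  have hyR : x + v ∈ Metric.ball x R := Metric.ball_subset_ball (by linarith) hy
  have h1 := hfR _ hyR x (Metric.mem_ball_self hR)
  rw [hfx, sub_zero, add_sub_cancel_left] at h1
  have hmain : |signedBdryDist Ω (x + v) - f (x + v)| ≤ 4 * κ * ‖v‖ := by
    rcases lt_or_ge (f (x + v)) 0 with hle | hle
    · have h2 := abs_infDist_add_le (S := Ωᶜ) hκpos hκ2 hR han hLa hL hfR hfx ⟨x, hxΩ⟩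
        (fun z hz hzS => not_lt.1 fun hc => hzS ((hiff z hz).2 hc))
        (fun z hz hzf hzΩ => absurd ((hiff z hz).1 hzΩ) (not_lt.2 hzf.le)) hy hle.le
      have h3 : Metric.infDist (x + v) Ω = 0 :=
        Metric.infDist_zero_of_mem ((hiff _ hyR).2 hle)
      rw [add_sub_cancel_left] at h2
      rw [signedBdryDist, h3, zero_sub, ← abs_neg]
      convert h2 using 2
      ring
    · have h2 := abs_infDist_add_le (f := fun z => -f z) (L := -L) (a := -a) (S := Ω) (y := x + v)
        hκpos hκ2 hR (by simpa using han) (by simpa using hLa) (by simpa using hL)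
        (fun z hz z' hz' => by
          have := hfR z hz z' hz'
          rw [← abs_neg] at this
          convert this using 2
          simp; ring) (by simp [hfx])
        (closure_nonempty_iff.1 ⟨x, frontier_subset_closure hx⟩)
        (fun z hz hzS => by linarith [(hiff z hz).1 hzS])
        (fun z hz hzf => (hiff z hz).2 (by linarith)) hy (by simpa using hle)
      have h3 : Metric.infDist (x + v) Ωᶜ = 0 := Metric.infDist_zero_of_mem fun hc =>
        absurd ((hiff _ hyR).1 hc) (not_lt.2 hle)
      rw [add_sub_cancel_left] at h2
      rw [signedBdryDist, h3, sub_zero]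
      convert h2 using 2
      ring
  rw [hsx, sub_zero, Real.norm_eq_abs]
  calc |signedBdryDist Ω (x + v) - L v|
      = |(signedBdryDist Ω (x + v) - f (x + v)) + (f (x + v) - L v)| := by ring_nf
    _ ≤ |signedBdryDist Ω (x + v) - f (x + v)| + |f (x + v) - L v| := abs_add_le _ _
    _ ≤ 4 * κ * ‖v‖ + κ * ‖v‖ := add_le_add hmain h1
    _ = 5 * κ * ‖v‖ := by ring
    _ ≤ c * ‖v‖ := mul_le_mul_of_nonneg_right hκc (norm_nonneg _)

/-- A vector tangent to `∂Ω` is annihilated by the differential of any defining function. -/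
lemma fderiv_eq_zero_of_inner_outwardNormal {Ω Ud : Set E3} (hΩ : IsOpen Ω) {x : E3}
    (hx : x ∈ frontier Ω) (hU : Ud ∈ 𝓝 x) {φ : E3 → ℝ} (hφ : ContDiff ℝ 1 φ)
    (hd : fderiv ℝ φ x ≠ 0) (h : ∀ y ∈ Ud, (y ∈ Ω ↔ φ y < 0)) {v : E3}
    (hv : inner ℝ v (outwardNormal Ω x) = 0) : fderiv ℝ φ x v = 0 := by
  have h1 := (hasFDerivAt_signedBdryDist hΩ hx hU hφ hd h).fderiv
  rw [outwardNormal, gradient, h1, real_inner_comm, InnerProductSpace.toDual_symm_apply] at hv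
  have : ‖fderiv ℝ φ x‖⁻¹ ≠ 0 := inv_ne_zero (norm_ne_zero_iff.2 hd)
  simpa [this] using hv

end CompressibleFlow

namespace CompressibleFlow

/-! ### Boundary layers -/

lemma add_le_of_one_le_fderiv {φ : E3 → ℝ} (hφ : Differentiable ℝ φ) {B : Set E3}
    (hB : Convex ℝ B) {w : E3} (hw : ∀ z ∈ B, 1 ≤ fderiv ℝ φ z w) {y : E3} (hy : y ∈ B) {t : ℝ}
    (ht : 0 ≤ t) (hyt : y + t • w ∈ B) : φ y + t ≤ φ (y + t • w) := by
  have hd : ∀ s : ℝ, HasDerivAt (fun s : ℝ => φ (y + s • w)) (fderiv ℝ φ (y + s • w) w) s := by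
    intro s
    have h1 : HasDerivAt (fun s : ℝ => y + s • w) w s := by
      simpa using ((hasDerivAt_id s).smul_const w).const_add y
    exact (hφ (y + s • w)).hasFDerivAt.comp_hasDerivAt s h1
  have hmem : ∀ s ∈ Icc 0 t, y + s • w ∈ B := by
    intro s hs
    rcases ht.eq_or_lt with rfl | htp
    · have : s = 0 := le_antisymm hs.2 hs.1
      simpa [this] using hy
    · have := hB.add_smul_mem hy (y := t • w) (t := s / t) (by simpa using hyt)
        ⟨div_nonneg hs.1 ht, (div_le_one htp).2 hs.2⟩
      rwa [smul_smul, div_mul_cancel₀ _ htp.ne'] at this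
  have := Convex.mul_sub_le_image_sub_of_le_deriv (convex_Icc 0 t) (f := fun s => φ (y + s • w))
    (fun s _ => (hd s).continuousAt.continuousWithinAt)
    (fun s _ => (hd s).differentiableAt.differentiableWithinAt) (C := 1)
    (fun s hs => by rw [(hd s).deriv]; exact hw _ (hmem s (interior_subset hs)))
    0 ⟨le_rfl, ht⟩ t ⟨ht, le_rfl⟩ ht
  simp at this
  linarith

/-- The slab `{-s ≤ φ < 0}` of a function with nonvanishing differential has measure `O(s)`:
it has `≳ 1 / s` disjoint translates in a fixed ball. -/
lemma volume_slab_le {φ : E3 → ℝ} (hφ : Differentiable ℝ φ) {x₀ w : E3} {R : ℝ} (hR : 0 < R)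
    (hw : ∀ z ∈ Metric.ball x₀ (3 * R), 1 ≤ fderiv ℝ φ z w) :
    ∃ C, 0 ≤ C ∧ ∀ s, 0 < s →
      volume {x | x ∈ Metric.closedBall x₀ R ∧ -s ≤ φ x ∧ φ x < 0} ≤ ENNReal.ofReal (C * s) := by
  set V := (volume (Metric.ball x₀ (3 * R))).toReal with hV
  have hVfin : volume (Metric.ball x₀ (3 * R)) ≠ ⊤ := measure_ball_lt_top.ne
  refine ⟨V * ((‖w‖ + 1) / R), by positivity, fun s hs => ?_⟩
  set A := {x | x ∈ Metric.closedBall x₀ R ∧ -s ≤ φ x ∧ φ x < 0} with hA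
  have hAm : MeasurableSet A := by
    have hm := hφ.continuous.measurable
    exact Metric.isClosed_closedBall.measurableSet.inter
      ((measurableSet_le measurable_const hm).inter (measurableSet_lt hm measurable_const))
  -- The number of translates by multiples of `s • w` shorter than `R`, so that all of them stay in
  -- the ball of radius `3R`.
  set N := ⌈R / (s * (‖w‖ + 1))⌉₊ with hN
  have hNle : R / (s * (‖w‖ + 1)) ≤ N := Nat.le_ceil _
  have hNpos : (0 : ℝ) < N := lt_of_lt_of_le (by positivity) hNle
  have hk : ∀ k < N, (k : ℝ) * s * ‖w‖ < R := by
    intro k hk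
    have h1 : (k : ℝ) < R / (s * (‖w‖ + 1)) := Nat.lt_ceil.1 hk
    rw [lt_div_iff₀ (by positivity)] at h1
    have : 0 ≤ (k : ℝ) * s := by positivity
    nlinarith
  let B : ℕ → Set E3 := fun k => (fun x => x + (-((k : ℝ) * s) • w)) ⁻¹' A
  have hBv : ∀ k, volume (B k) = volume A := fun k => measure_preimage_add_right _ _ _
  have hBm : ∀ k, MeasurableSet (B k) := fun k => (measurable_add_const _) hAm
  have hBsub : ∀ k < N, B k ⊆ Metric.ball x₀ (3 * R) := by
    intro k hkN x hx
    have h1 : ‖x + (-((k : ℝ) * s) • w) - x₀‖ ≤ R := by simpa [dist_eq_norm] using hx.1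
    rw [mem_ball_iff_norm]
    calc ‖x - x₀‖ = ‖(x + (-((k : ℝ) * s) • w) - x₀) + ((k : ℝ) * s) • w‖ := by
          congr 1; simp only [neg_smul]; abel
      _ ≤ R + ‖((k : ℝ) * s) • w‖ := (norm_add_le _ _).trans (by gcongr)
      _ = R + k * s * ‖w‖ := by rw [norm_smul, Real.norm_of_nonneg (by positivity)]
      _ < 3 * R := by linarith [hk k hkN]
  have hdisj : ∀ k l, k < l → l < N → Disjoint (B k) (B l) := by
    intro k l hkl hl
    rw [Set.disjoint_left]
    intro x hxk hxl
    have hkl' : ((k : ℝ) + 1) ≤ l := by exact_mod_cast hkl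
    have hmem : ∀ z ∈ A, z ∈ Metric.ball x₀ (3 * R) := fun z hz =>
      Metric.closedBall_subset_ball (by linarith) hz.1
    have e1 : x + (-((k : ℝ) * s) • w) = (x + (-((l : ℝ) * s) • w)) + ((l - k : ℝ) * s) • w := by
      rw [add_assoc, ← add_smul]; congr 2; ring
    have h1 := add_le_of_one_le_fderiv hφ (convex_ball x₀ (3 * R)) hw (hmem _ hxl)
      (t := (l - k : ℝ) * s) (mul_nonneg (by linarith) hs.le) (by rw [← e1]; exact hmem _ hxk)
    rw [← e1] at h1
    have h2 := hxk.2.2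
    have h3 := hxl.2.1
    nlinarith
  have hsum : (N : ℝ≥0∞) * volume A ≤ volume (Metric.ball x₀ (3 * R)) := by
    have h1 : volume (⋃ k ∈ Finset.range N, B k) = ∑ k ∈ Finset.range N, volume (B k) := by
      refine measure_biUnion_finset ?_ fun k _ => hBm k
      intro k hk l hl hne
      simp only [Finset.coe_range, mem_Iio] at hk hl
      rcases lt_or_gt_of_ne hne with h | h
      · exact hdisj k l h hl
      · exact (hdisj l k h hk).symm
    have h2 : (⋃ k ∈ Finset.range N, B k) ⊆ Metric.ball x₀ (3 * R) := by
      simp only [iUnion_subset_iff, Finset.mem_range]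
      exact hBsub
    have h3 := measure_mono (μ := volume) h2
    rw [h1] at h3
    simpa [hBv] using h3
  have hAfin : volume A ≠ ⊤ := by
    refine ne_top_of_le_ne_top (b := volume (Metric.closedBall x₀ R))
      measure_closedBall_lt_top.ne (measure_mono fun x hx => hx.1)
  rw [← ENNReal.ofReal_toReal hAfin]
  refine ENNReal.ofReal_le_ofReal ?_
  have h4 := ENNReal.toReal_mono hVfin hsum
  rw [ENNReal.toReal_mul, ENNReal.toReal_natCast, ← hV] at h4
  have h5 : R / (s * (‖w‖ + 1)) * (volume A).toReal ≤ V :=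
    (mul_le_mul_of_nonneg_right hNle ENNReal.toReal_nonneg).trans h4
  calc (volume A).toReal = (R / (s * (‖w‖ + 1)) * (volume A).toReal) * ((s * (‖w‖ + 1)) / R) := by
        field_simp
    _ ≤ V * ((s * (‖w‖ + 1)) / R) := mul_le_mul_of_nonneg_right h5 (by positivity)
    _ = _ := by ring

/-- The ball is connected and misses `∂Ω`, so it lies in the interior of `Ω` or off its closure; its
centre decides. -/
lemma ball_bdryDist_subset {Ω : Set E3} {x : E3} (hx : x ∈ Ω) :
    Metric.ball x (bdryDist Ω x) ⊆ Ω := by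
  rcases le_or_gt (bdryDist Ω x) 0 with h | hpos
  · simp [Metric.ball_eq_empty.2 h]
  have hx' : x ∈ Metric.ball x (bdryDist Ω x) := Metric.mem_ball_self hpos
  have hfr : ∀ z ∈ Metric.ball x (bdryDist Ω x), z ∉ frontier Ω := fun z hz hzf =>
    absurd (Metric.infDist_le_dist_of_mem hzf) (not_le.2 (Metric.mem_ball'.1 hz))
  refine Subset.trans ((convex_ball x _).isPreconnected.subset_left_of_subset_union isOpen_interior
    (isClosed_closure (s := Ω)).isOpen_compl ?_ ?_ ⟨x, hx', ?_⟩) interior_subset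
  · exact disjoint_compl_right_iff_subset.2 (interior_subset.trans subset_closure)
  · intro z hz
    by_cases hzc : z ∈ closure Ω
    · exact Or.inl (by_contra fun hzi => hfr z hz ⟨hzc, hzi⟩)
    · exact Or.inr hzc
  · exact by_contra fun hxi => hfr x hx' ⟨subset_closure hx, hxi⟩

lemma bdryDist_le_of_notMem {Ω : Set E3} {x y : E3} (hx : x ∈ Ω) (hy : y ∉ Ω) :
    bdryDist Ω x ≤ dist x y := by
  by_contra h
  exact hy (ball_bdryDist_subset hx (Metric.mem_ball'.2 (not_le.1 h)))

lemma bdryDist_pos {Ω : Set E3} (hΩ : IsOpen Ω) (hne : (frontier Ω).Nonempty) {x : E3}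
    (hx : x ∈ Ω) : 0 < bdryDist Ω x := by
  refine (isClosed_frontier.notMem_iff_infDist_pos hne).1 fun h => ?_
  rw [hΩ.frontier_eq] at h
  exact h.2 hx

/-- A field on `Ω` bounded by `L` with its derivative, tangent to the boundary. -/
structure IsTangentField (Ω : Set E3) (L : ℝ) (V : E3 → E3) : Prop where
  cont : ContinuousOn V (closure Ω)
  diff : ∀ x ∈ Ω, DifferentiableAt ℝ V x
  norm_le : ∀ x ∈ Ω, ‖V x‖ ≤ L
  fderiv_le : ∀ x ∈ Ω, ‖fderiv ℝ V x‖ ≤ L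
  boundary : ∀ x ∈ frontier Ω, inner ℝ (V x) (outwardNormal Ω x) = 0

/-- `Ω` need not be convex, but the ball of radius `d_Ω(x)` around `x` lies in it. The mean value
inequality holds there and passes to `y` on its boundary by continuity of `V` up to `∂Ω`. -/
lemma IsTangentField.norm_sub_le {Ω : Set E3} {L : ℝ} {V : E3 → E3} (hV : IsTangentField Ω L V)
    (hΩ : IsOpen Ω) {x y : E3} (hx : x ∈ Ω) (hy : y ∈ frontier Ω)
    (hxy : dist x y = bdryDist Ω x) : ‖V y - V x‖ ≤ L * ‖y - x‖ := by
  have hpos := bdryDist_pos hΩ ⟨y, hy⟩ hx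
  have hsub := ball_bdryDist_subset hx
  have hyc : y ∈ closure (Metric.ball x (bdryDist Ω x)) := by
    rw [closure_ball x hpos.ne', Metric.mem_closedBall', hxy]
  have hyΩ : y ∈ closure Ω := frontier_subset_closure hy
  have hsub' : Metric.ball x (bdryDist Ω x) ⊆ closure Ω := hsub.trans subset_closure
  refine ContinuousWithinAt.closure_le (f := fun z => ‖V z - V x‖) (g := fun z => L * ‖z - x‖) hyc
    (((hV.cont y hyΩ).mono hsub').sub continuousWithinAt_const).norm
    (by fun_prop) fun z hz => ?_
  exact Convex.norm_image_sub_le_of_norm_fderiv_le (fun u hu => hV.diff u (hsub hu))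
    (fun u hu => hV.fderiv_le u (hsub hu)) (convex_ball _ _) (Metric.mem_ball_self hpos) hz

/-- `χ` is a cutoff at scale `δ` vanishing near `A` and equal to `1` in `Ω` off the layer `S`. -/
structure IsCutoff (Ω A : Set E3) (C δ : ℝ) (χ : E3 → ℝ) (S : Set E3) : Prop where
  smooth : ContDiff ℝ ∞ χ
  nonneg : ∀ x, 0 ≤ χ x
  le_one : ∀ x, χ x ≤ 1
  zero : ∀ᶠ x in 𝓝ˢ A, χ x = 0
  meas : MeasurableSet S
  sub : S ⊆ boundaryLayer Ω δ
  vol : volume S ≤ ENNReal.ofReal (C * δ)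
  off : ∀ x ∈ Ω \ S, χ x = 1 ∧ fderiv ℝ χ x = 0
  bound : ∀ x ∈ Ω, ‖fderiv ℝ χ x‖ ≤ C / δ
  tangent : ∀ L V, IsTangentField Ω L V → ∀ x ∈ Ω, |fderiv ℝ χ x (V x)| ≤ C * L

/-- Cutoffs near `A` exist at all small scales, with a uniform constant. -/
def HasCutoffs (Ω A : Set E3) : Prop :=
  ∃ C δ₀, 0 ≤ C ∧ 0 < δ₀ ∧ ∀ δ ∈ Ioo 0 δ₀, ∃ χ S, IsCutoff Ω A C δ χ S

lemma IsTangentField.bound_nonneg {Ω : Set E3} {L : ℝ} {V : E3 → E3} (hV : IsTangentField Ω L V)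
    {x : E3} (hx : x ∈ Ω) : 0 ≤ L := (norm_nonneg _).trans (hV.norm_le x hx)

lemma hasCutoffs_empty (Ω : Set E3) : HasCutoffs Ω ∅ := by
  refine ⟨0, 1, le_rfl, one_pos, fun δ hδ => ⟨fun _ => 1, ∅, ?_⟩⟩
  constructor <;> simp [contDiff_const]

lemma HasCutoffs.mono {Ω A B : Set E3} (hAB : A ⊆ B) (h : HasCutoffs Ω B) : HasCutoffs Ω A := by
  obtain ⟨C, δ₀, hC, hδ₀, h⟩ := h
  refine ⟨C, δ₀, hC, hδ₀, fun δ hδ => ?_⟩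
  obtain ⟨χ, S, hχ⟩ := h δ hδ
  exact ⟨χ, S, { hχ with zero := hχ.zero.filter_mono (nhdsSet_mono hAB) }⟩

/-- Multiply the cutoffs. Both factors lie in `[0, 1]`, so by Leibniz the derivative bounds add, and
in particular the tangential ones; this makes the construction local on `∂Ω`. -/
lemma HasCutoffs.union {Ω A B : Set E3} (hA : HasCutoffs Ω A) (hB : HasCutoffs Ω B) :
    HasCutoffs Ω (A ∪ B) := by
  obtain ⟨C₁, d₁, hC₁, hd₁, h₁⟩ := hA
  obtain ⟨C₂, d₂, hC₂, hd₂, h₂⟩ := hB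
  refine ⟨C₁ + C₂, min d₁ d₂, by positivity, lt_min hd₁ hd₂, fun δ hδ => ?_⟩
  obtain ⟨χ₁, S₁, H₁⟩ := h₁ δ ⟨hδ.1, hδ.2.trans_le (min_le_left _ _)⟩
  obtain ⟨χ₂, S₂, H₂⟩ := h₂ δ ⟨hδ.1, hδ.2.trans_le (min_le_right _ _)⟩
  have hd : ∀ x, fderiv ℝ (fun y => χ₁ y * χ₂ y) x
      = χ₁ x • fderiv ℝ χ₂ x + χ₂ x • fderiv ℝ χ₁ x := fun x =>
    fderiv_fun_mul (H₁.smooth.differentiable (by simp) x) (H₂.smooth.differentiable (by simp) x)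
  have hle : ∀ x a b, |χ₁ x * a + χ₂ x * b| ≤ |b| + |a| := fun x a b => by
    refine (abs_add_le _ _).trans ?_
    rw [abs_mul, abs_mul, abs_of_nonneg (H₁.nonneg x), abs_of_nonneg (H₂.nonneg x), add_comm]
    exact add_le_add (mul_le_of_le_one_left (abs_nonneg _) (H₂.le_one x))
      (mul_le_of_le_one_left (abs_nonneg _) (H₁.le_one x))
  refine ⟨fun x => χ₁ x * χ₂ x, S₁ ∪ S₂, ⟨H₁.smooth.mul H₂.smooth,
    fun x => mul_nonneg (H₁.nonneg x) (H₂.nonneg x),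
    fun x => mul_le_one₀ (H₁.le_one x) (H₂.nonneg x) (H₂.le_one x), ?_, H₁.meas.union H₂.meas,
    union_subset H₁.sub H₂.sub, ?_, ?_, ?_, ?_⟩⟩
  · rw [nhdsSet_union, eventually_sup]
    exact ⟨H₁.zero.mono fun x hx => by simp [hx], H₂.zero.mono fun x hx => by simp [hx]⟩
  · refine (measure_union_le _ _).trans ((add_le_add H₁.vol H₂.vol).trans_eq ?_)
    rw [← ENNReal.ofReal_add (mul_nonneg hC₁ hδ.1.le) (mul_nonneg hC₂ hδ.1.le), add_mul]
  · rintro x ⟨hx, hxS⟩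
    rw [mem_union, not_or] at hxS
    obtain ⟨a1, b1⟩ := H₁.off x ⟨hx, hxS.1⟩
    obtain ⟨a2, b2⟩ := H₂.off x ⟨hx, hxS.2⟩
    rw [hd]; simp [a1, b1, a2, b2]
  · intro x hx
    have hδ := hδ.1
    refine ContinuousLinearMap.opNorm_le_bound _ (by positivity) fun v => ?_
    rw [hd]
    calc ‖(χ₁ x • fderiv ℝ χ₂ x + χ₂ x • fderiv ℝ χ₁ x) v‖
        ≤ |fderiv ℝ χ₁ x v| + |fderiv ℝ χ₂ x v| := hle x _ _
      _ ≤ C₁ / δ * ‖v‖ + C₂ / δ * ‖v‖ := add_le_add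
          ((fderiv ℝ χ₁ x).le_of_opNorm_le (H₁.bound x hx) v)
          ((fderiv ℝ χ₂ x).le_of_opNorm_le (H₂.bound x hx) v)
      _ = _ := by ring
  · intro L V hV x hx
    rw [hd, add_mul]
    exact (hle x _ _).trans (add_le_add (H₁.tangent L V hV x hx) (H₂.tangent L V hV x hx))

lemma exists_abs_deriv_smoothTransition_le :
    ∃ M, 0 ≤ M ∧ ∀ t, |deriv Real.smoothTransition t| ≤ M := by
  have hc : Continuous (deriv Real.smoothTransition) :=
    (Real.smoothTransition.contDiff (n := 1)).continuous_deriv le_rfl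
  obtain ⟨M, hM⟩ := isCompact_Icc.exists_bound_of_continuousOn (s := Icc (0 : ℝ) 1) hc.continuousOn
  refine ⟨max M 0, le_max_right _ _, fun t => ?_⟩
  by_cases ht : t ∈ Icc (0 : ℝ) 1
  · exact (hM t ht).trans (le_max_left _ _)
  · have h0 : deriv Real.smoothTransition t = 0 := by
      rw [mem_Icc, not_and_or, not_le, not_le] at ht
      rcases ht with ht | ht
      · have : Real.smoothTransition =ᶠ[𝓝 t] fun _ => 0 := by
          filter_upwards [Iio_mem_nhds ht] with s hs
          exact Real.smoothTransition.zero_of_nonpos (le_of_lt hs)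
        rw [this.deriv_eq, deriv_const]
      · have : Real.smoothTransition =ᶠ[𝓝 t] fun _ => 1 := by
          filter_upwards [Ioi_mem_nhds ht] with s hs
          exact Real.smoothTransition.one_of_one_le (le_of_lt hs)
        rw [this.deriv_eq, deriv_const]
    rw [h0, abs_zero]; exact le_max_right _ _

end CompressibleFlow

/-! ### Construction of the cutoffs at the boundary. -/

namespace CompressibleFlow

/-- The cutoff is a smooth step in `φ / s`, with `φ` a defining function and `s` comparable to `δ`,
localised by a bump `ζ` of fixed size. Its steep part is a multiple of `dφ / s`. For tangent `V` one
has `dφ(V) = 0` on `∂Ω`, hence `dφ(V) = O(δ)` in the layer, which cancels the factor `1 / s`. -/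
lemma hasCutoffs_local {Ω : Set E3} (hΩ : IsSmoothBoundedOpen Ω) {x₀ : E3}
    (hx₀ : x₀ ∈ frontier Ω) : ∃ t ∈ 𝓝[frontier Ω] x₀, HasCutoffs Ω t := by
  obtain ⟨Ud, hU, φ, hφ, hd, hiff⟩ := hΩ.smooth_boundary x₀ hx₀
  have hφ1 : ContDiff ℝ 1 φ := hφ.of_le (by simp)
  have hφd : Differentiable ℝ φ := hφ1.differentiable one_ne_zero
  have hφc : Continuous (fderiv ℝ φ) := hφ1.continuous_fderiv one_ne_zero
  -- The value `2` at `x₀` leaves room for `dφ(w) ≥ 1` on a whole ball.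
  obtain ⟨w, hw⟩ : ∃ w, fderiv ℝ φ x₀ w = 2 := by
    obtain ⟨v, hv⟩ : ∃ v, fderiv ℝ φ x₀ v ≠ 0 := by
      by_contra hc
      push Not at hc
      exact hd (ContinuousLinearMap.ext hc)
    exact ⟨(2 / fderiv ℝ φ x₀ v) • v, by simp [hv]⟩
  -- a ball on which everything is controlled
  have hw1 : ∀ᶠ z in 𝓝 x₀, 1 ≤ fderiv ℝ φ z w := by
    have : ContinuousAt (fun z => fderiv ℝ φ z w) x₀ := (hφc.clm_apply continuous_const).continuousAt
    filter_upwards [this.eventually (lt_mem_nhds (show (1 : ℝ) < fderiv ℝ φ x₀ w by rw [hw]; norm_num))] with z hz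
    exact hz.le
  obtain ⟨K, tK, htK, hK⟩ : ∃ K, ∃ t ∈ 𝓝 x₀, LipschitzOnWith K (fderiv ℝ φ) t :=
    (((contDiff_infty.1 hφ 2).fderiv_right (m := 1) (by norm_num)).contDiffAt).exists_lipschitzOnWith
  have hM1 : ∀ᶠ z in 𝓝 x₀, ‖fderiv ℝ φ z‖ ≤ ‖fderiv ℝ φ x₀‖ + 1 := by
    filter_upwards [hφc.norm.continuousAt.eventually
      (gt_mem_nhds (show ‖fderiv ℝ φ x₀‖ < ‖fderiv ℝ φ x₀‖ + 1 by linarith))] with z hz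
    exact hz.le
  set M := ‖fderiv ℝ φ x₀‖ + 1 with hM
  have hMpos : 0 < M := by positivity
  obtain ⟨R', hR', hball⟩ := Metric.mem_nhds_iff.1
    (((hw1.and hM1).and (eventually_of_mem htK fun _ h => h)).and
      (eventually_of_mem hU fun _ h => h))
  set R := R' / 3 with hRdef
  have hR : 0 < R := by positivity
  have hR3 : R' = 3 * R := by rw [hRdef]; ring
  rw [hR3] at hball
  have hbw : ∀ z ∈ Metric.ball x₀ (3 * R), 1 ≤ fderiv ℝ φ z w := fun z hz => (hball hz).1.1.1
  have hbM : ∀ z ∈ Metric.ball x₀ (3 * R), ‖fderiv ℝ φ z‖ ≤ M := fun z hz => (hball hz).1.1.2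
  have hbK : LipschitzOnWith K (fderiv ℝ φ) (Metric.ball x₀ (3 * R)) :=
    hK.mono fun z hz => (hball hz).1.2
  have hbU : ∀ z ∈ Metric.ball x₀ (3 * R), z ∈ Ud := fun z hz => (hball hz).2
  have hUn : ∀ z ∈ Metric.ball x₀ (3 * R), Ud ∈ 𝓝 z := fun z hz =>
    Filter.mem_of_superset (Metric.isOpen_ball.mem_nhds hz) hbU
  obtain ⟨Cv, hCv, hvol⟩ := volume_slab_le hφd hR hbw
  obtain ⟨Mσ, hMσ, hσ⟩ := exists_abs_deriv_smoothTransition_le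
  let ζ : ContDiffBump x₀ := ⟨R / 2, R, by positivity, by linarith⟩
  obtain ⟨Mζ, hζ⟩ : ∃ Mζ, ∀ z, ‖fderiv ℝ ζ z‖ ≤ Mζ :=
    (ζ.hasCompactSupport.fderiv ℝ).exists_bound_of_continuous
      ((ζ.contDiff (n := 1)).continuous_fderiv one_ne_zero)
  have hMζ : 0 ≤ Mζ := (norm_nonneg _).trans (hζ x₀)
  set W := ‖w‖ + 1 with hW
  have hWpos : 0 < W := by positivity
  set D := M + K with hD
  have hDpos : 0 < D := by positivity
  set C := Cv + (Mζ * R + Mσ * (2 * W) * M) + (Mζ + Mσ * (2 * W) * D) with hC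
  refine ⟨frontier Ω ∩ Metric.ball x₀ (R / 2), ?_, C, R, by positivity, hR, fun δ hδ => ?_⟩
  · exact inter_mem_nhdsWithin _ (Metric.ball_mem_nhds _ (by positivity))
  have hδ0 := hδ.1
  -- Moving from a point of `{-s ≤ φ < 0}` along `w` for time `-φ` leaves `Ω`, after a path of
  -- length at most `s‖w‖ < δ`. So this slab lies in the layer of width `δ`.
  set s := δ / W with hs
  have hspos : 0 < s := by positivity
  have hsW : s * W = δ := by rw [hs]; field_simp
  -- The transition takes place for `g` in `[0, 1]`, that is `φ` in `[-s, -s/2]`: the cutoff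
  -- vanishes in a full neighbourhood of `φ = 0` and equals `1` below `-s`.
  set g : E3 → ℝ := fun x => -(2 / s) * φ x - 1 with hg
  have hgd : ∀ x, HasFDerivAt g (-(2 / s) • fderiv ℝ φ x) x := fun x =>
    ((hφd x).hasFDerivAt.const_mul _).sub_const 1
  have hgs : ContDiff ℝ ∞ g := (contDiff_const.mul hφ).sub contDiff_const
  have hgc : Continuous g := hgs.continuous
  set χ : E3 → ℝ := fun x => 1 - ζ x * (1 - Real.smoothTransition (g x)) with hχ
  set S : Set E3 := {x | x ∈ Ω ∧ x ∈ Metric.closedBall x₀ R ∧ -s ≤ φ x} with hS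
  have hSB : ∀ x ∈ S, x ∈ Metric.ball x₀ (3 * R) := fun x hx =>
    Metric.closedBall_subset_ball (by linarith) hx.2.1
  have hSφ : ∀ x ∈ S, φ x < 0 := fun x hx => (hiff x (hbU x (hSB x hx))).1 hx.1
  have hSsub : S ⊆ boundaryLayer Ω δ := by
    intro x hx
    refine ⟨hx.1, ?_⟩
    have hφx := hSφ x hx
    have ht : -φ x ≤ s := by linarith [hx.2.2]
    have hnorm : ‖(-φ x) • w‖ < δ := by
      rw [norm_smul, Real.norm_of_nonneg (by linarith)]
      calc -φ x * ‖w‖ ≤ s * ‖w‖ := mul_le_mul_of_nonneg_right ht (norm_nonneg _)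
        _ < s * W := mul_lt_mul_of_pos_left (by rw [hW]; linarith) hspos
        _ = δ := hsW
    have hmem : x + (-φ x) • w ∈ Metric.ball x₀ (3 * R) := by
      rw [mem_ball_iff_norm]
      have h1 : ‖x - x₀‖ ≤ R := by simpa [dist_eq_norm] using hx.2.1
      calc ‖x + (-φ x) • w - x₀‖ = ‖(x - x₀) + (-φ x) • w‖ := by congr 1; abel
        _ ≤ ‖x - x₀‖ + ‖(-φ x) • w‖ := norm_add_le _ _
        _ < 3 * R := by linarith [hδ.2]
    have h2 := add_le_of_one_le_fderiv hφd (convex_ball _ _) hbw (hSB x hx) (t := -φ x)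
      (by linarith) hmem
    have h3 : x + (-φ x) • w ∉ Ω := fun hc => by
      have := (hiff _ (hbU _ hmem)).1 hc
      linarith
    have h4 := bdryDist_le_of_notMem hx.1 h3
    rw [dist_self_add_right] at h4
    exact h4.trans_lt hnorm
  -- off `S` the cutoff is locally constant
  have hoff : ∀ x ∈ Ω \ S, χ =ᶠ[𝓝 x] fun _ => 1 := by
    rintro x ⟨hx, hxS⟩
    by_cases hxR : x ∈ Metric.closedBall x₀ R
    · have hlt : φ x < -s := by
        by_contra hc
        exact hxS ⟨hx, hxR, not_lt.1 hc⟩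
      filter_upwards [hφd.continuous.continuousAt.eventually (gt_mem_nhds hlt)] with y hy
      have : 1 ≤ g y := by
        have : 2 ≤ (2 / s) * (-φ y) := by
          rw [div_mul_eq_mul_div, le_div_iff₀ hspos]; linarith
        simp only [hg]; linarith
      simp [hχ, Real.smoothTransition.one_of_one_le this]
    · have : (Metric.closedBall x₀ R)ᶜ ∈ 𝓝 x := Metric.isClosed_closedBall.isOpen_compl.mem_nhds hxR
      filter_upwards [this] with y hy
      have hy' : ζ.rOut ≤ dist y x₀ := (not_le.1 (fun hc => hy hc)).le
      simp [hχ, ζ.zero_of_le_dist hy']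
  have hderiv : ∀ x, HasFDerivAt χ (-(ζ x • -(deriv Real.smoothTransition (g x) •
      (-(2 / s) • fderiv ℝ φ x)) + (1 - Real.smoothTransition (g x)) • fderiv ℝ ζ x)) x := by
    intro x
    have h1 : HasFDerivAt (fun x => Real.smoothTransition (g x))
        (deriv Real.smoothTransition (g x) • (-(2 / s) • fderiv ℝ φ x)) x :=
      (((Real.smoothTransition.contDiff (n := 1)).differentiable one_ne_zero
        (g x)).hasDerivAt).comp_hasFDerivAt x (hgd x)
    have h2 : HasFDerivAt ζ (fderiv ℝ ζ x) x :=
      ((ζ.contDiff (n := 1)).differentiable one_ne_zero x).hasFDerivAt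
    exact (h2.mul (h1.const_sub 1)).const_sub 1
  have hest : ∀ x v, |fderiv ℝ χ x v| ≤ Mζ * ‖v‖ + Mσ * (2 / s) * |fderiv ℝ φ x v| := by
    intro x v
    rw [(hderiv x).fderiv]
    have e1 : (-(ζ x • -(deriv Real.smoothTransition (g x) •
      (-(2 / s) • fderiv ℝ φ x)) + (1 - Real.smoothTransition (g x)) • fderiv ℝ ζ x)) v
      = -(ζ x * (deriv Real.smoothTransition (g x) * ((2 / s) * fderiv ℝ φ x v)))
        - (1 - Real.smoothTransition (g x)) * fderiv ℝ ζ x v := by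
      simp; ring
    rw [e1]
    refine (abs_sub _ _).trans ?_
    rw [abs_neg, abs_mul, abs_mul, abs_mul, abs_mul, abs_of_nonneg ζ.nonneg,
      abs_of_pos (by positivity : 0 < 2 / s), add_comm]
    have h1 : |1 - Real.smoothTransition (g x)| ≤ 1 := by
      have := Real.smoothTransition.nonneg (g x)
      have := Real.smoothTransition.le_one (g x)
      rw [abs_le]; constructor <;> linarith
    refine add_le_add ?_ ?_
    · calc _ ≤ 1 * |fderiv ℝ ζ x v| := mul_le_mul_of_nonneg_right h1 (abs_nonneg _)
        _ ≤ Mζ * ‖v‖ := by rw [one_mul]; exact (fderiv ℝ ζ x).le_of_opNorm_le (hζ x) v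
    · calc _ ≤ 1 * (|deriv Real.smoothTransition (g x)| * (2 / s * |fderiv ℝ φ x v|)) :=
            mul_le_mul_of_nonneg_right ζ.le_one (by positivity)
        _ ≤ Mσ * (2 / s * |fderiv ℝ φ x v|) := by
            rw [one_mul]; exact mul_le_mul_of_nonneg_right (hσ _) (by positivity)
        _ = _ := by ring
  have h2s : 2 / s = 2 * W / δ := by rw [← hsW]; field_simp
  refine ⟨χ, S, ⟨?_, ?_, ?_, ?_, ?_, hSsub, ?_, ?_, ?_, ?_⟩⟩
  · exact contDiff_const.sub (ζ.contDiff.mul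
      (contDiff_const.sub (Real.smoothTransition.contDiff.comp hgs)))
  · intro x
    have h1 := Real.smoothTransition.nonneg (g x)
    have h2 := Real.smoothTransition.le_one (g x)
    have h3 : ζ x * (1 - Real.smoothTransition (g x)) ≤ 1 :=
      mul_le_one₀ ζ.le_one (by linarith) (by linarith)
    simp only [hχ]; linarith
  · intro x
    have h2 := Real.smoothTransition.le_one (g x)
    have h3 : 0 ≤ ζ x * (1 - Real.smoothTransition (g x)) :=
      mul_nonneg ζ.nonneg (by linarith)
    simp only [hχ]; linarith
  · rw [eventually_nhdsSet_iff_forall]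
    rintro x ⟨hxf, hxR⟩
    have hx3 : x ∈ Metric.ball x₀ (3 * R) := Metric.ball_subset_ball (by linarith) hxR
    have hφx : φ x = 0 := definingFunction_eq_zero hΩ.isOpen hxf (hUn x hx3) hφd.continuous hiff
    have h1 : g x < 0 := by simp [hg, hφx]
    filter_upwards [hgc.continuousAt.eventually (gt_mem_nhds h1),
      ζ.eventuallyEq_one_of_mem_ball hxR] with y hy hy2
    simp [hχ, hy2, Real.smoothTransition.zero_of_nonpos hy.le]
  · exact hΩ.isOpen.measurableSet.inter (Metric.isClosed_closedBall.measurableSet.inter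
      (measurableSet_le measurable_const hφd.continuous.measurable))
  · refine (measure_mono fun x hx => ?_).trans ((hvol s hspos).trans (ENNReal.ofReal_le_ofReal ?_))
    · exact ⟨hx.2.1, hx.2.2, hSφ x hx⟩
    · have h1 : s ≤ δ := by
        rw [← hsW]; exact le_mul_of_one_le_right hspos.le (by rw [hW]; linarith [norm_nonneg w])
      calc Cv * s ≤ Cv * δ := mul_le_mul_of_nonneg_left h1 hCv
        _ ≤ C * δ := by
          refine mul_le_mul_of_nonneg_right ?_ hδ0.le
          have : 0 ≤ (Mζ * R + Mσ * (2 * W) * M) + (Mζ + Mσ * (2 * W) * D) := by positivity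
          linarith
  · intro x hx
    have h := hoff x hx
    exact ⟨h.eq_of_nhds, by rw [h.fderiv_eq, fderiv_fun_const]; rfl⟩
  · intro x hx
    by_cases hxS : x ∈ S
    · refine ContinuousLinearMap.opNorm_le_bound _ (by positivity) fun v => ?_
      refine (hest x v).trans ?_
      have h1 : |fderiv ℝ φ x v| ≤ M * ‖v‖ := (fderiv ℝ φ x).le_of_opNorm_le (hbM x (hSB x hxS)) v
      have h2 : Mζ ≤ Mζ * R / δ := by
        rw [le_div_iff₀ hδ0]; exact mul_le_mul_of_nonneg_left hδ.2.le hMζ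
      calc _ ≤ Mζ * R / δ * ‖v‖ + Mσ * (2 * W / δ) * (M * ‖v‖) := by rw [h2s]; gcongr
        _ = (Mζ * R + Mσ * (2 * W) * M) / δ * ‖v‖ := by ring
        _ ≤ C / δ * ‖v‖ := by
          gcongr
          have : 0 ≤ Mζ + Mσ * (2 * W) * D := by positivity
          linarith
    · have h := hoff x ⟨hx, hxS⟩
      rw [h.fderiv_eq, fderiv_fun_const]
      simp; positivity
  · intro L V hV x hx
    have hL := hV.bound_nonneg hx
    by_cases hxS : x ∈ S
    · refine (hest x (V x)).trans ?_
      -- Compare with a nearest boundary point `y`, where `dφ(V) = 0`: moving from `y` to `x`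
      -- changes `dφ` by `K d_Ω(x)` and `V` by `L d_Ω(x)` at most.
      obtain ⟨y, hyf, hxy⟩ := isClosed_frontier.exists_infDist_eq_dist ⟨x₀, hx₀⟩ x
      have hdx : bdryDist Ω x < δ := (hSsub hxS).2
      have hdist : dist x y = bdryDist Ω x := hxy.symm
      have hyB : y ∈ Metric.ball x₀ (3 * R) := by
        rw [Metric.mem_ball]
        have h1 : dist x x₀ ≤ R := hxS.2.1
        have h2 := dist_triangle_left y x₀ x
        linarith [hδ.2]
      have hdy : fderiv ℝ φ y ≠ 0 := fun h0 => by
        have := hbw y hyB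
        rw [h0] at this; simp at this; linarith
      have h0 := fderiv_eq_zero_of_inner_outwardNormal hΩ.isOpen hyf (hUn y hyB) hφ1 hdy hiff
        (hV.boundary y hyf)
      have h1 := hV.norm_sub_le hΩ.isOpen hx hyf hdist
      have h2 : ‖fderiv ℝ φ x - fderiv ℝ φ y‖ ≤ K * dist x y := by
        rw [← dist_eq_norm]; exact hbK.dist_le_mul x (hSB x hxS) y hyB
      have e1 : fderiv ℝ φ x (V x)
          = (fderiv ℝ φ x - fderiv ℝ φ y) (V x) - fderiv ℝ φ y (V y - V x) := by
        simp [h0]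
      have h3 : |fderiv ℝ φ x (V x)| ≤ D * L * δ := by
        rw [e1]
        refine (abs_sub _ _).trans ?_
        have a1 : |(fderiv ℝ φ x - fderiv ℝ φ y) (V x)| ≤ (K * dist x y) * L :=
          (ContinuousLinearMap.le_of_opNorm_le _ h2 _).trans
            (mul_le_mul_of_nonneg_left (hV.norm_le x hx) (by positivity))
        have a2 : |fderiv ℝ φ y (V y - V x)| ≤ M * (L * dist x y) :=
          (ContinuousLinearMap.le_of_opNorm_le _ (hbM y hyB) _).trans
            (mul_le_mul_of_nonneg_left (by rwa [dist_comm, dist_eq_norm]) hMpos.le)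
        calc _ ≤ (K * dist x y) * L + M * (L * dist x y) := add_le_add a1 a2
          _ = D * L * dist x y := by rw [hD]; ring
          _ ≤ D * L * δ := mul_le_mul_of_nonneg_left (hdist ▸ hdx.le) (by positivity)
      calc _ ≤ Mζ * L + Mσ * (2 * W / δ) * (D * L * δ) := by
            rw [h2s]; have := hV.norm_le x hx; gcongr
        _ = (Mζ + Mσ * (2 * W) * D) * L := by field_simp
        _ ≤ C * L := by
          gcongr
          have : 0 ≤ Cv + (Mζ * R + Mσ * (2 * W) * M) := by positivity
          linarith
    · have h := hoff x ⟨hx, hxS⟩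
      rw [h.fderiv_eq, fderiv_fun_const]
      simp; positivity

lemma hasCutoffs_frontier {Ω : Set E3} (hΩ : IsSmoothBoundedOpen Ω) :
    HasCutoffs Ω (frontier Ω) := by
  have hc : IsCompact (frontier Ω) :=
    Metric.isCompact_of_isClosed_isBounded isClosed_frontier
      (hΩ.isBounded.closure.subset frontier_subset_closure)
  exact hc.induction_on (hasCutoffs_empty Ω) (fun _ _ h => HasCutoffs.mono h)
    (fun _ _ => HasCutoffs.union) fun x hx => hasCutoffs_local hΩ hx

/-- Removing from the compact closure an open neighbourhood of `∂Ω` on which `χ` vanishes leaves a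
compact subset of `Ω`; hence `χU` is admissible in the momentum equation. -/
lemma IsCutoff.exists_isCompact {Ω : Set E3} (hΩ : IsSmoothBoundedOpen Ω) {C δ : ℝ} {χ : E3 → ℝ}
    {S : Set E3} (h : IsCutoff Ω (frontier Ω) C δ χ S) :
    ∃ K, IsCompact K ∧ K ⊆ Ω ∧ ∀ x ∈ Ω \ K, χ x = 0 := by
  obtain ⟨O, hO, hsub, hz⟩ := eventually_nhdsSet_iff_exists.1 h.zero
  refine ⟨closure Ω \ O, ?_, ?_, ?_⟩
  · exact (Metric.isCompact_of_isClosed_isBounded isClosed_closure hΩ.isBounded.closure).diff hO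
  · rintro x ⟨hx, hxO⟩
    by_contra hxΩ
    exact hxO (hsub (by rw [hΩ.isOpen.frontier_eq]; exact ⟨hx, hxΩ⟩))
  · rintro x ⟨hx, hxK⟩
    refine hz x ?_
    by_contra hxO
    exact hxK ⟨subset_closure hx, hxO⟩

end CompressibleFlow

namespace CompressibleFlow

/-! ### The relative energy density and its rate of change -/

/-- The relative energy density of the state `(s, v)` with respect to the state `(r, V)`. -/
noncomputable def relEnergy (γ s : ℝ) (v : E3) (r : ℝ) (V : E3) : ℝ :=
  1 / 2 * s * ‖v - V‖ ^ 2 + relPressure γ s r / (γ - 1)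

lemma relEnergy_nonneg {γ s r : ℝ} (hγ : 1 < γ) (hs : 0 ≤ s) (hr : 0 ≤ r) (v V : E3) :
    0 ≤ relEnergy γ s v r V :=
  add_nonneg (by positivity) (div_nonneg (relPressure_nonneg hγ hs hr) (by linarith))

lemma relPressure_le_relEnergy {γ s r : ℝ} (hγ : 1 < γ) (hs : 0 ≤ s) (v V : E3) :
    relPressure γ s r ≤ (γ - 1) * relEnergy γ s v r V := by
  have h1 : 0 < γ - 1 := by linarith
  have h2 : 0 ≤ (γ - 1) * (1 / 2 * s * ‖v - V‖ ^ 2) := by positivity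
  have h3 : (γ - 1) * relEnergy γ s v r V
      = (γ - 1) * (1 / 2 * s * ‖v - V‖ ^ 2) + relPressure γ s r := by
    rw [relEnergy]; field_simp
  linarith

lemma kinetic_le_relEnergy {γ s r : ℝ} (hγ : 1 < γ) (hs : 0 ≤ s) (hr : 0 ≤ r) (v V : E3) :
    s * ‖v - V‖ ^ 2 ≤ 2 * relEnergy γ s v r V := by
  have := div_nonneg (relPressure_nonneg hγ hs hr) (by linarith : (0 : ℝ) ≤ γ - 1)
  rw [relEnergy]; linarith

lemma le_rpow_add_one {γ s : ℝ} (hγ : 1 < γ) (hs : 0 ≤ s) : s ≤ s ^ γ + 1 := by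
  have := le_add_mul_rpow hγ one_pos hs
  simpa [add_comm] using this

/-- The state variables are controlled by the relative energy density. -/
lemma exists_state_le_relEnergy {γ b : ℝ} (L : ℝ) (hγ : 1 < γ) (hb : 0 < b) :
    ∃ C, 0 ≤ C ∧ ∀ s r v V, 0 ≤ s → 0 ≤ r → r ≤ b → ‖V‖ ≤ L →
      s ≤ C * (relEnergy γ s v r V + 1) ∧ s ^ γ ≤ C * (relEnergy γ s v r V + 1) ∧
      s * ‖v‖ ^ 2 ≤ C * (relEnergy γ s v r V + 1) := by
  obtain ⟨C₁, hC₁, h₁⟩ := exists_rpow_le_relPressure hγ hb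
  set C₂ := 2 * (γ - 1) + C₁ + 1 with hC₂
  have hg : 0 < γ - 1 := by linarith
  refine ⟨4 + 2 * L ^ 2 * C₂ + C₂, by positivity, fun s r v V hs hr hrb hV => ?_⟩
  have he := relEnergy_nonneg hγ hs hr v V
  have hp := relPressure_le_relEnergy (r := r) hγ hs v V
  have hk := kinetic_le_relEnergy hγ hs hr v V
  have hγs := h₁ s r hs hr hrb
  set E := relEnergy γ s v r V
  have h2 : s ^ γ + 1 ≤ C₂ * (E + 1) := by
    have : 0 ≤ (C₁ + 1) * E := by positivity
    nlinarith
  have h3 : s ≤ C₂ * (E + 1) := (le_rpow_add_one hγ hs).trans h2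
  have h4 : s * ‖v‖ ^ 2 ≤ 2 * (s * ‖v - V‖ ^ 2) + 2 * L ^ 2 * s := by
    have a1 : ‖v‖ ≤ ‖v - V‖ + L := by
      have := norm_sub_norm_le v V
      linarith
    have a2 : ‖v‖ ^ 2 ≤ 2 * ‖v - V‖ ^ 2 + 2 * L ^ 2 := by
      have := pow_le_pow_left₀ (norm_nonneg v) a1 2
      nlinarith [sq_nonneg (‖v - V‖ - L)]
    have := mul_le_mul_of_nonneg_left a2 hs
    linarith
  have h5 : 0 ≤ (4 + 2 * L ^ 2 * C₂) * (E + 1) := by positivity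
  have h6 : 2 * L ^ 2 * s ≤ 2 * L ^ 2 * (C₂ * (E + 1)) := mul_le_mul_of_nonneg_left h3 (by positivity)
  have h7 : 0 ≤ C₂ * (E + 1) := by positivity
  refine ⟨by linarith, by linarith, ?_⟩
  linarith

lemma sum_apply_mul_e (ℓ : E3 →L[ℝ] ℝ) (V : E3) : ∑ i, ℓ (e i) * V i = ℓ V := by
  have h : V = ∑ i, V i • e i := by
    ext j
    simp [e_apply]
  conv_rhs => rw [h]
  simp [mul_comm]

lemma tr_add_smul_smulRight (k : ℝ) (A : E3 →L[ℝ] E3) (ℓ : E3 →L[ℝ] ℝ) (V : E3) :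
    tr (k • A + ℓ.smulRight V) = k * tr A + ℓ V := by
  rw [← sum_apply_mul_e ℓ V]
  simp [tr, Finset.sum_add_distrib, Finset.mul_sum]

lemma frob_add_smul (k : ℝ) (B A A' : E3 →L[ℝ] E3) :
    frob B (k • A + A') = k * frob B A + frob B A' := by
  simp only [frob, Fin.sum_univ_three]
  simp
  ring

lemma frob_smulRight_le (ℓ : E3 →L[ℝ] ℝ) (V : E3) :
    frob (ℓ.smulRight V) (ℓ.smulRight V) ≤ 9 * (‖ℓ‖ * ‖V‖) ^ 2 := by
  simpa using frob_self_le (ℓ.smulRight V)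

/-- Pointwise identity behind the relative energy inequality. -/
lemma relEnergy_rate_eq {γ ε μ η k s R rt : ℝ} {v V Vt : E3} {A G : E3 →L[ℝ] E3}
    {dr ℓ : E3 →L[ℝ] ℝ} (hγ : 1 < γ) (hR : 0 < R)
    (hmass : rt + dr V + R * tr A = 0)
    (hmom : ∀ w, R * inner ℝ (Vt + A V) w + γ * R ^ (γ - 1) * dr w = 0) :
    (s * (inner ℝ V Vt - γ * R ^ (γ - 2) * rt) + s * (inner ℝ V (A v) - γ * R ^ (γ - 2) * dr v))
      - (inner ℝ (s • v) (k • Vt) + s * inner ℝ v ((k • A + ℓ.smulRight V) v)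
        + s ^ γ * tr (k • A + ℓ.smulRight V)
        - ε * frob (stress μ η G) (k • A + ℓ.smulRight V))
      + (γ * R ^ (γ - 1) * rt
        + (R ^ γ * tr (k • A + ℓ.smulRight V) + k * (γ * R ^ (γ - 1) * dr V)))
    = -(s * inner ℝ (v - V) (A (v - V))) - relPressure γ s R * tr A
      + (1 - k) * (s * inner ℝ v Vt + s * inner ℝ v (A v) + (s ^ γ - R ^ γ) * tr A
        - γ * R ^ (γ - 1) * dr V)
      - s * inner ℝ v V * ℓ v - (s ^ γ - R ^ γ) * ℓ V
      + ε * k * frob (stress μ η G) A + ε * frob (stress μ η G) (ℓ.smulRight V) := by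
  have hR1 : R ^ (γ - 1) = R ^ (γ - 2) * R := by
    rw [← Real.rpow_add_one hR.ne']; congr 1; ring
  have hR2 : R ^ γ = R ^ (γ - 2) * R * R := by
    rw [← hR1, rpow_sub_one_mul_self hR.le hγ]
  -- The Euler momentum equation divided by the density and tested with `V - v`. The identity then
  -- follows by adding `s` times this and `γ R^(γ-1) - s γ R^(γ-2)` times the mass equation.
  have hm : inner ℝ (Vt + A V) (V - v) + γ * R ^ (γ - 2) * dr (V - v) = 0 := by
    have := hmom (V - v)
    rw [hR1] at this
    have h2 : R * (inner ℝ (Vt + A V) (V - v) + γ * R ^ (γ - 2) * dr (V - v)) = 0 := by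
      linarith
    exact (mul_eq_zero.1 h2).resolve_left hR.ne'
  rw [tr_add_smul_smulRight, frob_add_smul, relPressure, hR2, hR1]
  simp only [inner_sub_left, inner_sub_right, inner_add_left, inner_add_right, map_sub,
    inner_smul_left, inner_smul_right, add_apply,
    smul_apply, ContinuousLinearMap.smulRight_apply] at hm ⊢
  rw [real_inner_comm V Vt, real_inner_comm v Vt, real_inner_comm V (A V),
    real_inner_comm v (A V)] at hm
  simp only [conj_trivial]
  linear_combination s * hm + (γ * R ^ (γ - 2) * R - s * γ * R ^ (γ - 2)) * hmass

end CompressibleFlow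

/-! ### Pointwise estimate of the remainder. -/

namespace CompressibleFlow

set_option maxHeartbeats 2000000 in
/-- Pointwise bound on the rate of change of the relative energy, in and off the layer. -/
lemma exists_relEnergy_rate_le {γ b L μ η C₀ : ℝ} (hγ : 1 < γ) (hb : 0 < b) (hL : 0 ≤ L)
    (hμ : 0 ≤ μ) (hη : 0 ≤ η) (hC₀ : 0 ≤ C₀) :
    ∃ C, 0 ≤ C ∧ ∀ (ε δ k l s R i : ℝ) (v V Vt : E3) (A G : E3 →L[ℝ] E3) (dr ℓ : E3 →L[ℝ] ℝ),
      0 < ε → 0 < δ → 0 ≤ k → k ≤ 1 → 0 < l → 0 ≤ s → 0 < R → R ≤ b →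
      ‖V‖ ≤ L → ‖Vt‖ ≤ L → ‖A‖ ≤ L → ‖dr‖ ≤ L → ‖ℓ‖ ≤ C₀ / δ → |ℓ V| ≤ C₀ →
      0 ≤ i → (i = 1 ∨ k = 1 ∧ ℓ = 0) →
      -(s * inner ℝ (v - V) (A (v - V))) - relPressure γ s R * tr A
        + (1 - k) * (s * inner ℝ v Vt + s * inner ℝ v (A v) + (s ^ γ - R ^ γ) * tr A
          - γ * R ^ (γ - 1) * dr V)
        - s * inner ℝ v V * ℓ v - (s ^ γ - R ^ γ) * ℓ V
        + ε * k * frob (stress μ η G) A + ε * frob (stress μ η G) (ℓ.smulRight V)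
      ≤ C * relEnergy γ s v R V + ε * frob (stress μ η G) G / 2 + C * ε
        + i * (C + C / δ * (s * ‖v‖ ^ 2) + C / l * (ε * frob G G) + C * l * (ε / δ ^ 2)) := by
  obtain ⟨C₁, hC₁, h₁⟩ := exists_state_le_relEnergy L hγ hb
  set D := 2 * μ + 3 * η with hD
  have hDp : 0 ≤ D := by positivity
  set P := γ * b ^ (γ - 1) * (L * L) with hP
  have hPp : 0 ≤ P := by positivity
  set B := b ^ γ with hB
  have hBp : 0 ≤ B := by positivity
  have hg : 0 ≤ γ - 1 := by linarith
  -- `Q` bounds the layer terms of size `E + 1`: the bracket multiplied by `1 - k`, and the pressure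
  -- against `ℓ V`. Their `E` part goes to Gronwall and their constant part is charged to the layer
  -- through `i`.
  set Q := L * (2 * C₁) + L * C₁ + 3 * L * (C₁ + B) + P + (C₁ + B) * C₀ with hQ
  set C := (2 * L + 3 * L * (γ - 1)) + Q + L * C₀ + 9 * D * L ^ 2 + D + 9 * D * (C₀ * L) ^ 2 with hC
  have hQp : 0 ≤ Q := by positivity
  have hCQ : 2 * L + 3 * L * (γ - 1) + Q ≤ C := by
    have : 0 ≤ L * C₀ + 9 * D * L ^ 2 + D + 9 * D * (C₀ * L) ^ 2 := by positivity
    linarith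
  have hCp : 0 ≤ C := by positivity
  refine ⟨C, hCp, ?_⟩
  intro ε δ k l s R i v V Vt A G dr ℓ hε hδ hk hk1 hl hs hR hRb hV hVt hA hdr hℓ hℓV hi hcases
  obtain ⟨e1, e2, e3⟩ := h₁ s R v V hs hR.le hRb hV
  have he := relEnergy_nonneg hγ hs hR.le v V
  have hp := relPressure_le_relEnergy (r := R) hγ hs v V
  have hp0 := relPressure_nonneg hγ hs hR.le
  have hkin := kinetic_le_relEnergy hγ hs hR.le v V
  have hSG := frob_stress_self_nonneg hμ hη G
  set E := relEnergy γ s v R V with hE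
  have trA : |tr A| ≤ 3 * L := (abs_tr_le A).trans (by linarith)
  -- the bulk terms
  have t1 : -(s * inner ℝ (v - V) (A (v - V))) ≤ 2 * L * E := by
    have a1 : |inner ℝ (v - V) (A (v - V))| ≤ L * ‖v - V‖ ^ 2 := by
      refine (abs_real_inner_le_norm _ _).trans ?_
      calc ‖v - V‖ * ‖A (v - V)‖ ≤ ‖v - V‖ * (L * ‖v - V‖) :=
            mul_le_mul_of_nonneg_left (A.le_of_opNorm_le hA _) (norm_nonneg _)
        _ = _ := by ring
    have a2 := neg_le_of_abs_le a1
    have a3 := mul_le_mul_of_nonneg_left a2 hs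
    have a4 := mul_le_mul_of_nonneg_left hkin hL
    linarith
  have t2 : -(relPressure γ s R * tr A) ≤ 3 * L * (γ - 1) * E := by
    have a2 := neg_le_of_abs_le trA
    have a3 := mul_le_mul_of_nonneg_left a2 hp0
    have a4 := mul_le_mul_of_nonneg_left hp (by positivity : 0 ≤ 3 * L)
    linarith
  -- Cauchy–Schwarz with weight `1` spends half of the dissipation.
  have t6 : ε * k * frob (stress μ η G) A ≤ ε * frob (stress μ η G) G / 2 + 9 * D * L ^ 2 * ε := by
    have a1 := abs_frob_stress_le (s := 1) hμ hη one_pos G A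
    have a2 := frob_stress_self_le hμ hη A
    have a3 : frob A A ≤ 9 * L ^ 2 := (frob_self_le A).trans (by gcongr)
    have a4 : frob (stress μ η A) A ≤ 9 * D * L ^ 2 :=
      (a2.trans (mul_le_mul_of_nonneg_left a3 hDp)).trans_eq (by ring)
    have a5 : k * frob (stress μ η G) A ≤ |frob (stress μ η G) A| := by
      calc k * frob (stress μ η G) A ≤ k * |frob (stress μ η G) A| :=
            mul_le_mul_of_nonneg_left (le_abs_self _) hk
        _ ≤ _ := mul_le_of_le_one_left (abs_nonneg _) hk1
    have a6 : k * frob (stress μ η G) A ≤ frob (stress μ η G) G / 2 + 9 * D * L ^ 2 := by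
      have : 0 ≤ 9 * D * L ^ 2 := by positivity
      rw [inv_one, one_mul, one_mul] at a1
      linarith
    have := mul_le_mul_of_nonneg_left a6 hε.le
    linarith
  have hC9 : 9 * D * L ^ 2 ≤ C := by
    have : 0 ≤ (2 * L + 3 * L * (γ - 1)) + Q + L * C₀ + D + 9 * D * (C₀ * L) ^ 2 := by positivity
    linarith
  have hC9ε := mul_le_mul_of_nonneg_right hC9 hε.le
  have hfG := frob_nonneg G
  rcases hcases with rfl | ⟨rfl, rfl⟩
  swap
  · have hi0 : 0 ≤ i * (C + C / δ * (s * ‖v‖ ^ 2) + C / l * (ε * frob G G)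
        + C * l * (ε / δ ^ 2)) := by positivity
    have z : frob (stress μ η G) ((0 : E3 →L[ℝ] ℝ).smulRight V) = 0 := by simp [frob]
    rw [z]
    have : (2 * L + 3 * L * (γ - 1)) * E ≤ C * E :=
      mul_le_mul_of_nonneg_right (by linarith) he
    simp only [zero_apply]
    linarith
  -- the layer terms
  have hRg : R ^ γ ≤ B := Real.rpow_le_rpow hR.le hRb (by linarith)
  have hRg0 := Real.rpow_nonneg hR.le γ
  have hsg0 := Real.rpow_nonneg hs γ
  have hsR : |s ^ γ - R ^ γ| ≤ (C₁ + B) * (E + 1) := by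
    have : 0 ≤ B * E := by positivity
    have : 0 ≤ C₁ * (E + 1) := by positivity
    rw [abs_le]; constructor <;> linarith
  have t3 : (1 - k) * (s * inner ℝ v Vt + s * inner ℝ v (A v) + (s ^ γ - R ^ γ) * tr A
          - γ * R ^ (γ - 1) * dr V)
      ≤ (L * (2 * C₁) + L * C₁ + 3 * L * (C₁ + B) + P) * (E + 1) := by
    have b1 : |s * inner ℝ v Vt| ≤ L * (2 * C₁) * (E + 1) := by
      rw [abs_mul, abs_of_nonneg hs]
      have c1 : |inner ℝ v Vt| ≤ L * (1 + ‖v‖ ^ 2) := by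
        refine (abs_real_inner_le_norm _ _).trans ?_
        have c2 : ‖v‖ ≤ 1 + ‖v‖ ^ 2 := by nlinarith [sq_nonneg (‖v‖ - 1)]
        calc ‖v‖ * ‖Vt‖ ≤ (1 + ‖v‖ ^ 2) * L := mul_le_mul c2 hVt (norm_nonneg _) (by positivity)
          _ = _ := by ring
      calc s * |inner ℝ v Vt| ≤ s * (L * (1 + ‖v‖ ^ 2)) := mul_le_mul_of_nonneg_left c1 hs
        _ = L * (s + s * ‖v‖ ^ 2) := by ring
        _ ≤ L * (C₁ * (E + 1) + C₁ * (E + 1)) := by gcongr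
        _ = _ := by ring
    have b2 : |s * inner ℝ v (A v)| ≤ L * C₁ * (E + 1) := by
      rw [abs_mul, abs_of_nonneg hs]
      have c1 : |inner ℝ v (A v)| ≤ L * ‖v‖ ^ 2 := by
        refine (abs_real_inner_le_norm _ _).trans ?_
        calc ‖v‖ * ‖A v‖ ≤ ‖v‖ * (L * ‖v‖) :=
              mul_le_mul_of_nonneg_left (A.le_of_opNorm_le hA _) (norm_nonneg _)
          _ = _ := by ring
      calc s * |inner ℝ v (A v)| ≤ s * (L * ‖v‖ ^ 2) := mul_le_mul_of_nonneg_left c1 hs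
        _ = L * (s * ‖v‖ ^ 2) := by ring
        _ ≤ L * (C₁ * (E + 1)) := by gcongr
        _ = _ := by ring
    have b3 : |(s ^ γ - R ^ γ) * tr A| ≤ 3 * L * (C₁ + B) * (E + 1) := by
      rw [abs_mul]
      calc _ ≤ ((C₁ + B) * (E + 1)) * (3 * L) :=
            mul_le_mul hsR trA (abs_nonneg _) (by positivity)
        _ = _ := by ring
    have b4 : |γ * R ^ (γ - 1) * dr V| ≤ P * (E + 1) := by
      have c1 : R ^ (γ - 1) ≤ b ^ (γ - 1) := Real.rpow_le_rpow hR.le hRb hg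
      have c2 : |dr V| ≤ L * L := (dr.le_of_opNorm_le hdr V).trans (by gcongr)
      have c3 : 0 ≤ R ^ (γ - 1) := Real.rpow_nonneg hR.le _
      have c4 : 0 ≤ P * E := by positivity
      rw [abs_mul, abs_mul, abs_of_pos (by linarith : 0 < γ), abs_of_nonneg c3]
      have : γ * R ^ (γ - 1) * |dr V| ≤ P := by rw [hP]; gcongr
      linarith
    set X := s * inner ℝ v Vt + s * inner ℝ v (A v) + (s ^ γ - R ^ γ) * tr A
          - γ * R ^ (γ - 1) * dr V with hX
    have b5 : X ≤ (L * (2 * C₁) + L * C₁ + 3 * L * (C₁ + B) + P) * (E + 1) := by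
      have := le_of_abs_le b1
      have := le_of_abs_le b2
      have := le_of_abs_le b3
      have := neg_le_of_abs_le b4
      linarith
    have b6 : 0 ≤ (L * (2 * C₁) + L * C₁ + 3 * L * (C₁ + B) + P) * (E + 1) := by positivity
    calc (1 - k) * X ≤ (1 - k) * ((L * (2 * C₁) + L * C₁ + 3 * L * (C₁ + B) + P) * (E + 1)) :=
          mul_le_mul_of_nonneg_left b5 (by linarith)
      _ ≤ _ := mul_le_of_le_one_left b6 (by linarith)
  -- Only the size `1 / δ` of `ℓ` is available, since `v` is not tangent. The Kato-type hypothesis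
  -- compensates for it after integration.
  have t4 : -(s * inner ℝ v V * ℓ v) ≤ (L * C₀) / δ * (s * ‖v‖ ^ 2) := by
    refine (neg_le_abs _).trans ?_
    rw [abs_mul, abs_mul, abs_of_nonneg hs]
    have c1 : |inner ℝ v V| ≤ ‖v‖ * L := (abs_real_inner_le_norm _ _).trans (by gcongr)
    have c2 : |ℓ v| ≤ C₀ / δ * ‖v‖ := ℓ.le_of_opNorm_le hℓ v
    calc s * |inner ℝ v V| * |ℓ v| ≤ s * (‖v‖ * L) * (C₀ / δ * ‖v‖) := by gcongr
      _ = _ := by ring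
  have t5 : -((s ^ γ - R ^ γ) * ℓ V) ≤ (C₁ + B) * C₀ * (E + 1) := by
    refine (neg_le_abs _).trans ?_
    rw [abs_mul]
    calc _ ≤ ((C₁ + B) * (E + 1)) * C₀ := mul_le_mul hsR hℓV (abs_nonneg _) (by positivity)
      _ = _ := by ring
  -- Young with weight `l`, small later: the gradient part, amplified by `1 / l`, is controlled by
  -- hypothesis, while `l ε / δ²` has to be small by the choice of `l`.
  have t7 : ε * frob (stress μ η G) (ℓ.smulRight V)
      ≤ D / l * (ε * frob G G) + 9 * D * (C₀ * L) ^ 2 * l * (ε / δ ^ 2) := by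
    have a1 := abs_frob_stress_le hμ hη (inv_pos.2 hl) G (ℓ.smulRight V)
    rw [inv_inv] at a1
    have a2 := frob_stress_self_le hμ hη G
    have a3 := frob_stress_self_le hμ hη (ℓ.smulRight V)
    have a4 : frob (ℓ.smulRight V) (ℓ.smulRight V) ≤ 9 * (C₀ / δ * L) ^ 2 :=
      (frob_smulRight_le ℓ V).trans (by gcongr)
    have a5 := mul_le_mul_of_nonneg_left a4 hDp
    have a6 := frob_nonneg G
    have a7 : frob (stress μ η G) (ℓ.smulRight V)
        ≤ l⁻¹ * (D * frob G G) + l * (D * (9 * (C₀ / δ * L) ^ 2)) := by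
      have b1 := le_abs_self (frob (stress μ η G) (ℓ.smulRight V))
      have b2 : l⁻¹ * frob (stress μ η G) G ≤ l⁻¹ * (D * frob G G) :=
        mul_le_mul_of_nonneg_left a2 (inv_nonneg.2 hl.le)
      have b3 := mul_le_mul_of_nonneg_left (a3.trans a5) hl.le
      have b4 : 0 ≤ l⁻¹ * (D * frob G G) := by positivity
      have b5 : 0 ≤ l * (D * (9 * (C₀ / δ * L) ^ 2)) := by positivity
      linarith
    calc _ ≤ ε * (l⁻¹ * (D * frob G G) + l * (D * (9 * (C₀ / δ * L) ^ 2))) :=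
          mul_le_mul_of_nonneg_left a7 hε.le
      _ = _ := by field_simp
  have u1 : (L * C₀) / δ * (s * ‖v‖ ^ 2) ≤ C / δ * (s * ‖v‖ ^ 2) := by
    gcongr
    have : 0 ≤ (2 * L + 3 * L * (γ - 1)) + Q + 9 * D * L ^ 2 + D + 9 * D * (C₀ * L) ^ 2 := by
      positivity
    linarith
  have u2 : D / l * (ε * frob G G) ≤ C / l * (ε * frob G G) := by
    gcongr
    have : 0 ≤ (2 * L + 3 * L * (γ - 1)) + Q + L * C₀ + 9 * D * L ^ 2 + 9 * D * (C₀ * L) ^ 2 := by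
      positivity
    linarith
  have u3 : 9 * D * (C₀ * L) ^ 2 * l * (ε / δ ^ 2) ≤ C * l * (ε / δ ^ 2) := by
    gcongr
    have : 0 ≤ (2 * L + 3 * L * (γ - 1)) + Q + L * C₀ + 9 * D * L ^ 2 + D := by
      positivity
    linarith
  have u4 : (2 * L + 3 * L * (γ - 1)) * E + Q * (E + 1) ≤ C * E + C := by
    have : 0 ≤ (2 * L + 3 * L * (γ - 1)) := by positivity
    have h1 := mul_le_mul_of_nonneg_right hCQ he
    linarith
  have u5 : Q * (E + 1) = (L * (2 * C₁) + L * C₁ + 3 * L * (C₁ + B) + P) * (E + 1)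
      + (C₁ + B) * C₀ * (E + 1) := by rw [hQ]; ring
  rw [one_mul]
  linarith

end CompressibleFlow

namespace CompressibleFlow

/-! ### Smooth fields on the closed space-time cylinder -/

/-- `C¹` on `s` provides, near each point of `s`, a derivative within a neighbourhood in `s` that is
continuous at the point, hence bounded close to it. At interior points it is the true derivative,
and compactness makes the bound uniform without unique differentiability or an extension of `f`. -/
lemma exists_norm_fderiv_le_of_contDiffOn {X Y : Type*} [NormedAddCommGroup X] [NormedSpace ℝ X]
    [NormedAddCommGroup Y] [NormedSpace ℝ Y] {f : X → Y} {s : Set X} (hs : IsCompact s)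
    (hf : ContDiffOn ℝ 1 f s) : ∃ C, 0 ≤ C ∧ ∀ z ∈ interior s, ‖fderiv ℝ f z‖ ≤ C := by
  suffices h : ∃ C, 0 ≤ C ∧ ∀ z ∈ s ∩ interior s, ‖fderiv ℝ f z‖ ≤ C by
    obtain ⟨C, hC, h⟩ := h
    exact ⟨C, hC, fun z hz => h z ⟨interior_subset hz, hz⟩⟩
  refine hs.induction_on (p := fun t => ∃ C, 0 ≤ C ∧ ∀ z ∈ t ∩ interior s, ‖fderiv ℝ f z‖ ≤ C)
    ⟨0, le_rfl, by simp⟩ ?_ ?_ ?_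
  · rintro t t' htt ⟨C, hC, h⟩
    exact ⟨C, hC, fun z hz => h z ⟨htt hz.1, hz.2⟩⟩
  · rintro t t' ⟨C, hC, h⟩ ⟨C', hC', h'⟩
    refine ⟨max C C', hC.trans (le_max_left _ _), ?_⟩
    rintro z ⟨hz | hz, hzs⟩
    · exact (h z ⟨hz, hzs⟩).trans (le_max_left _ _)
    · exact (h' z ⟨hz, hzs⟩).trans (le_max_right _ _)
  · intro x hx
    have h1 : ContDiffWithinAt ℝ (0 + 1) f s x := by simpa using hf x hx
    rw [contDiffWithinAt_succ_iff_hasFDerivWithinAt (by simp)] at h1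
    obtain ⟨u, hu, -, f', hf', hc⟩ := h1
    rw [insert_eq_of_mem hx] at hu
    have hc' : ContinuousWithinAt f' u x := hc.continuousWithinAt
    have hlt : ∀ᶠ y in 𝓝[s] x, ‖f' y‖ < ‖f' x‖ + 1 :=
      nhdsWithin_le_of_mem hu (hc'.norm.eventually (gt_mem_nhds (by linarith)))
    refine ⟨_, (hlt.and (eventually_eventually_nhdsWithin.2 hu)), ‖f' x‖ + 1, by positivity, ?_⟩
    rintro y ⟨⟨hy1, hy2⟩, hys⟩
    have hu' : u ∈ 𝓝 y := by
      have : ∀ᶠ z in 𝓝[s] y, z ∈ u := hy2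
      rwa [nhdsWithin_eq_nhds.2 (mem_interior_iff_mem_nhds.1 hys)] at this
    rw [((hf' y (mem_of_mem_nhds hu')).hasFDerivAt hu').fderiv]
    exact hy1.le

variable {F : Type*} [NormedAddCommGroup F] [NormedSpace ℝ F]

lemma isOpen_cylinder {Ω : Set E3} (hΩ : IsOpen Ω) (T : ℝ) : IsOpen (Ioo 0 T ×ˢ Ω) :=
  isOpen_Ioo.prod hΩ

lemma cylinder_subset (Ω : Set E3) (T : ℝ) : Ioo 0 T ×ˢ Ω ⊆ Icc 0 T ×ˢ closure Ω :=
  prod_mono Ioo_subset_Icc_self subset_closure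

lemma isCompact_closedCylinder {Ω : Set E3} (hΩ : IsSmoothBoundedOpen Ω) (T : ℝ) :
    IsCompact (Icc 0 T ×ˢ closure Ω) :=
  isCompact_Icc.prod
    (Metric.isCompact_of_isClosed_isBounded isClosed_closure hΩ.isBounded.closure)

/-- `f`, smooth on the closed cylinder, is bounded by `L` with its first derivatives. -/
structure IsBoundedField (Ω : Set E3) (T L : ℝ) (f : ℝ → E3 → F) : Prop where
  contDiffOn : ContDiffOn ℝ ∞ (fun z : ℝ × E3 => f z.1 z.2) (Icc 0 T ×ˢ closure Ω)
  norm_le : ∀ t ∈ Icc 0 T, ∀ x ∈ closure Ω, ‖f t x‖ ≤ L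
  deriv_le : ∀ t ∈ Ioo 0 T, ∀ x ∈ Ω, ‖deriv (fun s => f s x) t‖ ≤ L
  fderiv_le : ∀ t ∈ Ioo 0 T, ∀ x ∈ Ω, ‖fderiv ℝ (f t) x‖ ≤ L

section

variable {Ω : Set E3} {T : ℝ} {f : ℝ → E3 → F}

lemma hasFDerivAt_cylinder (hΩ : IsOpen Ω)
    (hf : ContDiffOn ℝ ∞ (fun z : ℝ × E3 => f z.1 z.2) (Icc 0 T ×ˢ closure Ω))
    {z : ℝ × E3} (hz : z ∈ Ioo 0 T ×ˢ Ω) :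
    HasFDerivAt (fun z : ℝ × E3 => f z.1 z.2) (fderiv ℝ (fun z : ℝ × E3 => f z.1 z.2) z) z :=
  (((hf.mono (cylinder_subset Ω T)).contDiffAt ((isOpen_cylinder hΩ T).mem_nhds hz)).differentiableAt
    (by simp)).hasFDerivAt

lemma hasDerivAt_time (hΩ : IsOpen Ω)
    (hf : ContDiffOn ℝ ∞ (fun z : ℝ × E3 => f z.1 z.2) (Icc 0 T ×ˢ closure Ω))
    {t : ℝ} (ht : t ∈ Ioo 0 T) {x : E3} (hx : x ∈ Ω) :
    HasDerivAt (fun s => f s x) (fderiv ℝ (fun z : ℝ × E3 => f z.1 z.2) (t, x) (1, 0)) t := by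
  have h := hasFDerivAt_cylinder hΩ hf (z := (t, x)) ⟨ht, hx⟩
  exact h.comp_hasDerivAt t ((hasDerivAt_id t).prodMk (hasDerivAt_const t x))

lemma hasFDerivAt_space (hΩ : IsOpen Ω)
    (hf : ContDiffOn ℝ ∞ (fun z : ℝ × E3 => f z.1 z.2) (Icc 0 T ×ˢ closure Ω))
    {t : ℝ} (ht : t ∈ Ioo 0 T) {x : E3} (hx : x ∈ Ω) :
    HasFDerivAt (f t) ((fderiv ℝ (fun z : ℝ × E3 => f z.1 z.2) (t, x)).comp
      (ContinuousLinearMap.inr ℝ ℝ E3)) x := by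
  have h := hasFDerivAt_cylinder hΩ hf (z := (t, x)) ⟨ht, hx⟩
  exact h.comp x (hasFDerivAt_prodMk_right t x)

lemma differentiableAt_time (hΩ : IsOpen Ω)
    (hf : ContDiffOn ℝ ∞ (fun z : ℝ × E3 => f z.1 z.2) (Icc 0 T ×ˢ closure Ω))
    {t : ℝ} (ht : t ∈ Ioo 0 T) {x : E3} (hx : x ∈ Ω) : DifferentiableAt ℝ (fun s => f s x) t :=
  (hasDerivAt_time hΩ hf ht hx).differentiableAt

lemma differentiableAt_space (hΩ : IsOpen Ω)
    (hf : ContDiffOn ℝ ∞ (fun z : ℝ × E3 => f z.1 z.2) (Icc 0 T ×ˢ closure Ω))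
    {t : ℝ} (ht : t ∈ Ioo 0 T) {x : E3} (hx : x ∈ Ω) : DifferentiableAt ℝ (f t) x :=
  (hasFDerivAt_space hΩ hf ht hx).differentiableAt

lemma continuousOn_fderiv_cylinder (hΩ : IsOpen Ω)
    (hf : ContDiffOn ℝ ∞ (fun z : ℝ × E3 => f z.1 z.2) (Icc 0 T ×ˢ closure Ω)) :
    ContinuousOn (fderiv ℝ (fun z : ℝ × E3 => f z.1 z.2)) (Ioo 0 T ×ˢ Ω) :=
  (hf.mono (cylinder_subset Ω T)).continuousOn_fderiv_of_isOpen (isOpen_cylinder hΩ T) (by simp)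

lemma continuousOn_deriv_time (hΩ : IsOpen Ω)
    (hf : ContDiffOn ℝ ∞ (fun z : ℝ × E3 => f z.1 z.2) (Icc 0 T ×ˢ closure Ω)) :
    ContinuousOn (fun z : ℝ × E3 => deriv (fun s => f s z.2) z.1) (Ioo 0 T ×ˢ Ω) :=
  ((continuousOn_fderiv_cylinder hΩ hf).clm_apply continuousOn_const).congr fun _ hz =>
    (hasDerivAt_time hΩ hf hz.1 hz.2).deriv

lemma continuousOn_fderiv_space (hΩ : IsOpen Ω)
    (hf : ContDiffOn ℝ ∞ (fun z : ℝ × E3 => f z.1 z.2) (Icc 0 T ×ˢ closure Ω)) :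
    ContinuousOn (fun z : ℝ × E3 => fderiv ℝ (f z.1) z.2) (Ioo 0 T ×ˢ Ω) :=
  ((continuousOn_fderiv_cylinder hΩ hf).clm_comp continuousOn_const).congr fun _ hz =>
    (hasFDerivAt_space hΩ hf hz.1 hz.2).fderiv

lemma exists_isBoundedField (hΩ : IsSmoothBoundedOpen Ω)
    (hf : ContDiffOn ℝ ∞ (fun z : ℝ × E3 => f z.1 z.2) (Icc 0 T ×ˢ closure Ω)) :
    ∃ L, 0 ≤ L ∧ IsBoundedField Ω T L f := by
  have hc := isCompact_closedCylinder hΩ T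
  obtain ⟨C₁, h₁⟩ := hc.exists_bound_of_continuousOn hf.continuousOn
  obtain ⟨C₂, hC₂, h₂⟩ := exists_norm_fderiv_le_of_contDiffOn hc (hf.of_le (by simp))
  have hint : Ioo 0 T ×ˢ Ω ⊆ interior (Icc 0 T ×ˢ closure Ω) :=
    interior_maximal (cylinder_subset Ω T) (isOpen_cylinder hΩ.isOpen T)
  refine ⟨max C₁ C₂, hC₂.trans (le_max_right _ _), hf, ?_, ?_, ?_⟩
  · exact fun t ht x hx => (h₁ (t, x) ⟨ht, hx⟩).trans (le_max_left _ _)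
  · intro t ht x hx
    rw [(hasDerivAt_time hΩ.isOpen hf ht hx).deriv]
    refine le_trans ?_ (le_max_right C₁ C₂)
    refine ((ContinuousLinearMap.le_of_opNorm_le _ (h₂ (t, x) (hint ⟨ht, hx⟩)) _)).trans ?_
    simp
  · intro t ht x hx
    rw [(hasFDerivAt_space hΩ.isOpen hf ht hx).fderiv]
    refine le_trans ?_ (le_max_right C₁ C₂)
    refine ContinuousLinearMap.opNorm_le_bound _ hC₂ fun v => ?_
    refine ((ContinuousLinearMap.le_of_opNorm_le _ (h₂ (t, x) (hint ⟨ht, hx⟩)) _)).trans ?_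
    simp

lemma IsBoundedField.mono {L L' : ℝ} (h : IsBoundedField Ω T L f) (hL : L ≤ L') :
    IsBoundedField Ω T L' f where
  contDiffOn := h.contDiffOn
  norm_le t ht x hx := (h.norm_le t ht x hx).trans hL
  deriv_le t ht x hx := (h.deriv_le t ht x hx).trans hL
  fderiv_le t ht x hx := (h.fderiv_le t ht x hx).trans hL

end

/-! ### The Euler flow -/

section

variable {Ω : Set E3} {T γ : ℝ} {r : ℝ → E3 → ℝ} {U : ℝ → E3 → E3}

/-- The bounds pass to the closed cylinder by continuity, `T > 0` making it the closure of the open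
one. Taking `max a b` secures `a ≤ b` even for empty `Ω`. -/
lemma IsSmoothEulerSolution.exists_density_bounds (hE : IsSmoothEulerSolution Ω T γ r U)
    (hT : 0 < T) : ∃ a b, 0 < a ∧ a ≤ b ∧ ∀ t ∈ Icc 0 T, ∀ x ∈ closure Ω, a ≤ r t x ∧ r t x ≤ b := by
  obtain ⟨a, b, ha, h⟩ := hE.density_bounds
  refine ⟨a, max a b, ha, le_max_left _ _, fun t ht x hx => ?_⟩
  have hcl : Icc 0 T ×ˢ closure Ω = closure (Ioo 0 T ×ˢ Ω) := by
    rw [closure_prod_eq, closure_Ioo hT.ne]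
  have hmem : (t, x) ∈ closure (Ioo 0 T ×ˢ Ω) := hcl ▸ ⟨ht, hx⟩
  have hc := (hE.density_smooth.continuousOn (t, x) ⟨ht, hx⟩).mono (cylinder_subset Ω T)
  constructor
  · exact ContinuousWithinAt.closure_le hmem continuousWithinAt_const hc
      fun z hz => (h z.1 hz.1 z.2 hz.2).1
  · exact ContinuousWithinAt.closure_le hmem hc continuousWithinAt_const
      fun z hz => ((h z.1 hz.1 z.2 hz.2).2).trans (le_max_right _ _)

lemma div_smul_eq {g : E3 → ℝ} {V : E3 → E3} {x : E3} (hg : DifferentiableAt ℝ g x)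
    (hV : DifferentiableAt ℝ V x) :
    div (fun y => g y • V y) x = g x * tr (fderiv ℝ V x) + fderiv ℝ g x (V x) := by
  rw [div, fderiv_fun_smul hg hV, tr_add_smul_smulRight]

lemma IsSmoothEulerSolution.mass_eq (hE : IsSmoothEulerSolution Ω T γ r U) (hΩ : IsOpen Ω)
    {t : ℝ} (ht : t ∈ Ioo 0 T) {x : E3} (hx : x ∈ Ω) :
    deriv (fun s => r s x) t + fderiv ℝ (r t) x (U t x) + r t x * tr (fderiv ℝ (U t) x) = 0 := by
  have h := hE.continuity_eq t ht x hx
  rw [div_smul_eq (differentiableAt_space hΩ hE.density_smooth ht hx)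
    (differentiableAt_space hΩ hE.velocity_smooth ht hx)] at h
  linarith

/-- The non-conservative form: subtract `U` times the mass equation from the momentum equation, and
test with `w`. -/
lemma IsSmoothEulerSolution.acceleration_eq (hE : IsSmoothEulerSolution Ω T γ r U)
    (hΩ : IsOpen Ω) {t : ℝ} (ht : t ∈ Ioo 0 T) {x : E3} (hx : x ∈ Ω) (hr : 0 < r t x) (w : E3) :
    r t x * inner ℝ (deriv (fun s => U s x) t + fderiv ℝ (U t) x (U t x)) w
      + γ * r t x ^ (γ - 1) * fderiv ℝ (r t) x w = 0 := by
  have hrd := differentiableAt_space hΩ hE.density_smooth ht hx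
  have hUd := differentiableAt_space hΩ hE.velocity_smooth ht hx
  have hmass := hE.mass_eq hΩ ht hx
  have h := hE.momentum_eq t ht x hx
  have h1 : deriv (fun s => r s x • U s x) t
      = r t x • deriv (fun s => U s x) t + deriv (fun s => r s x) t • U t x :=
    deriv_fun_smul (differentiableAt_time hΩ hE.density_smooth ht hx)
      (differentiableAt_time hΩ hE.velocity_smooth ht hx)
  have hUj : ∀ j, HasFDerivAt (fun y => U t y j)
      ((EuclideanSpace.proj j : E3 →L[ℝ] ℝ).comp (fderiv ℝ (U t) x)) x := fun j =>
    (EuclideanSpace.proj j : E3 →L[ℝ] ℝ).hasFDerivAt.comp x hUd.hasFDerivAt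
  have h2 : ∀ j, fderiv ℝ (fun y => (r t y * U t y j) • U t y) x (e j)
      = (r t x * U t x j) • fderiv ℝ (U t) x (e j)
        + (r t x * (fderiv ℝ (U t) x (e j)) j + U t x j * fderiv ℝ (r t) x (e j)) • U t x := by
    intro j
    have hm : HasFDerivAt (fun y => (r t y * U t y j) • U t y) _ x :=
      (hrd.hasFDerivAt.mul (hUj j)).smul hUd.hasFDerivAt
    rw [hm.fderiv]
    simp
  have h3 : ∑ j, fderiv ℝ (fun y => (r t y * U t y j) • U t y) x (e j)
      = r t x • fderiv ℝ (U t) x (U t x)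
        + (r t x * tr (fderiv ℝ (U t) x) + fderiv ℝ (r t) x (U t x)) • U t x := by
    rw [Finset.sum_congr rfl fun j _ => h2 j, Finset.sum_add_distrib, ← Finset.sum_smul,
      Finset.sum_add_distrib, ← Finset.mul_sum]
    congr 2
    · have hU : U t x = ∑ j, U t x j • e j := by
        ext i; simp [e_apply]
      conv_rhs => rw [hU]
      simp [Finset.smul_sum, smul_smul]
    · rw [← sum_apply_mul_e (fderiv ℝ (r t) x)]
      simp [tr, mul_comm]
  have h4 : inner ℝ (gradient (fun y => r t y ^ γ) x) w
      = γ * r t x ^ (γ - 1) * fderiv ℝ (r t) x w := by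
    rw [gradient, InnerProductSpace.toDual_symm_apply,
      (hrd.hasFDerivAt.rpow_const (Or.inl hr.ne')).fderiv]
    simp
  have h5 : r t x • (deriv (fun s => U s x) t + fderiv ℝ (U t) x (U t x))
      + gradient (fun y => r t y ^ γ) x = 0 := by
    rw [h1, h3] at h
    have e1 : deriv (fun s => r s x) t + (r t x * tr (fderiv ℝ (U t) x)
        + fderiv ℝ (r t) x (U t x)) = 0 := by linarith
    calc _ = (r t x • deriv (fun s => U s x) t + deriv (fun s => r s x) t • U t x)
          + (r t x • fderiv ℝ (U t) x (U t x)
          + (r t x * tr (fderiv ℝ (U t) x) + fderiv ℝ (r t) x (U t x)) • U t x)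
          + gradient (fun y => r t y ^ γ) x
          - (deriv (fun s => r s x) t + (r t x * tr (fderiv ℝ (U t) x)
            + fderiv ℝ (r t) x (U t x))) • U t x := by
          rw [smul_add, add_smul (deriv (fun s => r s x) t)]; abel
      _ = 0 := by rw [e1, h]; simp
  have h6 := congrArg (fun v => inner ℝ v w) h5
  simp only [inner_add_left, inner_smul_left, inner_zero_left, h4, conj_trivial] at h6
  rw [inner_add_left]
  linarith

end

end CompressibleFlow

namespace CompressibleFlow

/-! ### Time localisation and Gronwall's inequality -/

lemma setIntegral_Ioo_eq_integral_indicator {T τ : ℝ} (hτ : τ ≤ T) (f : ℝ → ℝ) :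
    ∫ t in Ioo 0 τ, f t = ∫ t in Ioo 0 T, (Iio τ).indicator f t := by
  rw [setIntegral_indicator measurableSet_Iio]
  congr 2
  ext t
  simp only [mem_Ioo, mem_inter_iff, mem_Iio]
  constructor
  · exact fun h => ⟨⟨h.1, h.2.trans_le hτ⟩, h.2⟩
  · exact fun h => ⟨h.1.1, h.2⟩

lemma integrable_indicator_mul_prod {T : ℝ} {f ψ : ℝ → ℝ} (hf : IntegrableOn f (Ioo 0 T))
    (hψ : IntegrableOn ψ (Ioo 0 T)) :
    Integrable (fun p : ℝ × ℝ => (Iio p.1).indicator f p.2 * ψ p.1)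
      ((volume.restrict (Ioo 0 T)).prod (volume.restrict (Ioo 0 T))) := by
  have h1 : Integrable (fun p : ℝ × ℝ => ψ p.1 * f p.2)
      ((volume.restrict (Ioo 0 T)).prod (volume.restrict (Ioo 0 T))) := Integrable.mul_prod hψ hf
  have hm : MeasurableSet {p : ℝ × ℝ | p.2 < p.1} := measurableSet_lt measurable_snd measurable_fst
  refine (h1.indicator hm).congr (Eventually.of_forall fun p => ?_)
  by_cases hp : p.2 < p.1
  · simp [hp, mul_comm]
  · simp [hp]

lemma integrableOn_primitive {T : ℝ} {f : ℝ → ℝ} (hf : IntegrableOn f (Ioo 0 T)) :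
    IntegrableOn (fun τ => ∫ t in Ioo 0 τ, f t) (Ioo 0 T) := by
  have h := (integrable_indicator_mul_prod hf (ψ := fun _ => 1) (by simp)).integral_prod_left
  refine IntegrableOn.congr_fun h (fun τ hτ => ?_) measurableSet_Ioo
  simp only [mul_one]
  rw [setIntegral_Ioo_eq_integral_indicator hτ.2.le]

/-- A weak formulation in time tested against all smooth functions vanishing at the final time
yields the corresponding identity at almost every time. -/
lemma ae_eq_add_integral_of_weak {T g₀ : ℝ} (hT : 0 < T) {g f : ℝ → ℝ}
    (hg : IntegrableOn g (Ioo 0 T)) (hf : IntegrableOn f (Ioo 0 T))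
    (h : ∀ θ : ℝ → ℝ, ContDiff ℝ ∞ θ → θ T = 0 →
      -(θ 0 * g₀) = ∫ t in Ioo 0 T, (deriv θ t * g t + θ t * f t)) :
    ∀ᵐ τ ∂(volume.restrict (Ioo 0 T)), g τ = g₀ + ∫ t in Ioo 0 τ, f t := by
  set G : ℝ → ℝ := fun τ => g τ - g₀ - ∫ t in Ioo 0 τ, f t with hG
  have hprim := integrableOn_primitive hf
  have hGi : IntegrableOn G (Ioo 0 T) :=
    (Integrable.sub hg (integrableOn_const (by simp))).sub hprim
  have key : ∀ᵐ τ ∂(volume : Measure ℝ), τ ∈ Ioo 0 T → G τ = 0 := by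
    refine isOpen_Ioo.ae_eq_zero_of_integral_contDiff_smul_eq_zero hGi.locallyIntegrableOn ?_
    intro ψ hψ hψc hψs
    have hψcont := hψ.continuous
    have hψi : IntegrableOn ψ (Ioo 0 T) :=
      (hψcont.integrable_of_hasCompactSupport hψc).integrableOn
    -- The primitive of `ψ` vanishing at `T` is an admissible weight. Fubini turns `∫ θ f` into `-∫
    -- ψ(s) ∫₀ˢ f ds`, and `θ 0 = -∫ ψ` accounts for `g₀`; together they say that `G` is orthogonal
    -- to `ψ`.
    set θ : ℝ → ℝ := fun t => ∫ s in T..t, ψ s with hθ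
    have hθd : ∀ t, HasDerivAt θ (ψ t) t := fun t =>
      (hψcont.integral_hasStrictDerivAt T t).hasDerivAt
    have hθd' : deriv θ = ψ := funext fun t => (hθd t).deriv
    have hθs : ContDiff ℝ ∞ θ := by
      rw [contDiff_infty_iff_deriv, hθd']
      exact ⟨fun t => (hθd t).differentiableAt, hψ⟩
    have hθT : θ T = 0 := by simp [hθ]
    have hθi : ∀ t ∈ Ioo 0 T, θ t = -∫ s in Ioo 0 T, (Ioi t).indicator ψ s := by
      intro t ht
      change (∫ s in T..t, ψ s) = _
      rw [intervalIntegral.integral_symm, intervalIntegral.integral_of_le ht.2.le,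
        setIntegral_indicator measurableSet_Ioi, integral_Ioc_eq_integral_Ioo]
      congr 3
      ext s
      simp only [mem_Ioo, mem_inter_iff, mem_Ioi]
      exact ⟨fun h => ⟨⟨ht.1.trans h.1, h.2⟩, h.1⟩, fun h => ⟨h.2, h.1.2⟩⟩
    have hθ0 : θ 0 = -∫ s in Ioo 0 T, ψ s := by
      change (∫ s in T..0, ψ s) = _
      rw [intervalIntegral.integral_symm, intervalIntegral.integral_of_le hT.le,
        integral_Ioc_eq_integral_Ioo]
    have h1 := h θ hθs hθT
    rw [hθd'] at h1
    have hψb : ∃ C, ∀ t, ‖ψ t‖ ≤ C := hψc.exists_bound_of_continuous hψcont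
    obtain ⟨C, hC⟩ := hψb
    have hψg : IntegrableOn (fun t => ψ t * g t) (Ioo 0 T) :=
      Integrable.bdd_mul hg hψcont.aestronglyMeasurable (Eventually.of_forall hC)
    have hswap := integrable_indicator_mul_prod hf hψi
    have hθf : ∫ t in Ioo 0 T, θ t * f t = -∫ s in Ioo 0 T, (∫ t in Ioo 0 s, f t) * ψ s := by
      have e1 : ∫ s in Ioo 0 T, (∫ t in Ioo 0 s, f t) * ψ s
          = ∫ s in Ioo 0 T, ∫ t in Ioo 0 T, (Iio s).indicator f t * ψ s := by
        refine setIntegral_congr_fun measurableSet_Ioo fun s hs => ?_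
        rw [setIntegral_Ioo_eq_integral_indicator hs.2.le, integral_mul_const]
      rw [e1, integral_integral_swap hswap, ← integral_neg]
      refine setIntegral_congr_fun measurableSet_Ioo fun t ht => ?_
      rw [hθi t ht, neg_mul, ← integral_mul_const]
      congr 2
      ext s
      by_cases hst : t < s
      · simp [hst, mul_comm]
      · simp [hst]
    have hθfi : IntegrableOn (fun t => θ t * f t) (Ioo 0 T) := by
      have hθc : Continuous θ := hθs.continuous
      obtain ⟨C', hC'⟩ := isCompact_Icc.exists_bound_of_continuousOn (s := Icc 0 T) hθc.continuousOn
      exact Integrable.bdd_mul hf hθc.aestronglyMeasurable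
        ((ae_restrict_iff' measurableSet_Ioo).2 (Eventually.of_forall fun t ht =>
          hC' t (Ioo_subset_Icc_self ht)))
    rw [integral_add hψg hθfi, hθf, hθ0] at h1
    have hψF : IntegrableOn (fun t => ψ t * ∫ u in Ioo 0 t, f u) (Ioo 0 T) :=
      Integrable.bdd_mul hprim hψcont.aestronglyMeasurable (Eventually.of_forall hC)
    have e2 : ∫ x, ψ x • G x = ∫ x in Ioo 0 T, ψ x • G x := by
      rw [setIntegral_eq_integral_of_forall_compl_eq_zero]
      intro x hx
      have : ψ x = 0 := image_eq_zero_of_notMem_tsupport fun hc => hx (hψs hc)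
      simp [this]
    rw [e2]
    have e3 : ∀ x, ψ x • G x = ψ x * g x - ψ x * g₀ - ψ x * ∫ u in Ioo 0 x, f u := fun x => by
      simp only [hG, smul_eq_mul]; ring
    simp_rw [e3]
    have e5 : IntegrableOn (fun x => ψ x * g x - ψ x * g₀) (Ioo 0 T) :=
      hψg.sub (hψi.mul_const g₀)
    rw [integral_sub e5 hψF, integral_sub hψg (hψi.mul_const g₀), integral_mul_const]
    have e4 : ∫ s in Ioo 0 T, (∫ t in Ioo 0 s, f t) * ψ s
        = ∫ x in Ioo 0 T, ψ x * ∫ u in Ioo 0 x, f u := by simp_rw [mul_comm]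
    rw [e4] at h1
    linarith
  rw [ae_restrict_iff' measurableSet_Ioo]
  filter_upwards [key] with τ hτ hmem
  have := hτ hmem
  simp only [hG] at this
  linarith

/-- Gronwall for a function that is merely integrable. Integrating twice regularises: `F = κ + C ∫
E` is continuous and `G = κ + C ∫ F` is differentiable. As `E ≤ F` almost everywhere, `F ≤ G`, so
`G' = C F ≤ C G`. -/
lemma ae_le_of_le_add_integral {T C κ : ℝ} (hC : 0 ≤ C) (hκ : 0 ≤ κ) {E : ℝ → ℝ}
    (hE : IntegrableOn E (Ioo 0 T))
    (h : ∀ᵐ τ ∂(volume.restrict (Ioo 0 T)), E τ ≤ κ + C * ∫ t in Ioo 0 τ, E t) :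
    ∀ᵐ τ ∂(volume.restrict (Ioo 0 T)), E τ ≤ κ * Real.exp (C * T) := by
  set E' : ℝ → ℝ := (Ioo 0 T).indicator E with hE'
  have hE'i : Integrable E' := (integrable_indicator_iff measurableSet_Ioo).2 hE
  set F : ℝ → ℝ := fun τ => κ + C * ∫ t in (0 : ℝ)..τ, E' t with hF
  have hFc : Continuous F :=
    continuous_const.add (continuous_const.mul
      (intervalIntegral.continuous_primitive (fun a b => hE'i.intervalIntegrable) 0))
  set G : ℝ → ℝ := fun τ => κ + C * ∫ t in (0 : ℝ)..τ, F t with hG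
  have hGd : ∀ τ, HasDerivAt G (C * F τ) τ := fun τ =>
    ((hFc.integral_hasStrictDerivAt 0 τ).hasDerivAt.const_mul C).const_add κ
  have hFeq : ∀ τ ∈ Icc 0 T, F τ = κ + C * ∫ t in Ioo 0 τ, E t := by
    intro τ hτ
    simp only [hF]
    rw [intervalIntegral.integral_of_le hτ.1, integral_Ioc_eq_integral_Ioo]
    congr 2
    refine setIntegral_congr_fun measurableSet_Ioo fun t ht => ?_
    exact indicator_of_mem (show t ∈ Ioo 0 T from ⟨ht.1, ht.2.trans_le hτ.2⟩) E
  have hEF : ∀ᵐ τ ∂(volume.restrict (Ioo 0 T)), E τ ≤ F τ := by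
    rw [ae_restrict_iff' measurableSet_Ioo] at h ⊢
    filter_upwards [h] with τ hτ hm
    rw [hFeq τ (Ioo_subset_Icc_self hm)]
    exact hτ hm
  have hFG : ∀ τ ∈ Icc 0 T, F τ ≤ G τ := by
    intro τ hτ
    rw [hFeq τ hτ]
    simp only [hG]
    rw [intervalIntegral.integral_of_le hτ.1, integral_Ioc_eq_integral_Ioo]
    have hsub : Ioo 0 τ ⊆ Ioo 0 T := Ioo_subset_Ioo_right hτ.2
    have : ∫ t in Ioo 0 τ, E t ≤ ∫ t in Ioo 0 τ, F t :=
      integral_mono_ae (hE.mono_set hsub)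
        ((hFc.integrableOn_Icc (a := 0) (b := τ)).mono_set Ioo_subset_Icc_self)
        (ae_restrict_of_ae_restrict_of_subset hsub hEF)
    have := mul_le_mul_of_nonneg_left this hC
    linarith
  have hanti : AntitoneOn (fun τ => G τ * Real.exp (-(C * τ))) (Icc 0 T) := by
    have hd : ∀ τ, HasDerivAt (fun τ => G τ * Real.exp (-(C * τ)))
        (C * F τ * Real.exp (-(C * τ)) + G τ * (Real.exp (-(C * τ)) * (-(C * 1)))) τ := fun τ =>
      (hGd τ).mul (((hasDerivAt_id τ).const_mul C).neg.exp)
    refine antitoneOn_of_deriv_nonpos (convex_Icc 0 T)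
      (fun τ _ => (hd τ).continuousAt.continuousWithinAt)
      (fun τ _ => (hd τ).differentiableAt.differentiableWithinAt) fun τ hτ => ?_
    rw [(hd τ).deriv]
    have h1 := hFG τ (interior_subset hτ)
    have h2 := Real.exp_pos (-(C * τ))
    have h3 : 0 ≤ C * Real.exp (-(C * τ)) * (G τ - F τ) :=
      mul_nonneg (by positivity) (by linarith)
    linarith
  rw [ae_restrict_iff' measurableSet_Ioo] at hEF ⊢
  filter_upwards [hEF] with τ hτ hm
  have hm' := Ioo_subset_Icc_self hm
  have h1 := hanti (left_mem_Icc.2 (hm.1.trans hm.2).le) hm' hm.1.le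
  have hG0 : G 0 = κ := by simp [hG]
  simp only [hG0, mul_zero, neg_zero, Real.exp_zero, mul_one] at h1
  have h2 : G τ ≤ κ * Real.exp (C * τ) := by
    have := mul_le_mul_of_nonneg_right h1 (Real.exp_pos (C * τ)).le
    rwa [mul_assoc, ← Real.exp_add, neg_add_cancel, Real.exp_zero, mul_one] at this
  calc E τ ≤ G τ := (hτ hm).trans (hFG τ hm')
    _ ≤ κ * Real.exp (C * τ) := h2
    _ ≤ κ * Real.exp (C * T) := by have := hm.2; gcongr

end CompressibleFlow

namespace CompressibleFlow

/-! ### Integrability of the weak solution -/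

lemma volume_restrict_cylinder (Ω : Set E3) (T : ℝ) :
    (volume.restrict (Ioo 0 T ×ˢ Ω) : Measure (ℝ × E3))
      = (volume.restrict (Ioo 0 T)).prod (volume.restrict Ω) := by
  rw [Measure.prod_restrict, ← Measure.volume_eq_prod]

lemma isFiniteMeasure_restrict {Ω : Set E3} (hΩ : IsSmoothBoundedOpen Ω) :
    IsFiniteMeasure (volume.restrict Ω) :=
  ⟨by simpa using hΩ.isBounded.measure_lt_top⟩

lemma continuous_tr : Continuous tr := by
  unfold tr
  fun_prop

lemma continuous_frob_stress (μ η : ℝ) :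
    Continuous (fun p : (E3 →L[ℝ] E3) × (E3 →L[ℝ] E3) => frob (stress μ η p.1) p.2) := by
  simp only [frob, stress_apply, tr]
  fun_prop

lemma continuous_frob_self : Continuous (fun A : E3 →L[ℝ] E3 => frob A A) := by
  simp only [frob]
  fun_prop

section

variable {Ω : Set E3} {T γ μ η ε : ℝ} {ρ₀ : E3 → ℝ} {u₀ : E3 → E3} {ρ : ℝ → E3 → ℝ}
  {u : ℝ → E3 → E3} {Du : ℝ → E3 → E3 →L[ℝ] E3}

/-- Nonnegativity is assumed slice by slice. Passing to the product measure needs a measurable set,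
so the argument runs through a measurable representative of the density. -/
lemma IsFiniteEnergyWeakSolution.density_nonneg_ae
    (hS : IsFiniteEnergyWeakSolution Ω T γ μ η ε ρ₀ u₀ ρ u Du) :
    ∀ᵐ z ∂(volume.restrict (Ioo 0 T ×ˢ Ω)), 0 ≤ ρ z.1 z.2 := by
  have hm := hS.density_meas
  have h0 := hm.ae_eq_mk
  have hmk := hm.stronglyMeasurable_mk.measurable
  set f := hm.mk _ with hf
  rw [volume_restrict_cylinder] at h0 ⊢
  have h1 : ∀ᵐ z ∂((volume.restrict (Ioo 0 T)).prod (volume.restrict Ω)), 0 ≤ f z := by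
    rw [Measure.ae_prod_iff_ae_ae (measurableSet_le measurable_const hmk)]
    have h2 := Measure.ae_ae_of_ae_prod h0
    have h3 : ∀ᵐ t ∂(volume.restrict (Ioo 0 T)), t ∈ Ioo 0 T := ae_restrict_mem measurableSet_Ioo
    filter_upwards [h2, h3] with t ht ht'
    filter_upwards [ht, hS.density_nonneg t (Ioo_subset_Icc_self ht')] with x hx hx'
    rwa [← hx]
  filter_upwards [h0, h1] with z hz hz'
  rwa [hz]

lemma integrable_rpow_of_memLp {s : E3 → ℝ} (hγ : 1 < γ)
    (hs : MemLp s (ENNReal.ofReal γ) (volume.restrict Ω))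
    (h0 : ∀ᵐ x ∂(volume.restrict Ω), 0 ≤ s x) :
    Integrable (fun x => s x ^ γ) (volume.restrict Ω) := by
  have h := hs.integrable_norm_rpow (by simp; linarith) (by simp)
  rw [ENNReal.toReal_ofReal (by linarith)] at h
  refine h.congr ?_
  filter_upwards [h0] with x hx
  rw [Real.norm_of_nonneg hx]

/-- At almost every time the energy is finite and bounded by the initial one. -/
lemma IsFiniteEnergyWeakSolution.ae_energy (hγ : 1 < γ) (hμ : 0 ≤ μ) (hη : 0 ≤ η) (hε : 0 ≤ ε)
    (hS : IsFiniteEnergyWeakSolution Ω T γ μ η ε ρ₀ u₀ ρ u Du) :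
    ∀ᵐ t ∂(volume.restrict (Ioo 0 T)),
      Integrable (fun x => ρ t x ^ γ) (volume.restrict Ω) ∧
      Integrable (fun x => ρ t x * ‖u t x‖ ^ 2) (volume.restrict Ω) ∧
      energy Ω γ (ρ t) (u t) ≤ energy Ω γ ρ₀ u₀ := by
  obtain ⟨k, hk, hkeq⟩ := hS.kinetic_cw
  have h1 := ae_restrict_of_ae_restrict_of_subset Ioo_subset_Icc_self hkeq
  have h2 := ae_restrict_of_ae_restrict_of_subset Ioo_subset_Icc_self hS.energy_ineq
  filter_upwards [h1, h2, ae_restrict_mem measurableSet_Ioo] with t ht1 ht2 ht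
  have ht' := Ioo_subset_Icc_self ht
  refine ⟨integrable_rpow_of_memLp hγ (hS.density_cw.1 t ht') (hS.density_nonneg t ht'), ?_, ?_⟩
  -- Without this integrability the Bochner integral in `energy` could be the default value `0`, and
  -- the energy inequality would carry no information.
  · exact (memLp_one_iff_integrable.1 (hk.1 t ht')).congr ht1
  · have : 0 ≤ ε * ∫ z in Ioo 0 t ×ˢ Ω, frob (stress μ η (Du z.1 z.2)) (Du z.1 z.2) :=
      mul_nonneg hε (integral_nonneg fun z => frob_stress_self_nonneg hμ hη _)
    linarith

lemma integrable_cylinder_of_ae_bound (hΩ : IsSmoothBoundedOpen Ω) {f : ℝ × E3 → ℝ} {M : ℝ}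
    (hf : AEStronglyMeasurable f (volume.restrict (Ioo 0 T ×ˢ Ω)))
    (h : ∀ᵐ t ∂(volume.restrict (Ioo 0 T)), Integrable (fun x => f (t, x)) (volume.restrict Ω) ∧
      ∫ x in Ω, ‖f (t, x)‖ ≤ M) :
    Integrable f (volume.restrict (Ioo 0 T ×ˢ Ω)) := by
  have := isFiniteMeasure_restrict hΩ
  rw [volume_restrict_cylinder] at hf ⊢
  rw [integrable_prod_iff hf]
  refine ⟨h.mono fun t ht => ht.1, ?_⟩
  refine Integrable.of_bound hf.norm.integral_prod_right' M ?_
  filter_upwards [h] with t ht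
  rw [Real.norm_of_nonneg (integral_nonneg fun x => norm_nonneg _)]
  exact ht.2

lemma energy_terms_le {s : E3 → ℝ} {v : E3 → E3} {M : ℝ} (hγ : 1 < γ)
    (h0 : ∀ᵐ x ∂(volume.restrict Ω), 0 ≤ s x)
    (h1 : Integrable (fun x => s x ^ γ) (volume.restrict Ω))
    (h2 : Integrable (fun x => s x * ‖v x‖ ^ 2) (volume.restrict Ω))
    (hM : energy Ω γ s v ≤ M) :
    ∫ x in Ω, s x ^ γ ≤ (γ - 1) * M ∧ ∫ x in Ω, s x * ‖v x‖ ^ 2 ≤ 2 * M := by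
  have hg : 0 < γ - 1 := by linarith
  have e1 : energy Ω γ s v
      = 1 / 2 * (∫ x in Ω, s x * ‖v x‖ ^ 2) + (∫ x in Ω, s x ^ γ) / (γ - 1) := by
    rw [energy, ← integral_const_mul, ← integral_div, ← integral_add (h2.const_mul _) (h1.div_const _)]
    simp only [mul_assoc]
  have a1 : 0 ≤ ∫ x in Ω, s x * ‖v x‖ ^ 2 :=
    integral_nonneg_of_ae (h0.mono fun x hx => mul_nonneg hx (by positivity))
  have a2 : 0 ≤ ∫ x in Ω, s x ^ γ :=
    integral_nonneg_of_ae (h0.mono fun x hx => Real.rpow_nonneg hx _)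
  have a3 : 0 ≤ (∫ x in Ω, s x ^ γ) / (γ - 1) := div_nonneg a2 hg.le
  constructor
  · have : (∫ x in Ω, s x ^ γ) / (γ - 1) ≤ M := by linarith
    rw [div_le_iff₀ hg] at this
    linarith
  · linarith

lemma IsFiniteEnergyWeakSolution.integrable_rpow (hΩ : IsSmoothBoundedOpen Ω) (hγ : 1 < γ)
    (hμ : 0 ≤ μ) (hη : 0 ≤ η) (hε : 0 ≤ ε)
    (hS : IsFiniteEnergyWeakSolution Ω T γ μ η ε ρ₀ u₀ ρ u Du) :
    Integrable (fun z : ℝ × E3 => ρ z.1 z.2 ^ γ) (volume.restrict (Ioo 0 T ×ˢ Ω)) := by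
  refine integrable_cylinder_of_ae_bound hΩ
    (hS.density_meas.aemeasurable.pow_const γ).aestronglyMeasurable
    (M := (γ - 1) * energy Ω γ ρ₀ u₀) ?_
  filter_upwards [hS.ae_energy hγ hμ hη hε, ae_restrict_mem measurableSet_Ioo] with t ⟨h1, h2, h3⟩ ht
  have h0 := hS.density_nonneg t (Ioo_subset_Icc_self ht)
  refine ⟨h1, le_of_eq_of_le (integral_congr_ae ?_) (energy_terms_le hγ h0 h1 h2 h3).1⟩
  filter_upwards [h0] with x hx
  exact Real.norm_of_nonneg (Real.rpow_nonneg hx _)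

lemma IsFiniteEnergyWeakSolution.velocity_meas
    (hS : IsFiniteEnergyWeakSolution Ω T γ μ η ε ρ₀ u₀ ρ u Du) :
    AEStronglyMeasurable (fun z : ℝ × E3 => u z.1 z.2) (volume.restrict (Ioo 0 T ×ˢ Ω)) :=
  hS.velocity.1.1

lemma IsFiniteEnergyWeakSolution.integrable_kinetic (hΩ : IsSmoothBoundedOpen Ω) (hγ : 1 < γ)
    (hμ : 0 ≤ μ) (hη : 0 ≤ η) (hε : 0 ≤ ε)
    (hS : IsFiniteEnergyWeakSolution Ω T γ μ η ε ρ₀ u₀ ρ u Du) :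
    Integrable (fun z : ℝ × E3 => ρ z.1 z.2 * ‖u z.1 z.2‖ ^ 2)
      (volume.restrict (Ioo 0 T ×ˢ Ω)) := by
  refine integrable_cylinder_of_ae_bound hΩ (hS.density_meas.mul (hS.velocity_meas.norm.pow 2))
    (M := 2 * energy Ω γ ρ₀ u₀) ?_
  filter_upwards [hS.ae_energy hγ hμ hη hε, ae_restrict_mem measurableSet_Ioo] with t ⟨h1, h2, h3⟩ ht
  have h0 := hS.density_nonneg t (Ioo_subset_Icc_self ht)
  refine ⟨h2, le_of_eq_of_le (integral_congr_ae ?_) (energy_terms_le hγ h0 h1 h2 h3).2⟩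
  filter_upwards [h0] with x hx
  exact Real.norm_of_nonneg (by positivity)

lemma isFiniteMeasure_cylinder (hΩ : IsSmoothBoundedOpen Ω) (T : ℝ) :
    IsFiniteMeasure (volume.restrict (Ioo 0 T ×ˢ Ω) : Measure (ℝ × E3)) := by
  have := isFiniteMeasure_restrict hΩ
  rw [volume_restrict_cylinder]
  infer_instance

lemma IsFiniteEnergyWeakSolution.integrable_density (hΩ : IsSmoothBoundedOpen Ω) (hγ : 1 < γ)
    (hμ : 0 ≤ μ) (hη : 0 ≤ η) (hε : 0 ≤ ε)
    (hS : IsFiniteEnergyWeakSolution Ω T γ μ η ε ρ₀ u₀ ρ u Du) :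
    Integrable (fun z : ℝ × E3 => ρ z.1 z.2) (volume.restrict (Ioo 0 T ×ˢ Ω)) := by
  have := isFiniteMeasure_cylinder hΩ T
  refine ((hS.integrable_rpow hΩ hγ hμ hη hε).add (integrable_const 1)).mono' hS.density_meas ?_
  filter_upwards [hS.density_nonneg_ae] with z hz
  rw [Real.norm_of_nonneg hz]
  exact le_rpow_add_one hγ hz

lemma IsFiniteEnergyWeakSolution.integrable_momentum_norm (hΩ : IsSmoothBoundedOpen Ω) (hγ : 1 < γ)
    (hμ : 0 ≤ μ) (hη : 0 ≤ η) (hε : 0 ≤ ε)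
    (hS : IsFiniteEnergyWeakSolution Ω T γ μ η ε ρ₀ u₀ ρ u Du) :
    Integrable (fun z : ℝ × E3 => ρ z.1 z.2 * ‖u z.1 z.2‖) (volume.restrict (Ioo 0 T ×ˢ Ω)) := by
  refine ((hS.integrable_density hΩ hγ hμ hη hε).add (hS.integrable_kinetic hΩ hγ hμ hη hε)).mono'
    (hS.density_meas.mul hS.velocity_meas.norm) ?_
  filter_upwards [hS.density_nonneg_ae] with z hz
  rw [Real.norm_of_nonneg (by positivity), Pi.add_apply]
  nlinarith [mul_nonneg hz (sq_nonneg (‖u z.1 z.2‖ - 1)), mul_nonneg hz (norm_nonneg (u z.1 z.2))]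

lemma integrable_frob_self {G : ℝ × E3 → E3 →L[ℝ] E3} {m : Measure (ℝ × E3)} (hG : MemLp G 2 m) :
    Integrable (fun z => frob (G z) (G z)) m := by
  have h1 : Integrable (fun z => ‖G z‖ ^ 2) m := hG.integrable_norm_pow (by simp)
  refine (h1.const_mul 9).mono' (continuous_frob_self.comp_aestronglyMeasurable hG.1) ?_
  refine Eventually.of_forall fun z => ?_
  rw [Real.norm_of_nonneg (frob_nonneg _)]
  exact frob_self_le _

lemma aestronglyMeasurable_frob_stress (μ η : ℝ) {G W : ℝ × E3 → E3 →L[ℝ] E3}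
    {m : Measure (ℝ × E3)} (hG : AEStronglyMeasurable G m) (hW : AEStronglyMeasurable W m) :
    AEStronglyMeasurable (fun z => frob (stress μ η (G z)) (W z)) m := by
  have h : AEStronglyMeasurable (fun z => (G z, W z)) m := hG.prodMk hW
  have h2 := (continuous_frob_stress μ η).comp_aestronglyMeasurable h
  exact h2

lemma integrable_frob_stress_self (hμ : 0 ≤ μ) (hη : 0 ≤ η) {G : ℝ × E3 → E3 →L[ℝ] E3}
    {m : Measure (ℝ × E3)} (hG : MemLp G 2 m) :
    Integrable (fun z => frob (stress μ η (G z)) (G z)) m := by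
  refine ((integrable_frob_self hG).const_mul (2 * μ + 3 * η)).mono'
    (aestronglyMeasurable_frob_stress μ η hG.1 hG.1) ?_
  refine Eventually.of_forall fun z => ?_
  rw [Real.norm_of_nonneg (frob_stress_self_nonneg hμ hη _)]
  exact frob_stress_self_le hμ hη _

lemma integrable_frob_stress (hμ : 0 ≤ μ) (hη : 0 ≤ η) {G W : ℝ × E3 → E3 →L[ℝ] E3}
    {m : Measure (ℝ × E3)} (hG : MemLp G 2 m) (hW : MemLp W 2 m) :
    Integrable (fun z => frob (stress μ η (G z)) (W z)) m := by
  refine ((integrable_frob_stress_self hμ hη hG).add (integrable_frob_stress_self hμ hη hW)).mono'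
    (aestronglyMeasurable_frob_stress μ η hG.1 hW.1) ?_
  refine Eventually.of_forall fun z => ?_
  have h := abs_frob_stress_le hμ hη one_pos (G z) (W z)
  have := frob_stress_self_nonneg hμ hη (G z)
  have := frob_stress_self_nonneg hμ hη (W z)
  rw [Real.norm_eq_abs, Pi.add_apply]
  rw [inv_one, one_mul, one_mul] at h
  linarith [abs_nonneg (frob (stress μ η (G z)) (W z))]

/-- The space-time integrand of the difference of the two weak formulations, tested with `q`
and `w`. -/
noncomputable def weakRate (γ μ η ε : ℝ) (ρ : ℝ → E3 → ℝ) (u : ℝ → E3 → E3)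
    (Du : ℝ → E3 → E3 →L[ℝ] E3) (q : ℝ → E3 → ℝ) (w : ℝ → E3 → E3) (z : ℝ × E3) : ℝ :=
  (ρ z.1 z.2 * deriv (fun s => q s z.2) z.1 + ρ z.1 z.2 * fderiv ℝ (q z.1) z.2 (u z.1 z.2))
    - (inner ℝ (ρ z.1 z.2 • u z.1 z.2) (deriv (fun s => w s z.2) z.1)
      + ρ z.1 z.2 * inner ℝ (u z.1 z.2) (fderiv ℝ (w z.1) z.2 (u z.1 z.2))
      + ρ z.1 z.2 ^ γ * tr (fderiv ℝ (w z.1) z.2)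
      - ε * frob (stress μ η (Du z.1 z.2)) (fderiv ℝ (w z.1) z.2))

end

section

variable {Ω : Set E3} {T L : ℝ} {F : Type*} [NormedAddCommGroup F] [NormedSpace ℝ F]
  {f : ℝ → E3 → F}

lemma IsBoundedField.meas_deriv [SecondCountableTopology F]
    (hf : IsBoundedField Ω T L f) (hΩ : IsOpen Ω) :
    AEStronglyMeasurable (fun z : ℝ × E3 => deriv (fun s => f s z.2) z.1)
      (volume.restrict (Ioo 0 T ×ˢ Ω)) :=
  (continuousOn_deriv_time hΩ hf.contDiffOn).aestronglyMeasurable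
    (isOpen_cylinder hΩ T).measurableSet

lemma IsBoundedField.meas_fderiv [SecondCountableTopology F]
    (hf : IsBoundedField Ω T L f) (hΩ : IsOpen Ω) :
    AEStronglyMeasurable (fun z : ℝ × E3 => fderiv ℝ (f z.1) z.2)
      (volume.restrict (Ioo 0 T ×ˢ Ω)) :=
  (continuousOn_fderiv_space hΩ hf.contDiffOn).aestronglyMeasurable
    (isOpen_cylinder hΩ T).measurableSet

lemma IsBoundedField.meas (hf : IsBoundedField Ω T L f) (hΩ : IsOpen Ω)
    [SecondCountableTopology F] :
    AEStronglyMeasurable (fun z : ℝ × E3 => f z.1 z.2) (volume.restrict (Ioo 0 T ×ˢ Ω)) :=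
  (hf.contDiffOn.continuousOn.mono (cylinder_subset Ω T)).aestronglyMeasurable
    (isOpen_cylinder hΩ T).measurableSet

end

end CompressibleFlow

/-! ### The weak equations on almost every time interval. -/

namespace CompressibleFlow

section

variable {Ω : Set E3} {T γ μ η ε L L' : ℝ} {ρ₀ : E3 → ℝ} {u₀ : E3 → E3} {ρ : ℝ → E3 → ℝ}
  {u : ℝ → E3 → E3} {Du : ℝ → E3 → E3 →L[ℝ] E3} {q : ℝ → E3 → ℝ} {w : ℝ → E3 → E3}

lemma clm_apply_meas {F : Type*} [NormedAddCommGroup F] [NormedSpace ℝ F]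
    [SecondCountableTopology F] {m : Measure (ℝ × E3)} {A : ℝ × E3 → E3 →L[ℝ] F}
    {v : ℝ × E3 → E3} (hA : AEStronglyMeasurable A m) (hv : AEStronglyMeasurable v m) :
    AEStronglyMeasurable (fun z => A z (v z)) m := by
  have h : AEStronglyMeasurable (fun z => (A z, v z)) m := hA.prodMk hv
  exact isBoundedBilinearMap_apply.continuous.comp_aestronglyMeasurable h

/-- The integrand of the weak formulation at a fixed time. -/
lemma IsFiniteEnergyWeakSolution.integrable_weakState (hΩ : IsSmoothBoundedOpen Ω) (hγ : 1 < γ)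
    (hμ : 0 ≤ μ) (hη : 0 ≤ η) (hε : 0 ≤ ε)
    (hS : IsFiniteEnergyWeakSolution Ω T γ μ η ε ρ₀ u₀ ρ u Du)
    (hq : IsBoundedField Ω T L q) (hw : IsBoundedField Ω T L' w) :
    Integrable (fun z : ℝ × E3 => ρ z.1 z.2 * q z.1 z.2
      - inner ℝ (ρ z.1 z.2 • u z.1 z.2) (w z.1 z.2)) (volume.restrict (Ioo 0 T ×ˢ Ω)) := by
  have hmem : ∀ᵐ z ∂(volume.restrict (Ioo 0 T ×ˢ Ω) : Measure (ℝ × E3)), z ∈ Ioo 0 T ×ˢ Ω :=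
    ae_restrict_mem (isOpen_cylinder hΩ.isOpen T).measurableSet
  refine Integrable.sub ?_ ?_
  · refine (hS.integrable_density hΩ hγ hμ hη hε).mul_bdd (c := L) (hq.meas hΩ.isOpen) ?_
    filter_upwards [hmem] with z hz
    exact hq.norm_le _ (Ioo_subset_Icc_self hz.1) _ (subset_closure hz.2)
  · refine ((hS.integrable_momentum_norm hΩ hγ hμ hη hε).mul_const L').mono'
      ((hS.density_meas.smul hS.velocity_meas).inner (hw.meas hΩ.isOpen)) ?_
    filter_upwards [hmem, hS.density_nonneg_ae] with z hz h0
    refine (norm_inner_le_norm _ _).trans ?_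
    rw [norm_smul, Real.norm_of_nonneg h0]
    have := hw.norm_le _ (Ioo_subset_Icc_self hz.1) _ (subset_closure hz.2)
    gcongr

lemma IsFiniteEnergyWeakSolution.integrable_continuity_terms (hΩ : IsSmoothBoundedOpen Ω)
    (hγ : 1 < γ) (hμ : 0 ≤ μ) (hη : 0 ≤ η) (hε : 0 ≤ ε)
    (hS : IsFiniteEnergyWeakSolution Ω T γ μ η ε ρ₀ u₀ ρ u Du)
    (hq : IsBoundedField Ω T L q) :
    Integrable (fun z : ℝ × E3 => ρ z.1 z.2 * deriv (fun s => q s z.2) z.1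
      + ρ z.1 z.2 * fderiv ℝ (q z.1) z.2 (u z.1 z.2)) (volume.restrict (Ioo 0 T ×ˢ Ω)) := by
  have hmem : ∀ᵐ z ∂(volume.restrict (Ioo 0 T ×ˢ Ω) : Measure (ℝ × E3)), z ∈ Ioo 0 T ×ˢ Ω :=
    ae_restrict_mem (isOpen_cylinder hΩ.isOpen T).measurableSet
  refine Integrable.add ?_ ?_
  · refine (hS.integrable_density hΩ hγ hμ hη hε).mul_bdd (c := L) (hq.meas_deriv hΩ.isOpen) ?_
    filter_upwards [hmem] with z hz
    exact hq.deriv_le _ hz.1 _ hz.2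
  · refine ((hS.integrable_momentum_norm hΩ hγ hμ hη hε).mul_const L).mono'
      (hS.density_meas.mul (clm_apply_meas (hq.meas_fderiv hΩ.isOpen) hS.velocity_meas)) ?_
    filter_upwards [hmem, hS.density_nonneg_ae] with z hz h0
    rw [norm_mul, Real.norm_of_nonneg h0, mul_assoc, mul_comm ‖u z.1 z.2‖]
    exact mul_le_mul_of_nonneg_left
      ((fderiv ℝ (q z.1) z.2).le_of_opNorm_le (hq.fderiv_le _ hz.1 _ hz.2) _) h0

lemma IsFiniteEnergyWeakSolution.integrable_momentum_terms (hΩ : IsSmoothBoundedOpen Ω)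
    (hγ : 1 < γ) (hμ : 0 ≤ μ) (hη : 0 ≤ η) (hε : 0 ≤ ε)
    (hS : IsFiniteEnergyWeakSolution Ω T γ μ η ε ρ₀ u₀ ρ u Du)
    (hw : IsBoundedField Ω T L' w) :
    Integrable (fun z : ℝ × E3 =>
      inner ℝ (ρ z.1 z.2 • u z.1 z.2) (deriv (fun s => w s z.2) z.1)
      + ρ z.1 z.2 * inner ℝ (u z.1 z.2) (fderiv ℝ (w z.1) z.2 (u z.1 z.2))
      + ρ z.1 z.2 ^ γ * tr (fderiv ℝ (w z.1) z.2)
      - ε * frob (stress μ η (Du z.1 z.2)) (fderiv ℝ (w z.1) z.2))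
      (volume.restrict (Ioo 0 T ×ˢ Ω)) := by
  have hfin := isFiniteMeasure_cylinder hΩ T
  have hmem : ∀ᵐ z ∂(volume.restrict (Ioo 0 T ×ˢ Ω) : Measure (ℝ × E3)), z ∈ Ioo 0 T ×ˢ Ω :=
    ae_restrict_mem (isOpen_cylinder hΩ.isOpen T).measurableSet
  have hDw := hw.meas_fderiv hΩ.isOpen
  have hDwb : ∀ᵐ z ∂(volume.restrict (Ioo 0 T ×ˢ Ω) : Measure (ℝ × E3)),
      ‖fderiv ℝ (w z.1) z.2‖ ≤ L' := hmem.mono fun z hz => hw.fderiv_le _ hz.1 _ hz.2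
  refine Integrable.sub (Integrable.add (Integrable.add ?_ ?_) ?_) ?_
  · refine ((hS.integrable_momentum_norm hΩ hγ hμ hη hε).mul_const L').mono'
      ((hS.density_meas.smul hS.velocity_meas).inner (hw.meas_deriv hΩ.isOpen)) ?_
    filter_upwards [hmem, hS.density_nonneg_ae] with z hz h0
    refine (norm_inner_le_norm _ _).trans ?_
    rw [norm_smul, Real.norm_of_nonneg h0]
    have := hw.deriv_le _ hz.1 _ hz.2
    gcongr
  · refine ((hS.integrable_kinetic hΩ hγ hμ hη hε).mul_const L').mono'
      (hS.density_meas.mul (hS.velocity_meas.inner (clm_apply_meas hDw hS.velocity_meas))) ?_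
    filter_upwards [hDwb, hS.density_nonneg_ae] with z hz h0
    rw [norm_mul, Real.norm_of_nonneg h0, mul_assoc]
    refine mul_le_mul_of_nonneg_left ?_ h0
    refine (norm_inner_le_norm _ _).trans ?_
    calc _ ≤ ‖u z.1 z.2‖ * (L' * ‖u z.1 z.2‖) := mul_le_mul_of_nonneg_left
          ((fderiv ℝ (w z.1) z.2).le_of_opNorm_le hz _) (norm_nonneg _)
      _ = _ := by ring
  · refine (hS.integrable_rpow hΩ hγ hμ hη hε).mul_bdd (c := 3 * L')
      (continuous_tr.comp_aestronglyMeasurable hDw) ?_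
    filter_upwards [hDwb] with z hz
    exact (abs_tr_le _).trans (by linarith)
  · exact (integrable_frob_stress hμ hη hS.velocity.2.1 (MemLp.of_bound hDw L' hDwb)).const_mul ε

lemma IsFiniteEnergyWeakSolution.integrable_weakRate (hΩ : IsSmoothBoundedOpen Ω) (hγ : 1 < γ)
    (hμ : 0 ≤ μ) (hη : 0 ≤ η) (hε : 0 ≤ ε)
    (hS : IsFiniteEnergyWeakSolution Ω T γ μ η ε ρ₀ u₀ ρ u Du)
    (hq : IsBoundedField Ω T L q) (hw : IsBoundedField Ω T L' w) :
    Integrable (weakRate γ μ η ε ρ u Du q w) (volume.restrict (Ioo 0 T ×ˢ Ω)) :=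
  (hS.integrable_continuity_terms hΩ hγ hμ hη hε hq).sub
    (hS.integrable_momentum_terms hΩ hγ hμ hη hε hw)

/-- The weak formulations hold on `[0, τ]` for almost every `τ`. -/
lemma IsFiniteEnergyWeakSolution.ae_weak_identity (hΩ : IsSmoothBoundedOpen Ω) (hT : 0 < T)
    (hγ : 1 < γ) (hμ : 0 ≤ μ) (hη : 0 ≤ η) (hε : 0 ≤ ε)
    (hS : IsFiniteEnergyWeakSolution Ω T γ μ η ε ρ₀ u₀ ρ u Du)
    (hq : IsBoundedField Ω T L q) (hw : IsBoundedField Ω T L' w)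
    (hK : ∃ K : Set E3, IsCompact K ∧ K ⊆ Ω ∧ ∀ t ∈ Icc 0 T, ∀ x ∈ Ω \ K, w t x = 0) :
    ∀ᵐ τ ∂(volume.restrict (Ioo 0 T)),
      ∫ x in Ω, (ρ τ x * q τ x - inner ℝ (ρ τ x • u τ x) (w τ x))
        = ((∫ x in Ω, ρ₀ x * q 0 x) - ∫ x in Ω, inner ℝ (ρ₀ x • u₀ x) (w 0 x))
          + ∫ t in Ioo 0 τ, ∫ x in Ω, weakRate γ μ η ε ρ u Du q w (t, x) := by
  have hG := hS.integrable_weakState hΩ hγ hμ hη hε hq hw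
  have hR := hS.integrable_weakRate hΩ hγ hμ hη hε hq hw
  have hms : MeasurableSet (Ioo 0 T ×ˢ Ω) := (isOpen_cylinder hΩ.isOpen T).measurableSet
  have hg : IntegrableOn (fun t => ∫ x in Ω, (ρ t x * q t x - inner ℝ (ρ t x • u t x) (w t x)))
      (Ioo 0 T) := by
    rw [volume_restrict_cylinder] at hG
    exact hG.integral_prod_left
  have hf : IntegrableOn (fun t => ∫ x in Ω, weakRate γ μ η ε ρ u Du q w (t, x)) (Ioo 0 T) := by
    rw [volume_restrict_cylinder] at hR
    exact hR.integral_prod_left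
  -- Test the two equations with `θ(t) q` and `θ(t) w` and subtract; `θ T = 0` removes the terms at
  -- the final time.
  refine ae_eq_add_integral_of_weak hT hg hf fun θ hθ hθT => ?_
  have hθd : Differentiable ℝ θ := hθ.differentiable (by simp)
  have hθc : Continuous (deriv θ) := hθ.continuous_deriv (by simp)
  have hθ1 : ContDiffOn ℝ ∞ (fun z : ℝ × E3 => θ z.1) (Icc 0 T ×ˢ closure Ω) :=
    (hθ.comp contDiff_fst).contDiffOn
  have h1 := hS.continuity_eq (fun t x => θ t * q t x) (hθ1.mul hq.contDiffOn)
  have h2 := hS.momentum_eq (fun t x => θ t • w t x)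
    ⟨(hθ1.smul hw.contDiffOn).mono (prod_mono Subset.rfl subset_closure), by
      obtain ⟨K, hK1, hK2, hK3⟩ := hK
      exact ⟨K, hK1, hK2, fun t ht x hx => by simp [hK3 t ht x hx]⟩⟩
  have e1 : ∫ z in Ioo 0 T ×ˢ Ω, (ρ z.1 z.2 * deriv (fun s => θ s * q s z.2) z.1
        + ρ z.1 z.2 * fderiv ℝ (fun x => θ z.1 * q z.1 x) z.2 (u z.1 z.2))
      = ∫ z in Ioo 0 T ×ˢ Ω, (deriv θ z.1 * (ρ z.1 z.2 * q z.1 z.2)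
        + θ z.1 * (ρ z.1 z.2 * deriv (fun s => q s z.2) z.1
          + ρ z.1 z.2 * fderiv ℝ (q z.1) z.2 (u z.1 z.2))) := by
    refine setIntegral_congr_fun hms fun z hz => ?_
    have d1 := differentiableAt_time hΩ.isOpen hq.contDiffOn hz.1 hz.2
    have d2 := differentiableAt_space hΩ.isOpen hq.contDiffOn hz.1 hz.2
    rw [deriv_fun_mul (hθd _) d1, fderiv_const_mul d2]
    simp only [smul_apply, smul_eq_mul]
    ring
  have e2 : ∫ z in Ioo 0 T ×ˢ Ω,
          (inner ℝ (ρ z.1 z.2 • u z.1 z.2) (deriv (fun s => θ s • w s z.2) z.1)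
            + ρ z.1 z.2 * inner ℝ (u z.1 z.2) (fderiv ℝ (fun x => θ z.1 • w z.1 x) z.2 (u z.1 z.2))
            + ρ z.1 z.2 ^ γ * div (fun x => θ z.1 • w z.1 x) z.2
            - ε * frob (stress μ η (Du z.1 z.2)) (fderiv ℝ (fun x => θ z.1 • w z.1 x) z.2))
      = ∫ z in Ioo 0 T ×ˢ Ω, (deriv θ z.1 * inner ℝ (ρ z.1 z.2 • u z.1 z.2) (w z.1 z.2)
        + θ z.1 * (inner ℝ (ρ z.1 z.2 • u z.1 z.2) (deriv (fun s => w s z.2) z.1)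
          + ρ z.1 z.2 * inner ℝ (u z.1 z.2) (fderiv ℝ (w z.1) z.2 (u z.1 z.2))
          + ρ z.1 z.2 ^ γ * tr (fderiv ℝ (w z.1) z.2)
          - ε * frob (stress μ η (Du z.1 z.2)) (fderiv ℝ (w z.1) z.2))) := by
    refine setIntegral_congr_fun hms fun z hz => ?_
    have d1 := differentiableAt_time hΩ.isOpen hw.contDiffOn hz.1 hz.2
    have d2 := differentiableAt_space hΩ.isOpen hw.contDiffOn hz.1 hz.2
    have f1 : tr (θ z.1 • fderiv ℝ (w z.1) z.2) = θ z.1 * tr (fderiv ℝ (w z.1) z.2) := by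
      simp [tr, Finset.mul_sum]
    have f2 : frob (stress μ η (Du z.1 z.2)) (θ z.1 • fderiv ℝ (w z.1) z.2)
        = θ z.1 * frob (stress μ η (Du z.1 z.2)) (fderiv ℝ (w z.1) z.2) := by
      have := frob_add_smul (θ z.1) (stress μ η (Du z.1 z.2)) (fderiv ℝ (w z.1) z.2) 0
      simpa [frob] using this
    simp only [div]
    rw [deriv_fun_smul (hθd _) d1, fderiv_fun_const_smul d2, f1, f2]
    simp only [smul_apply, inner_add_right, inner_smul_right]
    ring
  rw [e1] at h1
  rw [e2] at h2
  simp only [hθT, zero_mul, mul_zero, zero_smul, inner_zero_right, integral_zero, zero_sub] at h1 h2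
  have f3 : ∫ x in Ω, ρ₀ x * (θ 0 * q 0 x) = θ 0 * ∫ x in Ω, ρ₀ x * q 0 x := by
    rw [← integral_const_mul]; congr 1; ext x; ring
  have f4 : ∫ x in Ω, inner ℝ (ρ₀ x • u₀ x) (θ 0 • w 0 x)
      = θ 0 * ∫ x in Ω, inner ℝ (ρ₀ x • u₀ x) (w 0 x) := by
    rw [← integral_const_mul]; simp only [inner_smul_right]
  rw [f3] at h1
  rw [f4] at h2
  -- bounded multipliers
  have hbdd : ∀ {k : ℝ → ℝ}, Continuous k → ∀ {Φ : ℝ × E3 → ℝ},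
      Integrable Φ (volume.restrict (Ioo 0 T ×ˢ Ω)) →
      Integrable (fun z => k z.1 * Φ z) (volume.restrict (Ioo 0 T ×ˢ Ω)) := by
    intro k hk Φ hΦ
    obtain ⟨C, hC⟩ := isCompact_Icc.exists_bound_of_continuousOn (s := Icc 0 T) hk.continuousOn
    refine hΦ.bdd_mul (c := C) (hk.comp continuous_fst).aestronglyMeasurable ?_
    filter_upwards [ae_restrict_mem hms] with z hz
    exact hC _ (Ioo_subset_Icc_self hz.1)
  have hfub : ∀ {k : ℝ → ℝ}, Continuous k → ∀ {Φ : ℝ × E3 → ℝ},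
      Integrable Φ (volume.restrict (Ioo 0 T ×ˢ Ω)) →
      IntegrableOn (fun t => k t * ∫ x in Ω, Φ (t, x)) (Ioo 0 T) ∧
      ∫ z in Ioo 0 T ×ˢ Ω, k z.1 * Φ z = ∫ t in Ioo 0 T, k t * ∫ x in Ω, Φ (t, x) := by
    intro k hk Φ hΦ
    have h := hbdd hk hΦ
    rw [volume_restrict_cylinder] at h ⊢
    have e : (fun t => ∫ x in Ω, k t * Φ (t, x)) = fun t => k t * ∫ x in Ω, Φ (t, x) :=
      funext fun t => integral_const_mul _ _
    refine ⟨e ▸ h.integral_prod_left, ?_⟩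
    rw [integral_prod _ h]
    exact congrArg (fun g => ∫ t in Ioo 0 T, g t) e
  have hqI : Integrable (fun z : ℝ × E3 => ρ z.1 z.2 * q z.1 z.2)
      (volume.restrict (Ioo 0 T ×ˢ Ω)) := by
    refine (hS.integrable_density hΩ hγ hμ hη hε).mul_bdd (c := L) (hq.meas hΩ.isOpen) ?_
    filter_upwards [ae_restrict_mem hms] with z hz
    exact hq.norm_le _ (Ioo_subset_Icc_self hz.1) _ (subset_closure hz.2)
  have hwI : Integrable (fun z : ℝ × E3 => inner ℝ (ρ z.1 z.2 • u z.1 z.2) (w z.1 z.2))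
      (volume.restrict (Ioo 0 T ×ˢ Ω)) := by
    refine (hqI.sub hG).congr (Eventually.of_forall fun z => ?_)
    simp
  have hcI := hS.integrable_continuity_terms hΩ hγ hμ hη hε hq
  have hmI := hS.integrable_momentum_terms hΩ hγ hμ hη hε hw
  rw [integral_add (hbdd hθc hqI) (hbdd hθ.continuous hcI)] at h1
  rw [integral_add (hbdd hθc hwI) (hbdd hθ.continuous hmI)] at h2
  have i1 := hfub hθc hG
  have i2 := hfub hθ.continuous hR
  rw [integral_add i1.1 i2.1, ← i1.2, ← i2.2]
  have j1 : ∫ z in Ioo 0 T ×ˢ Ω, deriv θ z.1 * (ρ z.1 z.2 * q z.1 z.2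
      - inner ℝ (ρ z.1 z.2 • u z.1 z.2) (w z.1 z.2))
      = (∫ z in Ioo 0 T ×ˢ Ω, deriv θ z.1 * (ρ z.1 z.2 * q z.1 z.2))
        - ∫ z in Ioo 0 T ×ˢ Ω, deriv θ z.1 * inner ℝ (ρ z.1 z.2 • u z.1 z.2) (w z.1 z.2) := by
    rw [← integral_sub (hbdd hθc hqI) (hbdd hθc hwI)]
    simp only [mul_sub]
  have j2 := integral_sub (hbdd hθ.continuous hcI) (hbdd hθ.continuous hmI)
  simp only [← mul_sub] at j2
  rw [j1]
  simp only [weakRate]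
  linarith

end

end CompressibleFlow

namespace CompressibleFlow

/-! ### Integral identities for smooth fields -/

section

variable {Ω : Set E3} {T L : ℝ}

lemma IsBoundedField.meas_slice {F : Type*} [NormedAddCommGroup F] [NormedSpace ℝ F]
    [SecondCountableTopology F] {f : ℝ → E3 → F} (hf : IsBoundedField Ω T L f) (hΩ : IsOpen Ω)
    {t : ℝ} (ht : t ∈ Icc 0 T) : AEStronglyMeasurable (f t) (volume.restrict Ω) := by
  have h : ContinuousOn (f t) (closure Ω) :=
    hf.contDiffOn.continuousOn.comp (f := fun x => (t, x)) (by fun_prop) fun x hx => ⟨ht, hx⟩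
  exact (h.mono subset_closure).aestronglyMeasurable hΩ.measurableSet

lemma IsBoundedField.integrable_slice {f : ℝ → E3 → ℝ} (hf : IsBoundedField Ω T L f)
    (hΩ : IsSmoothBoundedOpen Ω) {t : ℝ} (ht : t ∈ Icc 0 T) :
    Integrable (f t) (volume.restrict Ω) := by
  have := isFiniteMeasure_restrict hΩ
  refine Integrable.of_bound (hf.meas_slice hΩ.isOpen ht) L ?_
  filter_upwards [ae_restrict_mem hΩ.isOpen.measurableSet] with x hx
  exact hf.norm_le t ht x (subset_closure hx)

lemma IsBoundedField.integrable_deriv {f : ℝ → E3 → ℝ} (hf : IsBoundedField Ω T L f)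
    (hΩ : IsSmoothBoundedOpen Ω) :
    Integrable (fun z : ℝ × E3 => deriv (fun s => f s z.2) z.1)
      (volume.restrict (Ioo 0 T ×ˢ Ω)) := by
  have := isFiniteMeasure_cylinder hΩ T
  refine Integrable.of_bound (hf.meas_deriv hΩ.isOpen) L ?_
  filter_upwards [ae_restrict_mem (isOpen_cylinder hΩ.isOpen T).measurableSet] with z hz
  exact hf.deriv_le _ hz.1 _ hz.2

lemma IsBoundedField.integral_eq_add_integral_deriv {f : ℝ → E3 → ℝ}
    (hf : IsBoundedField Ω T L f) (hΩ : IsSmoothBoundedOpen Ω) {τ : ℝ} (hτ : τ ∈ Ioo 0 T) :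
    ∫ x in Ω, f τ x = (∫ x in Ω, f 0 x)
      + ∫ t in Ioo 0 τ, ∫ x in Ω, deriv (fun s => f s x) t := by
  have hsub : Ioo 0 τ ⊆ Ioo 0 T := Ioo_subset_Ioo_right hτ.2.le
  have hint : Integrable (Function.uncurry fun (t : ℝ) (x : E3) => deriv (fun s => f s x) t)
      ((volume.restrict (Ioo 0 τ)).prod (volume.restrict Ω)) := by
    rw [← volume_restrict_cylinder]
    exact (hf.integrable_deriv hΩ).mono_measure
      (Measure.restrict_mono (prod_mono hsub Subset.rfl) le_rfl)
  rw [integral_integral_swap hint]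
  have h0T : (0 : ℝ) ∈ Icc 0 T := ⟨le_rfl, (hτ.1.trans hτ.2).le⟩
  have hxe : ∀ x ∈ Ω, ∫ t in Ioo 0 τ, deriv (fun s => f s x) t = f τ x - f 0 x := by
    intro x hx
    rw [← integral_Ioc_eq_integral_Ioo, ← intervalIntegral.integral_of_le hτ.1.le]
    refine intervalIntegral.integral_eq_sub_of_hasDerivAt_of_le (f := fun s => f s x) hτ.1.le ?_ ?_ ?_
    · refine hf.contDiffOn.continuousOn.comp (f := fun s : ℝ => (s, x)) (by fun_prop) fun s hs => ?_
      exact ⟨⟨hs.1, hs.2.trans hτ.2.le⟩, subset_closure hx⟩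
    · exact fun t ht => (differentiableAt_time hΩ.isOpen hf.contDiffOn (hsub ht) hx).hasDerivAt
    · rw [intervalIntegrable_iff_integrableOn_Ioo_of_le hτ.1.le]
      refine Measure.integrableOn_of_bounded (M := L) (by simp) (aestronglyMeasurable_deriv _ _) ?_
      filter_upwards [ae_restrict_mem measurableSet_Ioo] with t ht
      exact hf.deriv_le t (hsub ht) x hx
  rw [setIntegral_congr_fun hΩ.isOpen.measurableSet hxe,
    integral_sub (hf.integrable_slice hΩ (Ioo_subset_Icc_self hτ)) (hf.integrable_slice hΩ h0T)]
  ring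

lemma integrable_tr_fderiv {w : ℝ → E3 → E3} (hw : IsBoundedField Ω T L w)
    (hΩ : IsSmoothBoundedOpen Ω) :
    Integrable (fun z : ℝ × E3 => tr (fderiv ℝ (w z.1) z.2)) (volume.restrict (Ioo 0 T ×ˢ Ω)) := by
  have := isFiniteMeasure_cylinder hΩ T
  refine Integrable.of_bound
    (continuous_tr.comp_aestronglyMeasurable (hw.meas_fderiv hΩ.isOpen)) (3 * L) ?_
  filter_upwards [ae_restrict_mem (isOpen_cylinder hΩ.isOpen T).measurableSet] with z hz
  exact (abs_tr_le _).trans (by linarith [hw.fderiv_le _ hz.1 _ hz.2])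

/-- The divergence theorem for fields compactly supported in `Ω`. -/
lemma integral_tr_fderiv_eq_zero {w : ℝ → E3 → E3} (hw : IsBoundedField Ω T L w)
    (hΩ : IsSmoothBoundedOpen Ω)
    (hK : ∃ K : Set E3, IsCompact K ∧ K ⊆ Ω ∧ ∀ t ∈ Icc 0 T, ∀ x ∈ Ω \ K, w t x = 0)
    {t : ℝ} (ht : t ∈ Ioo 0 T) : ∫ x in Ω, tr (fderiv ℝ (w t) x) = 0 := by
  obtain ⟨K, hKc, hKΩ, hK0⟩ := hK
  have hfin := isFiniteMeasure_restrict hΩ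
  have hΩm := hΩ.isOpen.measurableSet
  set A : E3 → E3 →L[ℝ] E3 := fun x => fderiv ℝ (w t) x with hA
  have hAc : ContinuousOn A Ω :=
    (continuousOn_fderiv_space hΩ.isOpen hw.contDiffOn).comp (f := fun x => (t, x)) (by fun_prop)
      fun x hx => ⟨ht, hx⟩
  -- As `w t` vanishes in `Ω` outside the compact `K`, its extension by zero is differentiable on
  -- all of `ℝ³`, with no boundary term.
  set W : E3 → E3 := Ω.indicator (w t) with hW
  have hWin : ∀ x ∈ Ω, HasFDerivAt W (A x) x := by
    intro x hx
    refine (differentiableAt_space hΩ.isOpen hw.contDiffOn ht hx).hasFDerivAt.congr_of_eventuallyEq ?_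
    filter_upwards [hΩ.isOpen.mem_nhds hx] with y hy
    exact indicator_of_mem hy _
  have hWout : ∀ x ∉ Ω, HasFDerivAt W (0 : E3 →L[ℝ] E3) x := by
    intro x hx
    refine (hasFDerivAt_const (0 : E3) x).congr_of_eventuallyEq ?_
    filter_upwards [hKc.isClosed.isOpen_compl.mem_nhds fun h => hx (hKΩ h)] with y hy
    by_cases hyΩ : y ∈ Ω
    · rw [hW, indicator_of_mem hyΩ]; exact hK0 t (Ioo_subset_Icc_self ht) y ⟨hyΩ, hy⟩
    · exact indicator_of_notMem hyΩ _
  have hWd : Differentiable ℝ W := fun x => by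
    by_cases hx : x ∈ Ω
    · exact (hWin x hx).differentiableAt
    · exact (hWout x hx).differentiableAt
  have hWb : ∀ x, ‖W x‖ ≤ max L 0 := fun x => by
    by_cases hx : x ∈ Ω
    · rw [hW, indicator_of_mem hx]
      exact (hw.norm_le t (Ioo_subset_Icc_self ht) x (subset_closure hx)).trans (le_max_left _ _)
    · rw [hW, indicator_of_notMem hx]; simp
  have hi : ∀ i : Fin 3, IntegrableOn (fun x => (A x (e i)) i) Ω ∧
      ∫ x in Ω, (A x (e i)) i = 0 := by
    intro i
    set g : E3 → ℝ := fun x => (W x) i with hg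
    have hgd : ∀ x, HasFDerivAt g
        ((EuclideanSpace.proj i : E3 →L[ℝ] ℝ).comp (fderiv ℝ W x)) x := fun x =>
      (EuclideanSpace.proj i : E3 →L[ℝ] ℝ).hasFDerivAt.comp x (hWd x).hasFDerivAt
    have hgf : ∀ x, fderiv ℝ g x (e i) = Ω.indicator (fun x => (A x (e i)) i) x := by
      intro x
      rw [(hgd x).fderiv]
      by_cases hx : x ∈ Ω
      · rw [indicator_of_mem hx, (hWin x hx).fderiv]; rfl
      · rw [indicator_of_notMem hx, (hWout x hx).fderiv]; simp
    have hIA : IntegrableOn (fun x => (A x (e i)) i) Ω := by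
      have hc : ContinuousOn (fun x => (A x (e i)) i) Ω :=
        (EuclideanSpace.proj i : E3 →L[ℝ] ℝ).continuous.comp_continuousOn
          (hAc.clm_apply continuousOn_const)
      refine Integrable.of_bound (hc.aestronglyMeasurable hΩm) L ?_
      filter_upwards [ae_restrict_mem hΩm] with x hx
      exact (abs_entry_le _ i i).trans (hw.fderiv_le t ht x hx)
    have hIg : Integrable g := by
      have hgc : Continuous g := (EuclideanSpace.proj i : E3 →L[ℝ] ℝ).continuous.comp hWd.continuous
      have : IntegrableOn g Ω := Integrable.of_bound hgc.aestronglyMeasurable (max L 0)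
        (Eventually.of_forall fun x => (abs_coord_le_norm _ i).trans (hWb x))
      refine (integrableOn_iff_integrable_of_support_subset ?_).1 this
      intro x hx
      by_contra hxΩ
      exact hx (by simp [hg, hW, hxΩ])
    have hId : Integrable (fun x => fderiv ℝ g x (e i)) := by
      simp_rw [hgf]
      exact (integrable_indicator_iff hΩm).2 hIA
    -- Integration by parts against the constant `1`, one coordinate at a time.
    have h := integral_mul_fderiv_eq_neg_fderiv_mul_of_integrable (μ := volume)
      (f := fun _ : E3 => (1 : ℝ)) (g := g) (v := e i) (by simp) (by simpa using hId)
      (by simpa using hIg) (fun _ _ => by fun_prop) (fun x _ => (hgd x).differentiableAt)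
    simp only [one_mul, fderiv_fun_const, Pi.zero_apply, zero_apply, zero_mul,
      integral_zero, neg_zero] at h
    simp_rw [hgf] at h
    rw [integral_indicator hΩm] at h
    exact ⟨hIA, h⟩
  simp only [tr]
  rw [integral_finsetSum _ fun i _ => (hi i).1]
  exact Finset.sum_eq_zero fun i _ => (hi i).2

end

/-! ### States of finite energy -/

/-- A state `(s, v)` of finite energy. -/
structure IsState (Ω : Set E3) (γ : ℝ) (s : E3 → ℝ) (v : E3 → E3) : Prop where
  meas : AEStronglyMeasurable s (volume.restrict Ω)
  meas_momentum : AEStronglyMeasurable (fun x => s x • v x) (volume.restrict Ω)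
  nonneg : ∀ᵐ x ∂(volume.restrict Ω), 0 ≤ s x
  rpow : Integrable (fun x => s x ^ γ) (volume.restrict Ω)
  kinetic : Integrable (fun x => s x * ‖v x‖ ^ 2) (volume.restrict Ω)

section

variable {Ω : Set E3} {T γ μ η ε L : ℝ} {s : E3 → ℝ} {v : E3 → E3}

lemma IsInitialData.isState (hγ : 1 < γ) (h : IsInitialData Ω γ s v) : IsState Ω γ s v where
  meas := h.memLp.1
  meas_momentum := h.memLp.1.smul h.meas
  nonneg := h.nonneg
  rpow := integrable_rpow_of_memLp hγ h.memLp h.nonneg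
  kinetic := h.kinetic

lemma IsFiniteEnergyWeakSolution.ae_isState {ρ₀ : E3 → ℝ} {u₀ : E3 → E3} {ρ : ℝ → E3 → ℝ}
    {u : ℝ → E3 → E3} {Du : ℝ → E3 → E3 →L[ℝ] E3} (hγ : 1 < γ) (hμ : 0 ≤ μ) (hη : 0 ≤ η)
    (hε : 0 ≤ ε) (hS : IsFiniteEnergyWeakSolution Ω T γ μ η ε ρ₀ u₀ ρ u Du) :
    ∀ᵐ t ∂(volume.restrict (Ioo 0 T)), IsState Ω γ (ρ t) (u t) := by
  filter_upwards [hS.ae_energy hγ hμ hη hε, ae_restrict_mem measurableSet_Ioo] with t ⟨h1, h2, _⟩ ht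
  have ht' := Ioo_subset_Icc_self ht
  exact ⟨(hS.density_cw.1 t ht').1, (hS.momentum_cw.1 t ht').1, hS.density_nonneg t ht', h1, h2⟩

lemma IsState.integrable_density (hs : IsState Ω γ s v) (hΩ : IsSmoothBoundedOpen Ω) (hγ : 1 < γ) :
    Integrable s (volume.restrict Ω) := by
  have := isFiniteMeasure_restrict hΩ
  refine (hs.rpow.add (integrable_const 1)).mono' hs.meas ?_
  filter_upwards [hs.nonneg] with x hx
  rw [Real.norm_of_nonneg hx]
  exact le_rpow_add_one hγ hx

lemma IsState.integrable_inner (hs : IsState Ω γ s v) (hΩ : IsSmoothBoundedOpen Ω) (hγ : 1 < γ)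
    {V : E3 → E3} (hV : AEStronglyMeasurable V (volume.restrict Ω))
    (hVb : ∀ x ∈ Ω, ‖V x‖ ≤ L) :
    Integrable (fun x => inner ℝ (s x • v x) (V x)) (volume.restrict Ω) := by
  refine (((hs.integrable_density hΩ hγ).add hs.kinetic).mul_const L).mono'
    (hs.meas_momentum.inner hV) ?_
  filter_upwards [hs.nonneg, ae_restrict_mem hΩ.isOpen.measurableSet] with x hx hxΩ
  refine (norm_inner_le_norm _ _).trans ?_
  rw [norm_smul, Real.norm_of_nonneg hx, Pi.add_apply]
  have h1 : s x * ‖v x‖ ≤ s x + s x * ‖v x‖ ^ 2 := by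
    nlinarith [mul_nonneg hx (sq_nonneg (‖v x‖ - 1)), mul_nonneg hx (norm_nonneg (v x))]
  exact mul_le_mul h1 (hVb x hxΩ) (norm_nonneg _) (by positivity)

/-- `V` is split as `kV + (1-k)V` so that each summand has its own tool: the energy inequality, the
weak equations, the time derivative of the Euler pressure, and the smallness of the momentum in the
layer. -/
lemma relEnergy_eq {γ s r : ℝ} (hγ : 1 < γ) (hr : 0 < r) (k : ℝ) (v V : E3) :
    relEnergy γ s v r V = (1 / 2 * s * ‖v‖ ^ 2 + s ^ γ / (γ - 1))
      + (s * (1 / 2 * ‖V‖ ^ 2 - γ / (γ - 1) * r ^ (γ - 1)) - inner ℝ (s • v) (k • V))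
      + r ^ γ - inner ℝ (s • v) ((1 - k) • V) := by
  have hg : γ - 1 ≠ 0 := by linarith
  rw [relEnergy, relPressure, ← rpow_sub_one_mul_self hr.le hγ, norm_sub_sq_real]
  simp only [inner_smul_left, inner_smul_right, conj_trivial]
  field_simp
  ring

/-- The part of the momentum carried by a thin set is small. -/
lemma IsState.abs_integral_inner_le (hs : IsState Ω γ s v) (hΩ : IsSmoothBoundedOpen Ω)
    (hγ : 1 < γ) {M l K : ℝ} (hl : 0 < l) (hK : 0 < K) (hL : 0 ≤ L) (hM : energy Ω γ s v ≤ M)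
    {V : E3 → E3} (hVb : ∀ x ∈ Ω, ‖V x‖ ≤ L)
    {S : Set E3} (hSm : MeasurableSet S) (hV0 : ∀ x ∈ Ω \ S, V x = 0) :
    |∫ x in Ω, inner ℝ (s x • v x) (V x)|
      ≤ L * (l * (2 * M) + l⁻¹ * (K * (volume.restrict Ω).real S
        + K ^ (1 - γ) * ((γ - 1) * M))) := by
  have := isFiniteMeasure_restrict hΩ
  obtain ⟨h1, h2⟩ := energy_terms_le hγ hs.nonneg hs.rpow hs.kinetic hM
  have hI : Integrable (fun x => S.indicator (fun _ => K) x) (volume.restrict Ω) :=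
    (integrable_const K).indicator hSm
  have hI2 : Integrable (fun x => S.indicator (fun _ => K) x + K ^ (1 - γ) * s x ^ γ)
      (volume.restrict Ω) := hI.add (hs.rpow.const_mul _)
  have hb : Integrable (fun x => L * (l * (s x * ‖v x‖ ^ 2)
      + l⁻¹ * (S.indicator (fun _ => K) x + K ^ (1 - γ) * s x ^ γ))) (volume.restrict Ω) :=
    ((hs.kinetic.const_mul l).add (hI2.const_mul _)).const_mul L
  have hle := norm_integral_le_of_norm_le hb (f := fun x => inner ℝ (s x • v x) (V x)) (by
    filter_upwards [hs.nonneg, ae_restrict_mem hΩ.isOpen.measurableSet] with x hx hxΩ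
    have hsγ := Real.rpow_nonneg hx γ
    by_cases hxS : x ∈ S
    · rw [indicator_of_mem hxS]
      refine (norm_inner_le_norm _ _).trans ?_
      rw [norm_smul, Real.norm_of_nonneg hx]
      -- Young, and then truncation of the density at height `K`: the mass in `S` is at most `K`
      -- times its volume plus a tail of order `K^(1-γ)`.
      have a1 : s x * ‖v x‖ ≤ l * (s x * ‖v x‖ ^ 2) + l⁻¹ * s x := by
        have : ‖v x‖ ≤ l * ‖v x‖ ^ 2 + l⁻¹ := by
          have h3 : 0 ≤ l⁻¹ * (l * ‖v x‖ - 1) ^ 2 := by positivity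
          have h4 : l⁻¹ * (l * ‖v x‖ - 1) ^ 2 = l * ‖v x‖ ^ 2 - 2 * ‖v x‖ + l⁻¹ := by
            field_simp
            ring
          linarith [norm_nonneg (v x)]
        calc s x * ‖v x‖ ≤ s x * (l * ‖v x‖ ^ 2 + l⁻¹) := mul_le_mul_of_nonneg_left this hx
          _ = _ := by ring
      have a2 := mul_le_mul_of_nonneg_left (le_add_mul_rpow hγ hK hx) (inv_nonneg.2 hl.le)
      calc s x * ‖v x‖ * ‖V x‖ ≤ (l * (s x * ‖v x‖ ^ 2) + l⁻¹ * (K + K ^ (1 - γ) * s x ^ γ)) * L :=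
            mul_le_mul (by linarith) (hVb x hxΩ) (norm_nonneg _) (by positivity)
        _ = _ := by ring
    · rw [hV0 x ⟨hxΩ, hxS⟩, inner_zero_right, norm_zero, indicator_of_notMem hxS]
      positivity)
  refine hle.trans ?_
  rw [integral_const_mul, integral_add (hs.kinetic.const_mul l)
    (hI2.const_mul _), integral_const_mul, integral_const_mul,
    integral_add hI (hs.rpow.const_mul _), integral_const_mul, integral_indicator_const _ hSm,
    smul_eq_mul]
  have : 0 ≤ K ^ (1 - γ) := by positivity
  rw [mul_comm K]
  gcongr

end

end CompressibleFlow

namespace CompressibleFlow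

/-! ### Test fields built from the Euler flow -/

/-- The scalar test function of the relative energy method. -/
noncomputable def eulerPotential (γ : ℝ) (r : ℝ → E3 → ℝ) (U : ℝ → E3 → E3) (t : ℝ) (x : E3) : ℝ :=
  1 / 2 * ‖U t x‖ ^ 2 - γ / (γ - 1) * r t x ^ (γ - 1)

section

variable {Ω : Set E3} {T γ μ η ε a : ℝ} {r : ℝ → E3 → ℝ} {U : ℝ → E3 → E3} {χ : E3 → ℝ}

lemma contDiffOn_rpow (hE : IsSmoothEulerSolution Ω T γ r U) (ha : 0 < a)
    (hr : ∀ t ∈ Icc 0 T, ∀ x ∈ closure Ω, a ≤ r t x) (p : ℝ) :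
    ContDiffOn ℝ ∞ (fun z : ℝ × E3 => r z.1 z.2 ^ p) (Icc 0 T ×ˢ closure Ω) :=
  hE.density_smooth.rpow_const_of_ne fun z hz => (ha.trans_le (hr z.1 hz.1 z.2 hz.2)).ne'

lemma contDiffOn_eulerPotential (hE : IsSmoothEulerSolution Ω T γ r U) (ha : 0 < a)
    (hr : ∀ t ∈ Icc 0 T, ∀ x ∈ closure Ω, a ≤ r t x) :
    ContDiffOn ℝ ∞ (fun z : ℝ × E3 => eulerPotential γ r U z.1 z.2) (Icc 0 T ×ˢ closure Ω) :=
  (contDiffOn_const.mul (hE.velocity_smooth.norm_sq ℝ)).sub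
    (contDiffOn_const.mul (contDiffOn_rpow hE ha hr (γ - 1)))

lemma contDiffOn_cutoff_smul (hE : IsSmoothEulerSolution Ω T γ r U) (hχ : ContDiff ℝ ∞ χ) :
    ContDiffOn ℝ ∞ (fun z : ℝ × E3 => χ z.2 • U z.1 z.2) (Icc 0 T ×ˢ closure Ω) :=
  ((hχ.comp contDiff_snd).contDiffOn).smul hE.velocity_smooth

lemma contDiffOn_pressure_smul (hE : IsSmoothEulerSolution Ω T γ r U) (ha : 0 < a)
    (hr : ∀ t ∈ Icc 0 T, ∀ x ∈ closure Ω, a ≤ r t x) (hχ : ContDiff ℝ ∞ χ) :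
    ContDiffOn ℝ ∞ (fun z : ℝ × E3 => r z.1 z.2 ^ γ • (χ z.2 • U z.1 z.2))
      (Icc 0 T ×ˢ closure Ω) :=
  (contDiffOn_rpow hE ha hr γ).smul (contDiffOn_cutoff_smul hE hχ)

/-- The space-time rate of the relative energy equals the remainder of the relative energy
method. -/
lemma weakRate_add_eq (hγ : 1 < γ) (hΩ : IsOpen Ω) (hE : IsSmoothEulerSolution Ω T γ r U)
    (ha : 0 < a) (hr : ∀ t ∈ Icc 0 T, ∀ x ∈ closure Ω, a ≤ r t x) (hχ : ContDiff ℝ ∞ χ)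
    (ρ : ℝ → E3 → ℝ) (u : ℝ → E3 → E3) (Du : ℝ → E3 → E3 →L[ℝ] E3)
    {t : ℝ} (ht : t ∈ Ioo 0 T) {x : E3} (hx : x ∈ Ω) :
    weakRate γ μ η ε ρ u Du (eulerPotential γ r U) (fun t x => χ x • U t x) (t, x)
      + deriv (fun s => r s x ^ γ) t
      + tr (fderiv ℝ (fun y => r t y ^ γ • (χ y • U t y)) x)
    = -(ρ t x * inner ℝ (u t x - U t x) (fderiv ℝ (U t) x (u t x - U t x)))
        - relPressure γ (ρ t x) (r t x) * tr (fderiv ℝ (U t) x)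
      + (1 - χ x) * (ρ t x * inner ℝ (u t x) (deriv (fun s => U s x) t)
        + ρ t x * inner ℝ (u t x) (fderiv ℝ (U t) x (u t x))
        + (ρ t x ^ γ - r t x ^ γ) * tr (fderiv ℝ (U t) x)
        - γ * r t x ^ (γ - 1) * fderiv ℝ (r t) x (U t x))
      - ρ t x * inner ℝ (u t x) (U t x) * fderiv ℝ χ x (u t x)
      - (ρ t x ^ γ - r t x ^ γ) * fderiv ℝ χ x (U t x)
      + ε * χ x * frob (stress μ η (Du t x)) (fderiv ℝ (U t) x)
      + ε * frob (stress μ η (Du t x)) ((fderiv ℝ χ x).smulRight (U t x)) := by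
  have hR : 0 < r t x := ha.trans_le (hr t (Ioo_subset_Icc_self ht) x (subset_closure hx))
  have hg : γ - 1 ≠ 0 := by linarith
  have hrt := (differentiableAt_time hΩ hE.density_smooth ht hx).hasDerivAt
  have hUt := (differentiableAt_time hΩ hE.velocity_smooth ht hx).hasDerivAt
  have hrx := (differentiableAt_space hΩ hE.density_smooth ht hx).hasFDerivAt
  have hUx := (differentiableAt_space hΩ hE.velocity_smooth ht hx).hasFDerivAt
  have hχx := (hχ.differentiable (by simp) x).hasFDerivAt
  have hexp : γ - 1 - 1 = γ - 2 := by ring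
  have hqt : deriv (fun s => eulerPotential γ r U s x) t
      = inner ℝ (U t x) (deriv (fun s => U s x) t)
        - γ * r t x ^ (γ - 2) * deriv (fun s => r s x) t := by
    have h : HasDerivAt (fun s => 1 / 2 * ‖U s x‖ ^ 2 - γ / (γ - 1) * r s x ^ (γ - 1)) _ t :=
      (hUt.norm_sq.const_mul (1 / 2)).sub
        ((hrt.rpow_const (p := γ - 1) (Or.inl hR.ne')).const_mul (γ / (γ - 1)))
    refine h.deriv.trans ?_
    rw [hexp]
    field_simp
  have hqx : ∀ w, fderiv ℝ (eulerPotential γ r U t) x w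
      = inner ℝ (U t x) (fderiv ℝ (U t) x w) - γ * r t x ^ (γ - 2) * fderiv ℝ (r t) x w := by
    intro w
    have h : HasFDerivAt (fun y => 1 / 2 * ‖U t y‖ ^ 2 - γ / (γ - 1) * r t y ^ (γ - 1)) _ x :=
      (hUx.norm_sq.const_mul (1 / 2)).sub
        ((hrx.rpow_const (p := γ - 1) (Or.inl hR.ne')).const_mul (γ / (γ - 1)))
    have h' : fderiv ℝ (eulerPotential γ r U t) x = _ := h.fderiv
    rw [h']
    simp [hexp]
    field_simp
  have hwt : deriv (fun s => χ x • U s x) t = χ x • deriv (fun s => U s x) t :=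
    (hUt.const_smul (χ x)).deriv
  have hwx : HasFDerivAt (fun y => χ y • U t y)
      (χ x • fderiv ℝ (U t) x + (fderiv ℝ χ x).smulRight (U t x)) x := hχx.smul hUx
  have hpt : deriv (fun s => r s x ^ γ) t = γ * r t x ^ (γ - 1) * deriv (fun s => r s x) t := by
    rw [(hrt.rpow_const (p := γ) (Or.inl hR.ne')).deriv]
    ring
  have hpx : HasFDerivAt (fun y => r t y ^ γ) ((γ * r t x ^ (γ - 1)) • fderiv ℝ (r t) x) x :=
    hrx.rpow_const (Or.inl hR.ne')
  have hdiv : tr (fderiv ℝ (fun y => r t y ^ γ • (χ y • U t y)) x)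
      = r t x ^ γ * tr (χ x • fderiv ℝ (U t) x + (fderiv ℝ χ x).smulRight (U t x))
        + χ x * (γ * r t x ^ (γ - 1) * fderiv ℝ (r t) x (U t x)) := by
    have := div_smul_eq hpx.differentiableAt hwx.differentiableAt
    rw [div, hwx.fderiv, hpx.fderiv] at this
    rw [this]
    simp only [smul_apply, map_smul, smul_eq_mul]
  rw [hdiv, hpt, weakRate]
  simp only
  rw [hqt, hqx, hwt, hwx.fderiv, add_assoc]
  exact relEnergy_rate_eq hγ hR (hE.mass_eq hΩ ht hx) (hE.acceleration_eq hΩ ht hx hR)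

end

end CompressibleFlow

namespace CompressibleFlow

/-! ### The relative energy inequality -/

lemma integral_add_sub_add_sub {X : Type*} [MeasurableSpace X] {m : Measure X}
    {f g h k w : X → ℝ} (hf : Integrable f m) (hg : Integrable g m) (hh : Integrable h m)
    (hk : Integrable k m) (hw : Integrable w m) :
    ∫ x, (f x + (g x - h x) + k x - w x) ∂m
      = (∫ x, f x ∂m) + ((∫ x, g x ∂m) - ∫ x, h x ∂m) + (∫ x, k x ∂m) - ∫ x, w x ∂m := by
  have h1 : Integrable (fun x => g x - h x) m := hg.sub hh
  have h2 : Integrable (fun x => f x + (g x - h x)) m := hf.add h1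
  have h3 : Integrable (fun x => f x + (g x - h x) + k x) m := h2.add hk
  rw [integral_sub h3 hw, integral_add h2 hk, integral_add hf h1, integral_sub hg hh]

/-- A smooth Euler flow with quantitative bounds. -/
structure IsReferenceFlow (Ω : Set E3) (T γ a b L : ℝ) (r : ℝ → E3 → ℝ) (U : ℝ → E3 → E3) :
    Prop where
  euler : IsSmoothEulerSolution Ω T γ r U
  pos : 0 < a
  le : a ≤ b
  lower : ∀ t ∈ Icc 0 T, ∀ x ∈ closure Ω, a ≤ r t x
  upper : ∀ t ∈ Icc 0 T, ∀ x ∈ closure Ω, r t x ≤ b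
  bound_nonneg : 0 ≤ L
  density : IsBoundedField Ω T L r
  velocity : IsBoundedField Ω T L U

lemma IsSmoothEulerSolution.exists_isReferenceFlow {Ω : Set E3} {T γ : ℝ} {r : ℝ → E3 → ℝ}
    {U : ℝ → E3 → E3} (hE : IsSmoothEulerSolution Ω T γ r U) (hΩ : IsSmoothBoundedOpen Ω)
    (hT : 0 < T) : ∃ a b L, IsReferenceFlow Ω T γ a b L r U := by
  obtain ⟨a, b, ha, hab, h⟩ := hE.exists_density_bounds hT
  obtain ⟨L₁, hL₁, h₁⟩ := exists_isBoundedField hΩ hE.density_smooth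
  obtain ⟨L₂, hL₂, h₂⟩ := exists_isBoundedField hΩ hE.velocity_smooth
  exact ⟨a, b, max L₁ L₂, hE, ha, hab, fun t ht x hx => (h t ht x hx).1,
    fun t ht x hx => (h t ht x hx).2, hL₁.trans (le_max_left _ _), h₁.mono (le_max_left _ _),
    h₂.mono (le_max_right _ _)⟩

section

variable {Ω : Set E3} {T γ μ η ε a b L : ℝ} {r : ℝ → E3 → ℝ} {U : ℝ → E3 → E3}
  {ρ₀ : E3 → ℝ} {u₀ : E3 → E3} {ρ : ℝ → E3 → ℝ} {u : ℝ → E3 → E3} {Du : ℝ → E3 → E3 →L[ℝ] E3}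

lemma IsReferenceFlow.isTangentField (hR : IsReferenceFlow Ω T γ a b L r U)
    (hΩ : IsSmoothBoundedOpen Ω) {t : ℝ} (ht : t ∈ Ioo 0 T) : IsTangentField Ω L (U t) where
  cont := hR.velocity.contDiffOn.continuousOn.comp (f := fun x => (t, x)) (by fun_prop)
    fun x hx => ⟨Ioo_subset_Icc_self ht, hx⟩
  diff x hx := differentiableAt_space hΩ.isOpen hR.velocity.contDiffOn ht hx
  norm_le x hx := hR.velocity.norm_le t (Ioo_subset_Icc_self ht) x (subset_closure hx)
  fderiv_le x hx := hR.velocity.fderiv_le t ht x hx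
  boundary x hx := hR.euler.boundary t (Ioo_subset_Icc_self ht) x hx

lemma IsReferenceFlow.integral_relEnergy_eq (hR : IsReferenceFlow Ω T γ a b L r U)
    (hΩ : IsSmoothBoundedOpen Ω) (hγ : 1 < γ) {s : E3 → ℝ} {v : E3 → E3} (hs : IsState Ω γ s v)
    {t : ℝ} (ht : t ∈ Icc 0 T) {χ : E3 → ℝ} (hχ : ContDiff ℝ ∞ χ) :
    Integrable (fun x => relEnergy γ (s x) (v x) (r t x) (U t x)) (volume.restrict Ω) ∧
    Integrable (fun x => s x * eulerPotential γ r U t x) (volume.restrict Ω) ∧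
    Integrable (fun x => inner ℝ (s x • v x) (χ x • U t x)) (volume.restrict Ω) ∧
    ∫ x in Ω, relEnergy γ (s x) (v x) (r t x) (U t x)
      = energy Ω γ s v
        + ((∫ x in Ω, s x * eulerPotential γ r U t x) - ∫ x in Ω, inner ℝ (s x • v x) (χ x • U t x))
        + (∫ x in Ω, r t x ^ γ) - ∫ x in Ω, inner ℝ (s x • v x) ((1 - χ x) • U t x) := by
  have hΩm := hΩ.isOpen.measurableSet
  obtain ⟨Lq, -, hq⟩ := exists_isBoundedField hΩ (contDiffOn_eulerPotential hR.euler hR.pos hR.lower)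
  obtain ⟨Lp, -, hp⟩ := exists_isBoundedField (f := fun t x => r t x ^ γ) hΩ
    (contDiffOn_rpow hR.euler hR.pos hR.lower γ)
  obtain ⟨Lw, -, hw⟩ := exists_isBoundedField (f := fun t x => χ x • U t x) hΩ
    (contDiffOn_cutoff_smul hR.euler hχ)
  obtain ⟨Lv, -, hv⟩ := exists_isBoundedField (f := fun t x => (1 - χ x) • U t x) hΩ
    (contDiffOn_cutoff_smul (χ := fun x => 1 - χ x) hR.euler (contDiff_const.sub hχ))
  have h1 : Integrable (fun x => 1 / 2 * s x * ‖v x‖ ^ 2 + s x ^ γ / (γ - 1))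
      (volume.restrict Ω) := by
    simp only [mul_assoc]
    exact (hs.kinetic.const_mul _).add (hs.rpow.div_const _)
  have h2 : Integrable (fun x => s x * eulerPotential γ r U t x) (volume.restrict Ω) := by
    refine (hs.integrable_density hΩ hγ).mul_bdd (c := Lq) (hq.meas_slice hΩ.isOpen ht) ?_
    filter_upwards [ae_restrict_mem hΩm] with x hx
    exact hq.norm_le t ht x (subset_closure hx)
  have h3 := hs.integrable_inner hΩ hγ (hw.meas_slice hΩ.isOpen ht)
    fun x hx => hw.norm_le t ht x (subset_closure hx)
  have h4 := hp.integrable_slice hΩ ht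
  have h5 := hs.integrable_inner hΩ hγ (hv.meas_slice hΩ.isOpen ht)
    fun x hx => hv.norm_le t ht x (subset_closure hx)
  have heq : ∀ x ∈ Ω, relEnergy γ (s x) (v x) (r t x) (U t x)
      = ((1 / 2 * s x * ‖v x‖ ^ 2 + s x ^ γ / (γ - 1))
        + (s x * eulerPotential γ r U t x - inner ℝ (s x • v x) (χ x • U t x)))
        + r t x ^ γ - inner ℝ (s x • v x) ((1 - χ x) • U t x) := fun x hx =>
    relEnergy_eq hγ (hR.pos.trans_le (hR.lower t ht x (subset_closure hx))) (χ x) _ _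
  have hI := ((h1.add (h2.sub h3)).add h4).sub h5
  refine ⟨hI.congr ?_, h2, h3, ?_⟩
  · filter_upwards [ae_restrict_mem hΩm] with x hx
    exact (heq x hx).symm
  · rw [setIntegral_congr_fun hΩm heq, energy]
    exact integral_add_sub_add_sub h1 h2 h3 h4 h5

lemma IsReferenceFlow.integrable_relEnergy (hR : IsReferenceFlow Ω T γ a b L r U)
    (hΩ : IsSmoothBoundedOpen Ω) (hγ : 1 < γ) (hμ : 0 ≤ μ) (hη : 0 ≤ η) (hε : 0 ≤ ε)
    (hS : IsFiniteEnergyWeakSolution Ω T γ μ η ε ρ₀ u₀ ρ u Du) :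
    Integrable (fun z : ℝ × E3 => relEnergy γ (ρ z.1 z.2) (u z.1 z.2) (r z.1 z.2) (U z.1 z.2))
      (volume.restrict (Ioo 0 T ×ˢ Ω)) := by
  have hfin := isFiniteMeasure_cylinder hΩ T
  obtain ⟨Lq, -, hq⟩ := exists_isBoundedField hΩ (contDiffOn_eulerPotential hR.euler hR.pos hR.lower)
  obtain ⟨Lp, -, hp⟩ := exists_isBoundedField (f := fun t x => r t x ^ γ) hΩ
    (contDiffOn_rpow hR.euler hR.pos hR.lower γ)
  have hmem : ∀ᵐ z ∂(volume.restrict (Ioo 0 T ×ˢ Ω) : Measure (ℝ × E3)), z ∈ Ioo 0 T ×ˢ Ω :=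
    ae_restrict_mem (isOpen_cylinder hΩ.isOpen T).measurableSet
  have h1 := ((hS.integrable_kinetic hΩ hγ hμ hη hε).const_mul (1 / 2)).add
    ((hS.integrable_rpow hΩ hγ hμ hη hε).div_const (γ - 1))
  have h2 := hS.integrable_weakState hΩ hγ hμ hη hε hq hR.velocity
  have h3 : Integrable (fun z : ℝ × E3 => r z.1 z.2 ^ γ) (volume.restrict (Ioo 0 T ×ˢ Ω)) := by
    refine Integrable.of_bound (hp.meas hΩ.isOpen) Lp ?_
    filter_upwards [hmem] with z hz
    exact hp.norm_le _ (Ioo_subset_Icc_self hz.1) _ (subset_closure hz.2)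
  refine ((h1.add h2).add h3).congr ?_
  filter_upwards [hmem] with z hz
  rw [relEnergy_eq hγ (hR.pos.trans_le (hR.lower z.1 (Ioo_subset_Icc_self hz.1) z.2
    (subset_closure hz.2))) 1]
  simp [eulerPotential, mul_assoc]

end

end CompressibleFlow

namespace CompressibleFlow

/-! ### The contribution of the boundary layer -/

section

variable {Ω : Set E3} {T γ μ η ε a b L c d C C₀ l : ℝ} {r : ℝ → E3 → ℝ} {U : ℝ → E3 → E3}
  {ρ₀ : E3 → ℝ} {u₀ : E3 → E3} {ρ : ℝ → E3 → ℝ} {u : ℝ → E3 → E3} {Du : ℝ → E3 → E3 →L[ℝ] E3}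
  {χ : E3 → ℝ} {S : Set E3}

lemma measurableSet_boundaryLayer (hΩ : IsOpen Ω) (δ : ℝ) : MeasurableSet (boundaryLayer Ω δ) :=
  hΩ.measurableSet.inter
    (measurableSet_lt (Metric.continuous_infDist_pt _).measurable measurable_const)

lemma real_cylinder_le (hC : 0 ≤ C) (hT : 0 ≤ T)
    (hv : volume S ≤ ENNReal.ofReal C) :
    (volume.restrict (Ioo 0 T ×ˢ Ω) : Measure (ℝ × E3)).real (univ ×ˢ S) ≤ T * C := by
  rw [volume_restrict_cylinder, measureReal_prod_prod]
  have h1 : (volume.restrict (Ioo 0 T)).real univ = T := by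
    simp [Measure.real, hT]
  have h2 : (volume.restrict Ω).real S ≤ C := by
    rw [Measure.real]
    exact ENNReal.toReal_le_of_le_ofReal hC ((Measure.restrict_apply_le _ _).trans hv)
  rw [h1]
  gcongr

/-- Where the Kato-type hypothesis enters. In the layer `d_Ω < cε`, so `1 / (cε) ≤ cε / d_Ω²`: the
convective term is dominated by `ε ρ|u|² / d_Ω²` times `C c`, and the viscous one carries the factor
`ε` already. -/
lemma IsCutoff.integral_layer_le (hχ : IsCutoff Ω (frontier Ω) C₀ (c * ε) χ S)
    (hΩ : IsSmoothBoundedOpen Ω) (hγ : 1 < γ) (hμ : 0 ≤ μ) (hη : 0 ≤ η) (hε : 0 < ε) (hc : 0 < c)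
    (hC : 0 ≤ C) (hl : 0 < l) (hd : 0 ≤ d)
    (hS : IsFiniteEnergyWeakSolution Ω T γ μ η ε ρ₀ u₀ ρ u Du)
    (hD : ENNReal.ofReal ε * layerDissipation Ω T (c * ε) ρ u Du ≤ ENNReal.ofReal d) :
    Integrable (fun z : ℝ × E3 => S.indicator (fun _ => (1 : ℝ)) z.2
      * (C / (c * ε) * (ρ z.1 z.2 * ‖u z.1 z.2‖ ^ 2)
        + C / l * (ε * frob (Du z.1 z.2) (Du z.1 z.2)))) (volume.restrict (Ioo 0 T ×ˢ Ω)) ∧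
    ∫ z in Ioo 0 T ×ˢ Ω, S.indicator (fun _ => (1 : ℝ)) z.2
      * (C / (c * ε) * (ρ z.1 z.2 * ‖u z.1 z.2‖ ^ 2)
        + C / l * (ε * frob (Du z.1 z.2) (Du z.1 z.2))) ≤ (C * c + C / l) * d := by
  have hS1 := hS.integrable_kinetic hΩ hγ hμ hη hε.le
  have hS2 := integrable_frob_self hS.velocity.2.1
  set f : ℝ × E3 → ℝ := fun z => C / (c * ε) * (ρ z.1 z.2 * ‖u z.1 z.2‖ ^ 2)
        + C / l * (ε * frob (Du z.1 z.2) (Du z.1 z.2)) with hf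
  have hfi : Integrable f (volume.restrict (Ioo 0 T ×ˢ Ω)) :=
    (hS1.const_mul _).add ((hS2.const_mul _).const_mul _)
  have hm : MeasurableSet (univ ×ˢ S : Set (ℝ × E3)) := MeasurableSet.univ.prod hχ.meas
  have hind : ∀ z : ℝ × E3, S.indicator (fun _ => (1 : ℝ)) z.2 * f z
      = (univ ×ˢ S : Set (ℝ × E3)).indicator f z := fun z => by
    by_cases hz : z.2 ∈ S
    · rw [indicator_of_mem hz, indicator_of_mem (show z ∈ univ ×ˢ S from ⟨mem_univ _, hz⟩), one_mul]
    · rw [indicator_of_notMem hz, indicator_of_notMem (fun h => hz h.2), zero_mul]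
  have hI : Integrable (fun z : ℝ × E3 => S.indicator (fun _ => (1 : ℝ)) z.2 * f z)
      (volume.restrict (Ioo 0 T ×ˢ Ω)) := by
    simp_rw [hind]
    exact hfi.indicator hm
  refine ⟨hI, ?_⟩
  have hmem : ∀ᵐ z ∂(volume.restrict (Ioo 0 T ×ˢ Ω) : Measure (ℝ × E3)), z ∈ Ioo 0 T ×ˢ Ω :=
    ae_restrict_mem (isOpen_cylinder hΩ.isOpen T).measurableSet
  have hK : 0 ≤ C * c + C / l := by positivity
  have hnn : 0 ≤ᵐ[volume.restrict (Ioo 0 T ×ˢ Ω)]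
      fun z : ℝ × E3 => S.indicator (fun _ => (1 : ℝ)) z.2 * f z := by
    filter_upwards [hS.density_nonneg_ae] with z hz
    have := frob_nonneg (Du z.1 z.2)
    exact mul_nonneg (indicator_nonneg (fun _ _ => zero_le_one) _) (by positivity)
  rw [← ENNReal.ofReal_le_ofReal_iff (mul_nonneg hK hd),
    ofReal_integral_eq_lintegral_ofReal hI hnn]
  set g : ℝ × E3 → ℝ≥0∞ := fun z => ENNReal.ofReal (ρ z.1 z.2 * ‖u z.1 z.2‖ ^ 2 / bdryDist Ω z.2 ^ 2
      + ρ z.1 z.2 ^ 2 * (inner ℝ (u z.1 z.2) (outwardNormal Ω z.2)) ^ 2 / bdryDist Ω z.2 ^ 2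
      + frob (Du z.1 z.2) (Du z.1 z.2)) with hg
  have hA : MeasurableSet (Ioo 0 T ×ˢ boundaryLayer Ω (c * ε)) :=
    measurableSet_Ioo.prod (measurableSet_boundaryLayer hΩ.isOpen _)
  set k := ENNReal.ofReal ((C * c + C / l) * ε) with hk
  calc ∫⁻ z in Ioo 0 T ×ˢ Ω, ENNReal.ofReal (S.indicator (fun _ => (1 : ℝ)) z.2 * f z)
      ≤ ∫⁻ z in Ioo 0 T ×ˢ Ω, (Ioo 0 T ×ˢ boundaryLayer Ω (c * ε)).indicator
          (fun z => k * g z) z := by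
        refine lintegral_mono_ae ?_
        filter_upwards [hS.density_nonneg_ae, hmem] with z hz hzm
        by_cases hzS : z.2 ∈ S
        · have hlay := hχ.sub hzS
          rw [indicator_of_mem hzS, indicator_of_mem (show z ∈ Ioo 0 T ×ˢ boundaryLayer Ω (c * ε)
            from ⟨hzm.1, hlay⟩), one_mul, hk, hg, ← ENNReal.ofReal_mul (by positivity)]
          refine ENNReal.ofReal_le_ofReal ?_
          -- A nonempty bounded open set has a boundary; this gives `d_Ω > 0`, so the quotients by
          -- `d_Ω²` are not the default value `0`.
          have hne : (frontier Ω).Nonempty := by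
            by_contra hne
            have hcl : IsClopen Ω := isClopen_iff_frontier_eq_empty.2 (not_nonempty_iff_eq_empty.1 hne)
            rcases isClopen_iff.1 hcl with h | h
            · exact absurd hzm.2 (h ▸ notMem_empty _)
            · exact NormedSpace.unbounded_univ ℝ E3 (h ▸ hΩ.isBounded)
          have hdp := bdryDist_pos hΩ.isOpen hne hzm.2
          have hdl := hlay.2
          have hF := frob_nonneg (Du z.1 z.2)
          set D := bdryDist Ω z.2
          set F := frob (Du z.1 z.2) (Du z.1 z.2)
          set k₁ := ρ z.1 z.2 * ‖u z.1 z.2‖ ^ 2 with hk₁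
          have hk₁p : 0 ≤ k₁ := by positivity
          have hmid : 0 ≤ ρ z.1 z.2 ^ 2 * (inner ℝ (u z.1 z.2) (outwardNormal Ω z.2)) ^ 2 / D ^ 2 := by
            positivity
          have e1 : C / (c * ε) * k₁ ≤ C * c * ε * (k₁ / D ^ 2) := by
            have : k₁ ≤ (c * ε) ^ 2 * (k₁ / D ^ 2) := by
              rw [← mul_div_assoc, le_div_iff₀ (by positivity), mul_comm]
              gcongr
            calc C / (c * ε) * k₁ ≤ C / (c * ε) * ((c * ε) ^ 2 * (k₁ / D ^ 2)) := by gcongr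
              _ = _ := by field_simp
          have e2 : 0 ≤ C / l * ε * (k₁ / D ^ 2) := by positivity
          have e3 : 0 ≤ C * c * ε * F := by positivity
          have e4 : 0 ≤ (C * c + C / l) * ε
              * (ρ z.1 z.2 ^ 2 * (inner ℝ (u z.1 z.2) (outwardNormal Ω z.2)) ^ 2 / D ^ 2) := by
            positivity
          simp only [hf]
          nlinarith
        · rw [indicator_of_notMem hzS, zero_mul, ENNReal.ofReal_zero]
          exact zero_le
    _ ≤ ∫⁻ z, (Ioo 0 T ×ˢ boundaryLayer Ω (c * ε)).indicator (fun z => k * g z) z :=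
        lintegral_mono' Measure.restrict_le_self le_rfl
    _ = k * layerDissipation Ω T (c * ε) ρ u Du := by
        rw [lintegral_indicator hA, lintegral_const_mul' _ _ ENNReal.ofReal_ne_top, layerDissipation]
    _ = ENNReal.ofReal (C * c + C / l)
        * (ENNReal.ofReal ε * layerDissipation Ω T (c * ε) ρ u Du) := by
        rw [hk, ENNReal.ofReal_mul hK, mul_assoc]
    _ ≤ ENNReal.ofReal ((C * c + C / l) * d) := by
        rw [ENNReal.ofReal_mul hK]
        gcongr

end

end CompressibleFlow

namespace CompressibleFlow

/-! ### Gronwall form of the relative energy inequality -/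

section

variable {Ω : Set E3} {T γ μ η ε a b L c d C C₀ l : ℝ} {r : ℝ → E3 → ℝ} {U : ℝ → E3 → E3}
  {ρ₀ : E3 → ℝ} {u₀ : E3 → E3} {ρ : ℝ → E3 → ℝ} {u : ℝ → E3 → E3} {Du : ℝ → E3 → E3 →L[ℝ] E3}
  {χ : E3 → ℝ} {S : Set E3}

/-- The bound for the rate of change of the relative energy density. -/
noncomputable def rateBound (γ μ η ε δ C l : ℝ) (S : Set E3) (r : ℝ → E3 → ℝ) (U : ℝ → E3 → E3)
    (ρ : ℝ → E3 → ℝ) (u : ℝ → E3 → E3) (Du : ℝ → E3 → E3 →L[ℝ] E3) (z : ℝ × E3) : ℝ :=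
  C * relEnergy γ (ρ z.1 z.2) (u z.1 z.2) (r z.1 z.2) (U z.1 z.2)
    + ε / 2 * frob (stress μ η (Du z.1 z.2)) (Du z.1 z.2)
    + (C * ε + S.indicator (fun _ => (1 : ℝ)) z.2 * (C + C * l * (ε / δ ^ 2))
      + S.indicator (fun _ => (1 : ℝ)) z.2 * (C / δ * (ρ z.1 z.2 * ‖u z.1 z.2‖ ^ 2)
        + C / l * (ε * frob (Du z.1 z.2) (Du z.1 z.2))))

/-- The constant is chosen before `ε`, `δ`, `l`, the cutoff and the weak solution, which the limit
`ε → 0` requires. -/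
lemma IsReferenceFlow.exists_weakRate_le (hR : IsReferenceFlow Ω T γ a b L r U)
    (hΩ : IsSmoothBoundedOpen Ω) (hγ : 1 < γ) (hμ : 0 ≤ μ) (hη : 0 ≤ η) (hC₀ : 0 ≤ C₀) :
    ∃ C, 0 ≤ C ∧ ∀ (ε δ l : ℝ) (χ : E3 → ℝ) (S : Set E3) (ρ : ℝ → E3 → ℝ) (u : ℝ → E3 → E3)
      (Du : ℝ → E3 → E3 →L[ℝ] E3), 0 < ε → 0 < δ → 0 < l → IsCutoff Ω (frontier Ω) C₀ δ χ S →
      ∀ t ∈ Ioo 0 T, ∀ x ∈ Ω, 0 ≤ ρ t x →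
      weakRate γ μ η ε ρ u Du (eulerPotential γ r U) (fun t x => χ x • U t x) (t, x)
        + deriv (fun s => r s x ^ γ) t
        + tr (fderiv ℝ (fun y => r t y ^ γ • (χ y • U t y)) x)
      ≤ rateBound γ μ η ε δ C l S r U ρ u Du (t, x) := by
  have hL := hR.bound_nonneg
  -- One constant dominating both `C₀`, for the gradient of the cutoff, and `C₀ L`, for its
  -- derivative along the flow.
  obtain ⟨C, hC, h⟩ := exists_relEnergy_rate_le (C₀ := C₀ * (L + 1)) hγ (hR.pos.trans_le hR.le) hL
    hμ hη (by positivity)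
  refine ⟨C, hC, fun ε δ l χ S ρ u Du hε hδ hl hχ t ht x hx hρ => ?_⟩
  have ht' := Ioo_subset_Icc_self ht
  have hx' := subset_closure hx
  rw [weakRate_add_eq hγ hΩ.isOpen hR.euler hR.pos hR.lower hχ.smooth ρ u Du ht hx]
  have hC₁ : C₀ ≤ C₀ * (L + 1) := by nlinarith
  have htan : |fderiv ℝ χ x (U t x)| ≤ C₀ * (L + 1) :=
    (hχ.tangent L _ (hR.isTangentField hΩ ht) x hx).trans (by nlinarith)
  refine (h ε δ (χ x) l (ρ t x) (r t x) (S.indicator (fun _ => 1) x) (u t x) (U t x)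
    (deriv (fun s => U s x) t) (fderiv ℝ (U t) x) (Du t x) (fderiv ℝ (r t) x) (fderiv ℝ χ x)
    hε hδ (hχ.nonneg x) (hχ.le_one x) hl hρ (hR.pos.trans_le (hR.lower t ht' x hx'))
    (hR.upper t ht' x hx') (hR.velocity.norm_le t ht' x hx') (hR.velocity.deriv_le t ht x hx)
    (hR.velocity.fderiv_le t ht x hx) (hR.density.fderiv_le t ht x hx)
    ((hχ.bound x hx).trans (by gcongr)) htan (indicator_nonneg (fun _ _ => zero_le_one) _) ?_).trans
    (le_of_eq ?_)
  · by_cases hxS : x ∈ S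
    · exact Or.inl (indicator_of_mem hxS _)
    · exact Or.inr (hχ.off x ⟨hx, hxS⟩)
  · rw [rateBound]
    ring

/-- The half dissipation is enlarged to the full one, which the energy inequality cancels exactly.
The layer has space-time measure at most `T C₀ cε`, which bounds the cost of the constant layer
terms. -/
lemma IsReferenceFlow.integral_rateBound_le (hR : IsReferenceFlow Ω T γ a b L r U)
    (hχ : IsCutoff Ω (frontier Ω) C₀ (c * ε) χ S) (hC₀ : 0 ≤ C₀)
    (hΩ : IsSmoothBoundedOpen Ω) (hγ : 1 < γ) (hμ : 0 ≤ μ) (hη : 0 ≤ η) (hε : 0 < ε) (hc : 0 < c)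
    (hC : 0 ≤ C) (hl : 0 < l) (hd : 0 ≤ d)
    (hS : IsFiniteEnergyWeakSolution Ω T γ μ η ε ρ₀ u₀ ρ u Du)
    (hD : ENNReal.ofReal ε * layerDissipation Ω T (c * ε) ρ u Du ≤ ENNReal.ofReal d)
    {τ : ℝ} (hτ : τ ∈ Ioo 0 T) :
    IntegrableOn (rateBound γ μ η ε (c * ε) C l S r U ρ u Du) (Ioo 0 τ ×ˢ Ω) ∧
    ∫ z in Ioo 0 τ ×ˢ Ω, rateBound γ μ η ε (c * ε) C l S r U ρ u Du z
      ≤ C * (∫ t in Ioo 0 τ, ∫ x in Ω, relEnergy γ (ρ t x) (u t x) (r t x) (U t x))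
        + ε * (∫ z in Ioo 0 τ ×ˢ Ω, frob (stress μ η (Du z.1 z.2)) (Du z.1 z.2))
        + (C * ε * (T * volume.real Ω) + (C + C * l * (ε / (c * ε) ^ 2)) * (T * (C₀ * (c * ε)))
          + (C * c + C / l) * d) := by
  have hT : 0 ≤ T := (hτ.1.trans hτ.2).le
  have hfin := isFiniteMeasure_cylinder hΩ T
  have hsub : Ioo 0 τ ×ˢ Ω ⊆ Ioo 0 T ×ˢ Ω := prod_mono (Ioo_subset_Ioo_right hτ.2.le) Subset.rfl
  obtain ⟨hIl, hIl'⟩ := hχ.integral_layer_le hΩ hγ hμ hη hε hc hC hl hd hS hD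
  have hIE := hR.integrable_relEnergy hΩ hγ hμ hη hε.le hS
  have hIF := integrable_frob_stress_self hμ hη hS.velocity.2.1
  have hm : MeasurableSet (univ ×ˢ S : Set (ℝ × E3)) := MeasurableSet.univ.prod hχ.meas
  set k := C + C * l * (ε / (c * ε) ^ 2) with hk
  have hkp : 0 ≤ k := by positivity
  have hind : ∀ z : ℝ × E3, S.indicator (fun _ => (1 : ℝ)) z.2 * k
      = (univ ×ˢ S : Set (ℝ × E3)).indicator (fun _ => k) z := fun z => by
    by_cases hz : z.2 ∈ S
    · rw [indicator_of_mem hz, indicator_of_mem (show z ∈ univ ×ˢ S from ⟨mem_univ _, hz⟩), one_mul]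
    · rw [indicator_of_notMem hz, indicator_of_notMem (fun h => hz h.2), zero_mul]
  have hIk : Integrable (fun z : ℝ × E3 => S.indicator (fun _ => (1 : ℝ)) z.2 * k)
      (volume.restrict (Ioo 0 T ×ˢ Ω)) := by
    simp_rw [hind]
    exact (integrable_const k).indicator hm
  have hIck : Integrable (fun z : ℝ × E3 => C * ε + S.indicator (fun _ => (1 : ℝ)) z.2 * k)
      (volume.restrict (Ioo 0 T ×ˢ Ω)) := (integrable_const _).add hIk
  set G : ℝ × E3 → ℝ := fun z => C * ε + S.indicator (fun _ => (1 : ℝ)) z.2 * k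
      + S.indicator (fun _ => (1 : ℝ)) z.2 * (C / (c * ε) * (ρ z.1 z.2 * ‖u z.1 z.2‖ ^ 2)
        + C / l * (ε * frob (Du z.1 z.2) (Du z.1 z.2))) with hG
  have hIG : Integrable G (volume.restrict (Ioo 0 T ×ˢ Ω)) := hIck.add hIl
  have hG0 : 0 ≤ᵐ[volume.restrict (Ioo 0 T ×ˢ Ω)] G := by
    filter_upwards [hS.density_nonneg_ae] with z hz
    have h1 := frob_nonneg (Du z.1 z.2)
    have h2 : 0 ≤ S.indicator (fun _ => (1 : ℝ)) z.2 := indicator_nonneg (fun _ _ => zero_le_one) _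
    simp only [hG, Pi.zero_apply]
    positivity
  have hGle : ∫ z in Ioo 0 τ ×ˢ Ω, G z ≤ C * ε * (T * volume.real Ω) + k * (T * (C₀ * (c * ε)))
      + (C * c + C / l) * d := by
    refine (setIntegral_mono_set hIG hG0 hsub.eventuallyLE).trans ?_
    simp only [hG]
    rw [integral_add hIck hIl, integral_add (integrable_const _) hIk]
    refine add_le_add (add_le_add (le_of_eq ?_) ?_) hIl'
    · rw [integral_const, smul_eq_mul, measureReal_restrict_apply_univ, Measure.volume_eq_prod,
        measureReal_prod_prod, mul_comm]
      simp [hT]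
    · simp_rw [hind]
      rw [integral_indicator_const _ hm, smul_eq_mul, mul_comm]
      exact mul_le_mul_of_nonneg_left (real_cylinder_le (by positivity) hT hχ.vol) hkp
  have hIE' := IntegrableOn.mono_set hIE hsub
  have hIF' := IntegrableOn.mono_set hIF hsub
  have hIG' := IntegrableOn.mono_set hIG hsub
  have hIE2 : IntegrableOn (fun z : ℝ × E3 =>
      C * relEnergy γ (ρ z.1 z.2) (u z.1 z.2) (r z.1 z.2) (U z.1 z.2)) (Ioo 0 τ ×ˢ Ω) :=
    hIE'.const_mul C
  have hIF2 : IntegrableOn (fun z : ℝ × E3 =>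
      ε / 2 * frob (stress μ η (Du z.1 z.2)) (Du z.1 z.2)) (Ioo 0 τ ×ˢ Ω) := hIF'.const_mul (ε / 2)
  have hIEF : IntegrableOn (fun z : ℝ × E3 =>
      C * relEnergy γ (ρ z.1 z.2) (u z.1 z.2) (r z.1 z.2) (U z.1 z.2)
      + ε / 2 * frob (stress μ η (Du z.1 z.2)) (Du z.1 z.2)) (Ioo 0 τ ×ˢ Ω) := hIE2.add hIF2
  refine ⟨hIEF.add hIG', ?_⟩
  have hsplit : ∫ z in Ioo 0 τ ×ˢ Ω, rateBound γ μ η ε (c * ε) C l S r U ρ u Du z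
      = C * (∫ z in Ioo 0 τ ×ˢ Ω, relEnergy γ (ρ z.1 z.2) (u z.1 z.2) (r z.1 z.2) (U z.1 z.2))
        + ε / 2 * (∫ z in Ioo 0 τ ×ˢ Ω, frob (stress μ η (Du z.1 z.2)) (Du z.1 z.2))
        + ∫ z in Ioo 0 τ ×ˢ Ω, G z := by
    rw [← integral_const_mul, ← integral_const_mul, ← integral_add hIE2 hIF2,
      ← integral_add hIEF hIG']
    rfl
  have hfub : ∫ z in Ioo 0 τ ×ˢ Ω, relEnergy γ (ρ z.1 z.2) (u z.1 z.2) (r z.1 z.2) (U z.1 z.2)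
      = ∫ t in Ioo 0 τ, ∫ x in Ω, relEnergy γ (ρ t x) (u t x) (r t x) (U t x) := by
    rw [IntegrableOn, volume_restrict_cylinder] at hIE'
    rw [volume_restrict_cylinder, integral_prod _ hIE']
  have hF0 : 0 ≤ ∫ z in Ioo 0 τ ×ˢ Ω, frob (stress μ η (Du z.1 z.2)) (Du z.1 z.2) :=
    integral_nonneg fun z => frob_stress_self_nonneg hμ hη _
  rw [hsplit, hfub]
  nlinarith [mul_nonneg hε.le hF0]

end

end CompressibleFlow

/-! ### The relative energy estimate at almost every time. -/

namespace CompressibleFlow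

section

variable {Ω : Set E3} {T γ μ η ε a b L c d C C₀ l M K : ℝ} {r : ℝ → E3 → ℝ} {U : ℝ → E3 → E3}
  {ρ₀ : E3 → ℝ} {u₀ : E3 → E3} {ρ : ℝ → E3 → ℝ} {u : ℝ → E3 → E3} {Du : ℝ → E3 → E3 →L[ℝ] E3}
  {χ : E3 → ℝ} {S : Set E3}

lemma IsReferenceFlow.abs_layer_momentum_le (hR : IsReferenceFlow Ω T γ a b L r U)
    (hχ : IsCutoff Ω (frontier Ω) C₀ (c * ε) χ S) (hC₀ : 0 ≤ C₀) (hε : 0 < ε) (hc : 0 < c)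
    (hΩ : IsSmoothBoundedOpen Ω) (hγ : 1 < γ) (hl : 0 < l) (hK : 0 < K)
    {s : E3 → ℝ} {v : E3 → E3} (hs : IsState Ω γ s v) (hM : energy Ω γ s v ≤ M)
    {t : ℝ} (ht : t ∈ Icc 0 T) :
    |∫ x in Ω, inner ℝ (s x • v x) ((1 - χ x) • U t x)|
      ≤ L * (l * (2 * M) + l⁻¹ * (K * (C₀ * (c * ε)) + K ^ (1 - γ) * ((γ - 1) * M))) := by
  have hL := hR.bound_nonneg
  refine (hs.abs_integral_inner_le hΩ hγ hl hK hL hM (S := S) (fun x hx => ?_) hχ.meas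
    fun x hx => ?_).trans ?_
  · rw [norm_smul, Real.norm_of_nonneg (by linarith [hχ.le_one x])]
    have := hR.velocity.norm_le t ht x (subset_closure hx)
    nlinarith [hχ.nonneg x, hχ.le_one x, norm_nonneg (U t x)]
  · rw [(hχ.off x hx).1, sub_self, zero_smul]
  · have : (volume.restrict Ω).real S ≤ C₀ * (c * ε) :=
      ENNReal.toReal_le_of_le_ofReal (by positivity) ((Measure.restrict_apply_le _ _).trans hχ.vol)
    gcongr

/-- Write the relative energy at `τ` and at `0` through the splitting of `relEnergy_eq` and
subtract: the energy inequality, the weak identity and the rate bound leave an integral inequality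
for Gronwall. The layer momentum appears at both times, hence the factor `2`. -/
lemma IsReferenceFlow.exists_ae_relEnergy_le (hR : IsReferenceFlow Ω T γ a b L r U)
    (hΩ : IsSmoothBoundedOpen Ω) (hT : 0 < T) (hγ : 1 < γ) (hμ : 0 ≤ μ) (hη : 0 ≤ η)
    (hc : 0 < c) (hC₀ : 0 ≤ C₀) :
    ∃ C, 0 ≤ C ∧ ∀ (ε l K M d : ℝ) (χ : E3 → ℝ) (S : Set E3) (ρ₀ : E3 → ℝ) (u₀ : E3 → E3)
      (ρ : ℝ → E3 → ℝ) (u : ℝ → E3 → E3) (Du : ℝ → E3 → E3 →L[ℝ] E3),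
      0 < ε → 0 < l → 0 < K → 0 ≤ M → 0 ≤ d → IsCutoff Ω (frontier Ω) C₀ (c * ε) χ S →
      IsInitialData Ω γ ρ₀ u₀ → IsFiniteEnergyWeakSolution Ω T γ μ η ε ρ₀ u₀ ρ u Du →
      energy Ω γ ρ₀ u₀ ≤ M →
      ENNReal.ofReal ε * layerDissipation Ω T (c * ε) ρ u Du ≤ ENNReal.ofReal d →
      ∀ᵐ τ ∂(volume.restrict (Ioo 0 T)),
        IsState Ω γ (ρ τ) (u τ) ∧
        ∫ x in Ω, relEnergy γ (ρ τ x) (u τ x) (r τ x) (U τ x)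
          ≤ ((∫ x in Ω, relEnergy γ (ρ₀ x) (u₀ x) (r 0 x) (U 0 x))
            + 2 * (L * (l * (2 * M) + l⁻¹ * (K * (C₀ * (c * ε)) + K ^ (1 - γ) * ((γ - 1) * M))))
            + (C * ε * (T * volume.real Ω) + (C + C * l * (ε / (c * ε) ^ 2)) * (T * (C₀ * (c * ε)))
              + (C * c + C / l) * d)) * Real.exp (C * T) := by
  obtain ⟨C, hC, hrate⟩ := hR.exists_weakRate_le hΩ hγ hμ hη hC₀
  refine ⟨C, hC, fun ε l K M d χ S ρ₀ u₀ ρ u Du hε hl hK hM hd hχ hdat hS hen hD => ?_⟩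
  have hL := hR.bound_nonneg
  have hcε : 0 < c * ε := by positivity
  have h0T : (0 : ℝ) ∈ Icc 0 T := ⟨le_rfl, hT.le⟩
  have hst := hS.ae_isState hγ hμ hη hε.le
  have hst₀ := hdat.isState hγ
  obtain ⟨Lq, -, hq⟩ := exists_isBoundedField hΩ (contDiffOn_eulerPotential hR.euler hR.pos hR.lower)
  obtain ⟨Lp, -, hp⟩ := exists_isBoundedField (f := fun t x => r t x ^ γ) hΩ
    (contDiffOn_rpow hR.euler hR.pos hR.lower γ)
  obtain ⟨Lw, -, hw⟩ := exists_isBoundedField (f := fun t x => χ x • U t x) hΩ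
    (contDiffOn_cutoff_smul hR.euler hχ.smooth)
  obtain ⟨Lv, -, hv⟩ := exists_isBoundedField (f := fun t x => r t x ^ γ • (χ x • U t x)) hΩ
    (contDiffOn_pressure_smul hR.euler hR.pos hR.lower hχ.smooth)
  obtain ⟨Q, hQc, hQΩ, hQ⟩ := hχ.exists_isCompact hΩ
  have hid := hS.ae_weak_identity hΩ hT hγ hμ hη hε.le hq hw
    ⟨Q, hQc, hQΩ, fun t _ x hx => by simp [hQ x hx]⟩
  have hdiv : ∀ t ∈ Ioo 0 T, ∫ x in Ω, tr (fderiv ℝ (fun x => r t x ^ γ • (χ x • U t x)) x) = 0 :=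
    fun t ht => integral_tr_fderiv_eq_zero hv hΩ
      ⟨Q, hQc, hQΩ, fun t _ x hx => by simp [hQ x hx]⟩ ht
  have hI1 := hS.integrable_weakRate hΩ hγ hμ hη hε.le hq hw
  have hI2 := hp.integrable_deriv hΩ
  have hI3 := integrable_tr_fderiv hv hΩ
  have hIE := hR.integrable_relEnergy hΩ hγ hμ hη hε.le hS
  have hE0 : 0 ≤ ∫ x in Ω, relEnergy γ (ρ₀ x) (u₀ x) (r 0 x) (U 0 x) := by
    refine integral_nonneg_of_ae ?_
    filter_upwards [hdat.nonneg, ae_restrict_mem hΩ.isOpen.measurableSet] with x hx hxΩ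
    exact relEnergy_nonneg hγ hx (hR.pos.le.trans (hR.lower 0 h0T x (subset_closure hxΩ))) _ _
  set E₀ := ∫ x in Ω, relEnergy γ (ρ₀ x) (u₀ x) (r 0 x) (U 0 x) with hE₀
  set B := L * (l * (2 * M) + l⁻¹ * (K * (C₀ * (c * ε)) + K ^ (1 - γ) * ((γ - 1) * M))) with hB
  set D := C * ε * (T * volume.real Ω) + (C + C * l * (ε / (c * ε) ^ 2)) * (T * (C₀ * (c * ε)))
    + (C * c + C / l) * d with hDdef
  have hB0 : 0 ≤ B := by
    have : 0 ≤ γ - 1 := by linarith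
    positivity
  have hD0 : 0 ≤ D := by positivity
  refine hst.and (ae_le_of_le_add_integral hC (by positivity) ?_ ?_)
  · rw [volume_restrict_cylinder] at hIE
    exact hIE.integral_prod_left
  filter_upwards [hst, hid, hS.ae_energy hγ hμ hη hε.le, ae_restrict_mem measurableSet_Ioo,
    ae_restrict_of_ae_restrict_of_subset Ioo_subset_Icc_self hS.energy_ineq]
    with τ hsτ hidτ ⟨_, _, henτ⟩ hτ hineq
  have hτ' := Ioo_subset_Icc_self hτ
  obtain ⟨-, i1, i2, e1⟩ := hR.integral_relEnergy_eq hΩ hγ hsτ hτ' hχ.smooth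
  obtain ⟨-, -, -, e0⟩ := hR.integral_relEnergy_eq hΩ hγ hst₀ h0T hχ.smooth
  rw [integral_sub i1 i2] at hidτ
  have hpτ := hp.integral_eq_add_integral_deriv hΩ hτ
  have b1 := hR.abs_layer_momentum_le hχ hC₀ hε hc hΩ hγ hl hK hsτ (henτ.trans hen) hτ'
  have b0 := hR.abs_layer_momentum_le hχ hC₀ hε hc hΩ hγ hl hK hst₀ hen h0T
  obtain ⟨hIb, hb⟩ := hR.integral_rateBound_le hχ hC₀ hΩ hγ hμ hη hε hc hC hl hd hS hD hτ
  have hsub : Ioo 0 τ ×ˢ Ω ⊆ Ioo 0 T ×ˢ Ω := prod_mono (Ioo_subset_Ioo_right hτ.2.le) Subset.rfl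
  have hJ1 := IntegrableOn.mono_set hI1 hsub
  have hJ2 := IntegrableOn.mono_set hI2 hsub
  have hJ3 := IntegrableOn.mono_set hI3 hsub
  have hJ12 : IntegrableOn (fun z : ℝ × E3 => weakRate γ μ η ε ρ u Du (eulerPotential γ r U)
      (fun t x => χ x • U t x) z + deriv (fun s => r s z.2 ^ γ) z.1) (Ioo 0 τ ×ˢ Ω) := hJ1.add hJ2
  have hfub : ∀ f : ℝ × E3 → ℝ, IntegrableOn f (Ioo 0 τ ×ˢ Ω) →
      ∫ z in Ioo 0 τ ×ˢ Ω, f z = ∫ t in Ioo 0 τ, ∫ x in Ω, f (t, x) := fun f hf => by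
    rw [IntegrableOn, volume_restrict_cylinder] at hf
    rw [volume_restrict_cylinder, integral_prod _ hf]
  have hle : (∫ t in Ioo 0 τ, ∫ x in Ω, weakRate γ μ η ε ρ u Du (eulerPotential γ r U)
      (fun t x => χ x • U t x) (t, x)) + (∫ t in Ioo 0 τ, ∫ x in Ω, deriv (fun s => r s x ^ γ) t)
      ≤ ∫ z in Ioo 0 τ ×ˢ Ω, rateBound γ μ η ε (c * ε) C l S r U ρ u Du z := by
    -- Adding this divergence costs nothing and replaces `ρ^γ` by `ρ^γ - r^γ` in the rate.
    have h3 : ∫ z in Ioo 0 τ ×ˢ Ω, tr (fderiv ℝ (fun x => r z.1 x ^ γ • (χ x • U z.1 x)) z.2) = 0 := by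
      rw [hfub _ hJ3]
      refine setIntegral_eq_zero_of_forall_eq_zero fun t ht => ?_
      exact hdiv t ⟨ht.1, ht.2.trans hτ.2⟩
    have h4 := integral_add hJ12 hJ3
    rw [h3, add_zero] at h4
    rw [← hfub _ hJ1, ← hfub _ hJ2, ← integral_add hJ1 hJ2, ← h4]
    refine integral_mono_ae (hJ12.add hJ3) hIb ?_
    have hae : ∀ᵐ z ∂(volume.restrict (Ioo 0 τ ×ˢ Ω) : Measure (ℝ × E3)), 0 ≤ ρ z.1 z.2 :=
      ae_restrict_of_ae_restrict_of_subset hsub hS.density_nonneg_ae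
    filter_upwards [hae, ae_restrict_mem (isOpen_cylinder hΩ.isOpen τ).measurableSet] with z hz hzm
    exact hrate ε (c * ε) l χ S ρ u Du hε hcε hl hχ z.1 (hsub hzm).1 z.2 hzm.2 hz
  have b1' := neg_abs_le (∫ x in Ω, inner ℝ (ρ τ x • u τ x) ((1 - χ x) • U τ x))
  have b0' := le_abs_self (∫ x in Ω, inner ℝ (ρ₀ x • u₀ x) ((1 - χ x) • U 0 x))
  linarith

end

end CompressibleFlow

namespace CompressibleFlow

/-! ### Relative energy and flow error -/

section

variable {Ω : Set E3} {T γ a b L : ℝ} {r : ℝ → E3 → ℝ} {U : ℝ → E3 → E3}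

/-- A small flow error of initial data forces a small relative energy. -/
lemma IsReferenceFlow.exists_integral_relEnergy_le (hR : IsReferenceFlow Ω T γ a b L r U)
    (hΩ : IsSmoothBoundedOpen Ω) (hγ : 1 < γ) (hT : 0 < T) {e : ℝ} (he : 0 < e) :
    ∃ θ, 0 < θ ∧ ∀ s v, IsInitialData Ω γ s v →
      flowError Ω γ s v (r 0) (U 0) ≤ ENNReal.ofReal θ →
      ∫ x in Ω, relEnergy γ (s x) (v x) (r 0 x) (U 0 x) ≤ e := by
  have hfin := isFiniteMeasure_restrict hΩ
  have h0T : (0 : ℝ) ∈ Icc 0 T := ⟨le_rfl, hT.le⟩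
  have hg : 0 < γ - 1 := by linarith
  obtain ⟨C, hC, h⟩ := exists_relPressure_le hγ (hR.pos.trans_le hR.le)
  set A := C / (γ - 1) with hA
  have hAp : 0 ≤ A := by positivity
  set V := (volume.restrict Ω).real univ with hV
  have hVp : 0 ≤ V := measureReal_nonneg
  -- The part of the gap linear in `|s - r|` is truncated at `l`, whose contribution `A l V` is then
  -- at most `e / 2`.
  set l := e / (2 * (A * V + 1)) with hl
  have hlp : 0 < l := by positivity
  set B := 1 / 2 + A * (1 + l ^ (1 - γ)) with hB
  have hBp : 0 < B := by positivity
  refine ⟨min 1 (e / (2 * B)), by positivity, fun s v hd hX => ?_⟩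
  set θ := min 1 (e / (2 * B)) with hθ
  have hθ1 : θ ≤ 1 := min_le_left _ _
  have hθ0 : 0 < θ := by positivity
  have hst := hd.isState hγ
  have hΩm := hΩ.isOpen.measurableSet
  have hUm := hR.velocity.meas_slice hΩ.isOpen h0T
  have hrm : MemLp (r 0) (ENNReal.ofReal γ) (volume.restrict Ω) := by
    refine MemLp.of_bound (hR.density.meas_slice hΩ.isOpen h0T) L ?_
    filter_upwards [ae_restrict_mem hΩm] with x hx
    exact hR.density.norm_le 0 h0T x (subset_closure hx)
  have hsr : MemLp (fun x => s x - r 0 x) (ENNReal.ofReal γ) (volume.restrict Ω) :=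
    hd.memLp.sub hrm
  have hγt : (ENNReal.ofReal γ).toReal = γ := ENNReal.toReal_ofReal (by linarith)
  have hNi : Integrable (fun x => |s x - r 0 x| ^ γ) (volume.restrict Ω) := by
    have := hsr.integrable_norm_rpow (by simp; linarith) (by simp)
    rwa [hγt] at this
  have hN0 : 0 ≤ ∫ x in Ω, |s x - r 0 x| ^ γ := integral_nonneg fun x => by positivity
  have hN : ∫ x in Ω, |s x - r 0 x| ^ γ ≤ θ := by
    have h1 : eLpNorm (fun x => s x - r 0 x) (ENNReal.ofReal γ) (volume.restrict Ω)
        ≤ ENNReal.ofReal θ := le_self_add.trans hX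
    rw [hsr.eLpNorm_eq_integral_rpow_norm (by simp; linarith) (by simp), hγt,
      ENNReal.ofReal_le_ofReal_iff hθ0.le] at h1
    simp only [Real.norm_eq_abs] at h1
    have h2 := Real.rpow_le_rpow (by positivity) h1 (by linarith : 0 ≤ γ)
    rw [← Real.rpow_mul hN0, inv_mul_cancel₀ (by linarith), Real.rpow_one] at h2
    refine h2.trans ?_
    calc θ ^ γ ≤ θ ^ (1 : ℝ) := Real.rpow_le_rpow_of_exponent_ge hθ0 hθ1 hγ.le
      _ = θ := Real.rpow_one θ
  have hKm : AEStronglyMeasurable (fun x => s x * ‖v x - U 0 x‖ ^ 2) (volume.restrict Ω) :=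
    hd.memLp.1.mul ((hd.meas.sub hUm).norm.pow 2)
  have hKl : ∫⁻ x in Ω, ENNReal.ofReal (s x * ‖v x - U 0 x‖ ^ 2) ≤ ENNReal.ofReal θ :=
    le_add_self.trans hX
  have hKnn : 0 ≤ᵐ[volume.restrict Ω] fun x => s x * ‖v x - U 0 x‖ ^ 2 :=
    hd.nonneg.mono fun x hx => mul_nonneg hx (by positivity)
  have hKi : Integrable (fun x => s x * ‖v x - U 0 x‖ ^ 2) (volume.restrict Ω) :=
    (lintegral_ofReal_ne_top_iff_integrable hKm hKnn).1 (hKl.trans_lt ENNReal.ofReal_lt_top).ne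
  have hK : ∫ x in Ω, s x * ‖v x - U 0 x‖ ^ 2 ≤ θ := by
    rw [integral_eq_lintegral_of_nonneg_ae hKnn hKm]
    exact ENNReal.toReal_le_of_le_ofReal hθ0.le hKl
  have hEi := (hR.integral_relEnergy_eq hΩ hγ hst h0T (contDiff_const (c := (1 : ℝ)))).1
  have hJ1 : Integrable (fun x => 1 / 2 * (s x * ‖v x - U 0 x‖ ^ 2)
      + A * (1 + l ^ (1 - γ)) * |s x - r 0 x| ^ γ) (volume.restrict Ω) :=
    (hKi.const_mul _).add (hNi.const_mul _)
  have hle : ∫ x in Ω, relEnergy γ (s x) (v x) (r 0 x) (U 0 x)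
      ≤ ∫ x in Ω, (1 / 2 * (s x * ‖v x - U 0 x‖ ^ 2)
        + A * (1 + l ^ (1 - γ)) * |s x - r 0 x| ^ γ + A * l) := by
    refine integral_mono_ae hEi (hJ1.add (integrable_const _)) ?_
    filter_upwards [hd.nonneg, ae_restrict_mem hΩm] with x hx hxΩ
    have hxc := subset_closure hxΩ
    have h1 := h (s x) (r 0 x) hx (hR.pos.le.trans (hR.lower 0 h0T x hxc)) (hR.upper 0 h0T x hxc)
    have h2 := le_add_mul_rpow hγ hlp (abs_nonneg (s x - r 0 x))
    have h3 : relPressure γ (s x) (r 0 x) / (γ - 1)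
        ≤ A * (|s x - r 0 x| ^ γ + |s x - r 0 x|) := by
      rw [hA, div_mul_eq_mul_div]
      gcongr
    have h4 := mul_le_mul_of_nonneg_left h2 hAp
    simp only [relEnergy]
    nlinarith
  rw [integral_add hJ1 (integrable_const _), integral_add (hKi.const_mul _) (hNi.const_mul _),
    integral_const_mul, integral_const_mul, integral_const, smul_eq_mul, ← hV] at hle
  have hlA : V * (A * l) ≤ e / 2 := by
    have : (A * V + 1) * l = e / 2 := by rw [hl]; field_simp
    nlinarith
  have hBθ : B * θ ≤ e / 2 := by
    calc B * θ ≤ B * (e / (2 * B)) := by gcongr; exact min_le_right _ _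
      _ = e / 2 := by field_simp
  have h6 : A * (1 + l ^ (1 - γ)) * (∫ x in Ω, |s x - r 0 x| ^ γ) ≤ A * (1 + l ^ (1 - γ)) * θ := by
    gcongr
  have h7 : B * θ = 1 / 2 * θ + A * (1 + l ^ (1 - γ)) * θ := by rw [hB]; ring
  linarith

/-- The energy is bounded in terms of the relative energy. -/
lemma IsReferenceFlow.exists_energy_le (hR : IsReferenceFlow Ω T γ a b L r U)
    (hΩ : IsSmoothBoundedOpen Ω) (hγ : 1 < γ) (hT : 0 < T) :
    ∃ M, 0 ≤ M ∧ ∀ s v, IsState Ω γ s v →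
      ∫ x in Ω, relEnergy γ (s x) (v x) (r 0 x) (U 0 x) ≤ 1 → energy Ω γ s v ≤ M := by
  have hfin := isFiniteMeasure_restrict hΩ
  have h0T : (0 : ℝ) ∈ Icc 0 T := ⟨le_rfl, hT.le⟩
  have hg : 0 < γ - 1 := by linarith
  obtain ⟨C, hC, h⟩ := exists_state_le_relEnergy L hγ (hR.pos.trans_le hR.le)
  set V := (volume.restrict Ω).real univ with hV
  have hVp : 0 ≤ V := measureReal_nonneg
  set A := 1 / 2 * C + C / (γ - 1) with hA
  have hAp : 0 ≤ A := by positivity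
  refine ⟨A * (1 + V), by positivity, fun s v hs hE => ?_⟩
  have hEi := (hR.integral_relEnergy_eq hΩ hγ hs h0T (contDiff_const (c := (1 : ℝ)))).1
  have h1 : Integrable (fun x => 1 / 2 * s x * ‖v x‖ ^ 2 + s x ^ γ / (γ - 1))
      (volume.restrict Ω) := by
    simp only [mul_assoc]
    exact (hs.kinetic.const_mul _).add (hs.rpow.div_const _)
  have h2 : energy Ω γ s v
      ≤ ∫ x in Ω, A * (relEnergy γ (s x) (v x) (r 0 x) (U 0 x) + 1) := by
    refine integral_mono_ae h1 ((hEi.add (integrable_const _)).const_mul _) ?_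
    filter_upwards [hs.nonneg, ae_restrict_mem hΩ.isOpen.measurableSet] with x hx hxΩ
    have hxc := subset_closure hxΩ
    obtain ⟨-, h3, h4⟩ := h (s x) (r 0 x) (v x) (U 0 x) hx
      (hR.pos.le.trans (hR.lower 0 h0T x hxc)) (hR.upper 0 h0T x hxc)
      (hR.velocity.norm_le 0 h0T x hxc)
    have h5 := div_le_div_of_nonneg_right h3 hg.le
    calc 1 / 2 * s x * ‖v x‖ ^ 2 + s x ^ γ / (γ - 1)
        ≤ 1 / 2 * (C * (relEnergy γ (s x) (v x) (r 0 x) (U 0 x) + 1))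
          + C * (relEnergy γ (s x) (v x) (r 0 x) (U 0 x) + 1) / (γ - 1) := by linarith
      _ = _ := by rw [hA]; ring
  rw [integral_const_mul, integral_add hEi (integrable_const _), integral_const, smul_eq_mul,
    mul_one, ← hV] at h2
  exact h2.trans (by gcongr)

/-- A small relative energy forces a small flow error. -/
lemma IsReferenceFlow.exists_flowError_le (hR : IsReferenceFlow Ω T γ a b L r U)
    (hΩ : IsSmoothBoundedOpen Ω) (hγ : 1 < γ) {e : ℝ} (he : 0 < e) :
    ∃ θ, 0 < θ ∧ ∀ t ∈ Icc 0 T, ∀ s v, (∀ᵐ x ∂(volume.restrict Ω), 0 ≤ s x) →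
      ∫⁻ x in Ω, ENNReal.ofReal (relEnergy γ (s x) (v x) (r t x) (U t x)) ≤ ENNReal.ofReal θ →
      flowError Ω γ s v (r t) (U t) ≤ ENNReal.ofReal e := by
  have hfin := isFiniteMeasure_restrict hΩ
  have hΩm := hΩ.isOpen.measurableSet
  have hg : 0 < γ - 1 := by linarith
  set V := (volume.restrict Ω).real univ with hV
  have hVp : 0 ≤ V := measureReal_nonneg
  -- The budget for `∫ |s - r|^γ` matching an `L^γ` norm of `e / 2`; half of it goes to the slack
  -- `l` and half to the relative energy.
  set m := (e / 2) ^ γ with hm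
  have hmp : 0 < m := by positivity
  set l := m / (2 * (V + 1)) with hl
  have hlp : 0 < l := by positivity
  obtain ⟨C, hC, h⟩ := exists_abs_sub_rpow_le hγ hR.pos hR.le hlp
  set D := C * (γ - 1) with hD
  have hDp : 0 ≤ D := by positivity
  refine ⟨min (e / 4) (m / (2 * (D + 1))), by positivity, fun t ht s v hs hE => ?_⟩
  set θ := min (e / 4) (m / (2 * (D + 1))) with hθ
  have hθ0 : 0 < θ := by positivity
  have hγt : (ENNReal.ofReal γ).toReal = γ := ENNReal.toReal_ofReal (by linarith)
  have h1 : ∫⁻ x in Ω, ENNReal.ofReal (s x * ‖v x - U t x‖ ^ 2) ≤ ENNReal.ofReal (e / 2) := by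
    calc ∫⁻ x in Ω, ENNReal.ofReal (s x * ‖v x - U t x‖ ^ 2)
        ≤ ∫⁻ x in Ω, ENNReal.ofReal 2
            * ENNReal.ofReal (relEnergy γ (s x) (v x) (r t x) (U t x)) := by
          refine lintegral_mono_ae ?_
          filter_upwards [hs, ae_restrict_mem hΩm] with x hx hxΩ
          rw [← ENNReal.ofReal_mul zero_le_two]
          exact ENNReal.ofReal_le_ofReal (kinetic_le_relEnergy hγ hx
            (hR.pos.le.trans (hR.lower t ht x (subset_closure hxΩ))) _ _)
      _ ≤ ENNReal.ofReal 2 * ENNReal.ofReal θ := by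
          rw [lintegral_const_mul' _ _ ENNReal.ofReal_ne_top]
          gcongr
      _ ≤ ENNReal.ofReal (e / 2) := by
          rw [← ENNReal.ofReal_mul zero_le_two]
          refine ENNReal.ofReal_le_ofReal ?_
          have : θ ≤ e / 4 := min_le_left _ _
          linarith
  have h2 : ∫⁻ x in Ω, ‖s x - r t x‖ₑ ^ γ ≤ ENNReal.ofReal m := by
    calc ∫⁻ x in Ω, ‖s x - r t x‖ₑ ^ γ
        ≤ ∫⁻ x in Ω, (ENNReal.ofReal l + ENNReal.ofReal D
            * ENNReal.ofReal (relEnergy γ (s x) (v x) (r t x) (U t x))) := by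
          refine lintegral_mono_ae ?_
          filter_upwards [hs, ae_restrict_mem hΩm] with x hx hxΩ
          have hxc := subset_closure hxΩ
          have hrp := hR.pos.le.trans (hR.lower t ht x hxc)
          have hEp := relEnergy_nonneg hγ hx hrp (v x) (U t x)
          rw [← ENNReal.ofReal_mul hDp, ← ENNReal.ofReal_add hlp.le (by positivity),
            Real.enorm_eq_ofReal_abs, ENNReal.ofReal_rpow_of_nonneg (abs_nonneg _) (by linarith)]
          refine ENNReal.ofReal_le_ofReal ((h _ _ hx (hR.lower t ht x hxc)
            (hR.upper t ht x hxc)).trans ?_)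
          rw [hD, mul_assoc]
          gcongr
          exact relPressure_le_relEnergy hγ hx _ _
      _ ≤ ENNReal.ofReal (l * V) + ENNReal.ofReal D * ENNReal.ofReal θ := by
          rw [lintegral_add_left measurable_const, lintegral_const,
            lintegral_const_mul' _ _ ENNReal.ofReal_ne_top, ENNReal.ofReal_mul hlp.le, hV,
            ofReal_measureReal]
          gcongr
      _ ≤ ENNReal.ofReal m := by
          rw [← ENNReal.ofReal_mul hDp, ← ENNReal.ofReal_add (by positivity) (by positivity)]
          refine ENNReal.ofReal_le_ofReal ?_
          have e1 : l * (V + 1) = m / 2 := by rw [hl]; field_simp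
          have e2 : (D + 1) * θ ≤ m / 2 := by
            calc (D + 1) * θ ≤ (D + 1) * (m / (2 * (D + 1))) := by gcongr; exact min_le_right _ _
              _ = m / 2 := by field_simp
          nlinarith
  have h3 : eLpNorm (fun x => s x - r t x) (ENNReal.ofReal γ) (volume.restrict Ω)
      ≤ ENNReal.ofReal (e / 2) := by
    rw [eLpNorm_eq_lintegral_rpow_enorm_toReal (by simp; linarith) (by simp), hγt]
    calc (∫⁻ x in Ω, ‖s x - r t x‖ₑ ^ γ) ^ (1 / γ) ≤ (ENNReal.ofReal m) ^ (1 / γ) := by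
          gcongr
      _ = ENNReal.ofReal (e / 2) := by
          rw [ENNReal.ofReal_rpow_of_pos hmp, hm, ← Real.rpow_mul (by positivity),
            mul_one_div_cancel (by linarith), Real.rpow_one]
  calc flowError Ω γ s v (r t) (U t) ≤ ENNReal.ofReal (e / 2) + ENNReal.ofReal (e / 2) :=
        add_le_add h3 h1
    _ = ENNReal.ofReal e := by
        rw [← ENNReal.ofReal_add (by positivity) (by positivity), add_halves]

end

end CompressibleFlow

namespace CompressibleFlow

/-! ### Lower semicontinuity in time of the relative energy -/

lemma le_of_ae_le_of_continuousOn {O : Set ℝ} (hO : IsOpen O) {f g : ℝ → ℝ}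
    (hf : ContinuousOn f O) (hg : ContinuousOn g O)
    (h : ∀ᵐ t ∂(volume.restrict O), f t ≤ g t) {t : ℝ} (ht : t ∈ O) : f t ≤ g t := by
  have h1 : f =ᵐ[volume.restrict O] fun t => min (f t) (g t) := by
    filter_upwards [h] with t ht
    rw [min_eq_left ht]
  have h2 := Measure.eqOn_open_of_ae_eq h1 hO hf (hf.inf hg) ht
  rw [h2]
  exact min_le_right _ _

lemma WeaklyContinuousLp.continuousOn_of_bound {F : Type*} [NormedAddCommGroup F]
    [InnerProductSpace ℝ F] {Ω : Set E3} {T B : ℝ} {p : ℝ≥0∞} {f : ℝ → E3 → F}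
    (h : WeaklyContinuousLp Ω T p f) (hp : 1 ≤ p) (hΩ : IsSmoothBoundedOpen Ω) {g : E3 → F}
    (hg : AEStronglyMeasurable g (volume.restrict Ω)) (hb : ∀ x ∈ Ω, ‖g x‖ ≤ B) :
    ContinuousOn (fun t => ∫ x in Ω, inner ℝ (f t x) (g x)) (Icc 0 T) := by
  have := isFiniteMeasure_restrict hΩ
  refine h.2 _ (ENNReal.HolderConjugate.conjExponent hp) g (MemLp.of_bound hg B ?_)
  filter_upwards [ae_restrict_mem hΩ.isOpen.measurableSet] with x hx
  exact hb x hx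

lemma IsBoundedField.norm_time_sub_le {Ω : Set E3} {T L : ℝ} {F : Type*} [NormedAddCommGroup F]
    [NormedSpace ℝ F] {f : ℝ → E3 → F} (hf : IsBoundedField Ω T L f) (hΩ : IsOpen Ω)
    {s t : ℝ} (hs : s ∈ Ioo 0 T) (ht : t ∈ Ioo 0 T) {x : E3} (hx : x ∈ Ω) :
    ‖f t x - f s x‖ ≤ L * |t - s| :=
  (convex_Ioo 0 T).norm_image_sub_le_of_norm_deriv_le (f := fun τ => f τ x)
    (fun _ hτ => differentiableAt_time hΩ hf.contDiffOn hτ hx)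
    (fun _ hτ => hf.deriv_le _ hτ _ hx) hs ht

/-- The tangent planes of the relative energy density lie below it. -/
lemma tangent_le_relEnergy {γ s σ R : ℝ} (hγ : 1 < γ) (hs : 0 ≤ s) (hσ : 0 ≤ σ) (hR : 0 ≤ R)
    (v V ξ : E3) :
    inner ℝ (s • v) ξ + s * (γ / (γ - 1) * σ ^ (γ - 1) - 1 / 2 * ‖ξ‖ ^ 2 - inner ℝ V ξ
      - γ / (γ - 1) * R ^ (γ - 1)) + (R ^ γ - σ ^ γ) ≤ relEnergy γ s v R V := by
  have hg : 0 < γ - 1 := by linarith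
  have h1 := div_nonneg (relPressure_nonneg hγ hs hσ) hg.le
  have h2 : 0 ≤ 1 / 2 * s * ‖v - V - ξ‖ ^ 2 := by positivity
  have h3 : relEnergy γ s v R V = inner ℝ (s • v) ξ + s * (γ / (γ - 1) * σ ^ (γ - 1)
      - 1 / 2 * ‖ξ‖ ^ 2 - inner ℝ V ξ - γ / (γ - 1) * R ^ (γ - 1)) + (R ^ γ - σ ^ γ)
      + relPressure γ s σ / (γ - 1) + 1 / 2 * s * ‖v - V - ξ‖ ^ 2 := by
    rw [relEnergy, relPressure, relPressure, ← rpow_sub_one_mul_self hR hγ,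
      ← rpow_sub_one_mul_self hσ hγ, norm_sub_sq_real (v - V) ξ, inner_sub_left]
    simp only [inner_smul_left, conj_trivial]
    field_simp
    ring
  linarith

/-- The tangent plane touches at its own state, `σ = s` and `ξ = v - V`. So the relative energy is a
supremum of functionals affine in `(s, sv)`. -/
lemma tangent_eq_relEnergy {γ s R : ℝ} (hγ : 1 < γ) (hs : 0 ≤ s) (hR : 0 ≤ R) (v V : E3) :
    inner ℝ (s • v) (v - V) + s * (γ / (γ - 1) * s ^ (γ - 1) - 1 / 2 * ‖v - V‖ ^ 2
      - inner ℝ V (v - V) - γ / (γ - 1) * R ^ (γ - 1)) + (R ^ γ - s ^ γ) = relEnergy γ s v R V := by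
  have hg : γ - 1 ≠ 0 := by linarith
  rw [relEnergy, relPressure, ← rpow_sub_one_mul_self hR hγ, ← rpow_sub_one_mul_self hs hγ,
    ← real_inner_self_eq_norm_sq]
  simp only [inner_smul_left, conj_trivial, inner_sub_left, inner_sub_right, real_inner_comm v V]
  field_simp
  ring

section

variable {Ω : Set E3} {T γ μ η ε a b L κ : ℝ} {r : ℝ → E3 → ℝ} {U : ℝ → E3 → E3}
  {ρ₀ : E3 → ℝ} {u₀ : E3 → E3} {ρ : ℝ → E3 → ℝ} {u : ℝ → E3 → E3} {Du : ℝ → E3 → E3 →L[ℝ] E3}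

/-- For fixed bounded `ξ` and `σ` the tangent functional is affine in density and momentum, so it is
continuous in time by weak continuity. It is below the relative energy, hence essentially below `κ`
at almost every time, and therefore at `t`. -/
lemma IsReferenceFlow.integral_tangent_le (hR : IsReferenceFlow Ω T γ a b L r U)
    (hΩ : IsSmoothBoundedOpen Ω) (hγ : 1 < γ)
    (hS : IsFiniteEnergyWeakSolution Ω T γ μ η ε ρ₀ u₀ ρ u Du)
    (hκ : ∀ᵐ τ ∂(volume.restrict (Ioo 0 T)), IsState Ω γ (ρ τ) (u τ) ∧
      ∫ x in Ω, relEnergy γ (ρ τ x) (u τ x) (r τ x) (U τ x) ≤ κ)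
    {ξ : E3 → E3} {σ : E3 → ℝ} {B : ℝ} (hξm : AEStronglyMeasurable ξ (volume.restrict Ω))
    (hσm : AEStronglyMeasurable σ (volume.restrict Ω)) (hξ : ∀ x ∈ Ω, ‖ξ x‖ ≤ B)
    (hσ0 : ∀ᵐ x ∂(volume.restrict Ω), 0 ≤ σ x) (hσ : ∀ x ∈ Ω, |σ x| ≤ B)
    {t : ℝ} (ht : t ∈ Ioo 0 T) :
    Integrable (fun x => inner ℝ (ρ t x • u t x) (ξ x) + ρ t x * (γ / (γ - 1) * σ x ^ (γ - 1)
      - 1 / 2 * ‖ξ x‖ ^ 2 - inner ℝ (U t x) (ξ x) - γ / (γ - 1) * r t x ^ (γ - 1))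
      + (r t x ^ γ - σ x ^ γ)) (volume.restrict Ω) ∧
    ∫ x in Ω, (inner ℝ (ρ t x • u t x) (ξ x) + ρ t x * (γ / (γ - 1) * σ x ^ (γ - 1)
      - 1 / 2 * ‖ξ x‖ ^ 2 - inner ℝ (U t x) (ξ x) - γ / (γ - 1) * r t x ^ (γ - 1))
      + (r t x ^ γ - σ x ^ γ)) ≤ κ := by
  have hfin := isFiniteMeasure_restrict hΩ
  have hΩm := hΩ.isOpen.measurableSet
  have ht' := Ioo_subset_Icc_self ht
  have hg : 0 < γ - 1 := by linarith
  set g := γ / (γ - 1) with hgdef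
  have hgp : 0 ≤ g := by positivity
  obtain ⟨N, hN0, hN⟩ := exists_isBoundedField (f := fun t x => r t x ^ (γ - 1)) hΩ
    (contDiffOn_rpow hR.euler hR.pos hR.lower (γ - 1))
  obtain ⟨P, hP0, hP⟩ := exists_isBoundedField (f := fun t x => r t x ^ γ) hΩ
    (contDiffOn_rpow hR.euler hR.pos hR.lower γ)
  have hUm := hR.velocity.meas_slice hΩ.isOpen ht'
  have hNm := hN.meas_slice hΩ.isOpen ht'
  set h : E3 → ℝ := fun x => g * σ x ^ (γ - 1) - 1 / 2 * ‖ξ x‖ ^ 2 - inner ℝ (U t x) (ξ x)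
      - g * r t x ^ (γ - 1) with hh
  have hhm : AEStronglyMeasurable h (volume.restrict Ω) :=
    ((((hσm.aemeasurable.pow_const _).aestronglyMeasurable.const_mul g).sub
      ((hξm.norm.pow 2).const_mul _)).sub (hUm.inner hξm)).sub (hNm.const_mul g)
  set H := g * B ^ (γ - 1) + 1 / 2 * B ^ 2 + L * B + g * N with hHdef
  have hhb : ∀ x ∈ Ω, ‖h x‖ ≤ H := fun x hx => by
    have hB : 0 ≤ B := (norm_nonneg _).trans (hξ x hx)
    have h1 : |g * σ x ^ (γ - 1)| ≤ g * B ^ (γ - 1) := by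
      rw [abs_mul, abs_of_nonneg hgp]
      gcongr
      exact (Real.abs_rpow_le_abs_rpow _ _).trans
        (Real.rpow_le_rpow (abs_nonneg _) (hσ x hx) hg.le)
    have h2 : |1 / 2 * ‖ξ x‖ ^ 2| ≤ 1 / 2 * B ^ 2 := by
      rw [abs_of_nonneg (by positivity)]
      gcongr
      exact hξ x hx
    have h3 : |inner ℝ (U t x) (ξ x)| ≤ L * B :=
      (abs_real_inner_le_norm _ _).trans (mul_le_mul (hR.velocity.norm_le t ht' x (subset_closure hx))
        (hξ x hx) (norm_nonneg _) hR.bound_nonneg)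
    have h4 : |g * r t x ^ (γ - 1)| ≤ g * N := by
      rw [abs_mul, abs_of_nonneg hgp]
      gcongr
      exact hN.norm_le t ht' x (subset_closure hx)
    rw [Real.norm_eq_abs]
    exact (abs_sub _ _).trans (add_le_add ((abs_sub _ _).trans
      (add_le_add ((abs_sub _ _).trans (add_le_add h1 h2)) h3)) h4)
  have hσi : Integrable (fun x => r t x ^ γ - σ x ^ γ) (volume.restrict Ω) := by
    refine (hP.integrable_slice hΩ ht').sub (Integrable.of_bound
      (hσm.aemeasurable.pow_const _).aestronglyMeasurable (B ^ γ) ?_)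
    filter_upwards [ae_restrict_mem hΩm] with x hx
    exact (Real.abs_rpow_le_abs_rpow _ _).trans
      (Real.rpow_le_rpow (abs_nonneg _) (hσ x hx) (by linarith))
  have hp1 : (1 : ℝ≥0∞) ≤ ENNReal.ofReal γ := ENNReal.one_le_ofReal.2 hγ.le
  have hp2 : (1 : ℝ≥0∞) ≤ ENNReal.ofReal (2 * γ / (γ + 1)) := by
    rw [ENNReal.one_le_ofReal, le_div_iff₀ (by linarith)]
    linarith
  have c1 := (hS.momentum_cw.continuousOn_of_bound hp2 hΩ hξm hξ).mono Ioo_subset_Icc_self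
  have c2 := (hS.density_cw.continuousOn_of_bound hp1 hΩ hhm hhb).mono Ioo_subset_Icc_self
  have c3 := (hS.density_cw.continuousOn_of_bound hp1 hΩ (g := fun _ => (1 : ℝ)) (B := 1)
    aestronglyMeasurable_const (by simp)).mono Ioo_subset_Icc_self
  have hinner : ∀ x y : ℝ, inner ℝ x y = x * y := fun x y => by simp [mul_comm]
  simp only [hinner, mul_one] at c2 c3
  set m := ∫ x in Ω, (r t x ^ γ - σ x ^ γ) with hm
  have hsplit : ∀ τ, Integrable (fun x => inner ℝ (ρ τ x • u τ x) (ξ x)) (volume.restrict Ω) →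
      Integrable (fun x => ρ τ x * h x) (volume.restrict Ω) →
      Integrable (fun x => inner ℝ (ρ τ x • u τ x) (ξ x) + ρ τ x * h x + (r t x ^ γ - σ x ^ γ))
        (volume.restrict Ω) ∧
      ∫ x in Ω, (inner ℝ (ρ τ x • u τ x) (ξ x) + ρ τ x * h x + (r t x ^ γ - σ x ^ γ))
        = (∫ x in Ω, inner ℝ (ρ τ x • u τ x) (ξ x)) + (∫ x in Ω, ρ τ x * h x) + m := by
    intro τ i1 i2
    have i3 : Integrable (fun x => inner ℝ (ρ τ x • u τ x) (ξ x) + ρ τ x * h x)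
      (volume.restrict Ω) := i1.add i2
    exact ⟨i3.add hσi, by rw [integral_add i3 hσi, integral_add i1 i2]⟩
  have hbdd : ∀ τ, Integrable (ρ τ) (volume.restrict Ω) →
      Integrable (fun x => ρ τ x * h x) (volume.restrict Ω) := fun τ hi => by
    refine hi.mul_bdd (c := H) hhm ?_
    filter_upwards [ae_restrict_mem hΩm] with x hx
    exact hhb x hx
  set K := L * B + g * N with hK
  set V := (volume.restrict Ω).real univ with hV
  -- The coefficients are frozen at time `t`, so that weak continuity applies against fixed
  -- functions. The Euler flow is Lipschitz in time, and the mismatch at `τ` costs a multiple of `|τ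
  -- - t|`, which vanishes at `t`.
  have hae : ∀ᵐ τ ∂(volume.restrict (Ioo 0 T)),
      (∫ x in Ω, inner ℝ (ρ τ x • u τ x) (ξ x)) + (∫ x in Ω, ρ τ x * h x) + m
        ≤ κ + |τ - t| * (K * (∫ x in Ω, ρ τ x) + P * V) := by
    filter_upwards [hκ, ae_restrict_mem measurableSet_Ioo] with τ ⟨hst, hE⟩ hτ
    have hτ' := Ioo_subset_Icc_self hτ
    have i0 := hst.integrable_density hΩ hγ
    have iE := (hR.integral_relEnergy_eq hΩ hγ hst hτ' (contDiff_const (c := (1 : ℝ)))).1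
    obtain ⟨i1, e1⟩ := hsplit τ (hst.integrable_inner hΩ hγ hξm hξ) (hbdd τ i0)
    have iE1 : Integrable (fun x => relEnergy γ (ρ τ x) (u τ x) (r τ x) (U τ x)
        + |τ - t| * K * ρ τ x) (volume.restrict Ω) := iE.add (i0.const_mul _)
    have iE2 := iE1.add (integrable_const (μ := volume.restrict Ω) (|τ - t| * P))
    have hle : ∫ x in Ω, (inner ℝ (ρ τ x • u τ x) (ξ x) + ρ τ x * h x + (r t x ^ γ - σ x ^ γ))
        ≤ ∫ x in Ω, (relEnergy γ (ρ τ x) (u τ x) (r τ x) (U τ x) + |τ - t| * K * ρ τ x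
          + |τ - t| * P) := by
      refine integral_mono_ae i1 iE2 ?_
      filter_upwards [hst.nonneg, hσ0, ae_restrict_mem hΩm] with x hx hσx hxΩ
      have hxc := subset_closure hxΩ
      have h1 := tangent_le_relEnergy hγ hx hσx (hR.pos.le.trans (hR.lower τ hτ' x hxc))
        (u τ x) (U τ x) (ξ x)
      have h2 := hR.velocity.norm_time_sub_le hΩ.isOpen ht hτ hxΩ
      have h3 := (abs_le.1 (hN.norm_time_sub_le hΩ.isOpen ht hτ hxΩ)).2
      have h4 := (abs_le.1 (hP.norm_time_sub_le hΩ.isOpen ht hτ hxΩ)).1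
      have h5 : inner ℝ (U τ x) (ξ x) - inner ℝ (U t x) (ξ x) ≤ L * B * |τ - t| := by
        rw [← inner_sub_left]
        refine (real_inner_le_norm _ _).trans ?_
        have := mul_le_mul h2 (hξ x hxΩ) (norm_nonneg _) (by have := hR.bound_nonneg; positivity)
        linarith
      have h6 := mul_le_mul_of_nonneg_left h3 hgp
      have h7 : ρ τ x * (inner ℝ (U τ x) (ξ x) - inner ℝ (U t x) (ξ x)
          + g * (r τ x ^ (γ - 1) - r t x ^ (γ - 1))) ≤ ρ τ x * (|τ - t| * K) :=
        mul_le_mul_of_nonneg_left (by rw [hK]; linarith) hx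
      simp only [hh]
      linarith
    rw [e1, integral_add iE1 (integrable_const _), integral_add iE (i0.const_mul _),
      integral_const_mul, integral_const, smul_eq_mul, ← hV] at hle
    linarith
  have hρt : Integrable (ρ t) (volume.restrict Ω) := (hS.density_cw.1 t ht').integrable hp1
  have hmt : Integrable (fun x => ρ t x • u t x) (volume.restrict Ω) :=
    (hS.momentum_cw.1 t ht').integrable hp2
  have hmξ : Integrable (fun x => inner ℝ (ρ t x • u t x) (ξ x)) (volume.restrict Ω) := by
    refine (hmt.norm.mul_const B).mono' (hmt.1.inner hξm) ?_
    filter_upwards [ae_restrict_mem hΩm] with x hx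
    exact (norm_inner_le_norm _ _).trans (mul_le_mul_of_nonneg_left (hξ x hx) (norm_nonneg _))
  obtain ⟨i1, e1⟩ := hsplit t hmξ (hbdd t hρt)
  refine ⟨i1, e1.trans_le ?_⟩
  have hfinal := le_of_ae_le_of_continuousOn isOpen_Ioo ((c1.add c2).add continuousOn_const)
    (continuousOn_const.add ((by fun_prop : ContinuousOn (fun τ => |τ - t|) (Ioo 0 T)).mul
      ((c3.const_mul K).add continuousOn_const))) hae ht
  simpa using hfinal

end

end CompressibleFlow

/-! ### From almost every time to every time. -/

namespace CompressibleFlow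

section

variable {Ω : Set E3} {T γ μ η ε a b L κ : ℝ} {r : ℝ → E3 → ℝ} {U : ℝ → E3 → E3}
  {ρ₀ : E3 → ℝ} {u₀ : E3 → E3} {ρ : ℝ → E3 → ℝ} {u : ℝ → E3 → E3} {Du : ℝ → E3 → E3 →L[ℝ] E3}

/-- A bound for the relative energy at almost every time holds at every time. -/
lemma IsReferenceFlow.lintegral_relEnergy_le (hR : IsReferenceFlow Ω T γ a b L r U)
    (hΩ : IsSmoothBoundedOpen Ω) (hγ : 1 < γ)
    (hS : IsFiniteEnergyWeakSolution Ω T γ μ η ε ρ₀ u₀ ρ u Du)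
    (hκ : ∀ᵐ τ ∂(volume.restrict (Ioo 0 T)), IsState Ω γ (ρ τ) (u τ) ∧
      ∫ x in Ω, relEnergy γ (ρ τ x) (u τ x) (r τ x) (U τ x) ≤ κ)
    {t : ℝ} (ht : t ∈ Ioo 0 T) :
    ∫⁻ x in Ω, ENNReal.ofReal (relEnergy γ (ρ t x) (u t x) (r t x) (U t x))
      ≤ ENNReal.ofReal κ := by
  have hΩm := hΩ.isOpen.measurableSet
  have ht' := Ioo_subset_Icc_self ht
  set A : ℕ → Set (E3 × ℝ) := fun k => {p | ‖p.1‖ ≤ k ∧ |p.2| ≤ k} with hA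
  have hAm : ∀ k, MeasurableSet (A k) := fun k =>
    (measurableSet_le measurable_fst.norm measurable_const).inter
      (measurableSet_le measurable_snd.abs measurable_const)
  -- At an individual time only density and momentum are known to be measurable. The velocity
  -- recovered from them differs from `u t` only where the density vanishes, and there the relative
  -- energy does not see it.
  set v : E3 → E3 := fun x => (ρ t x)⁻¹ • (ρ t x • u t x) with hv
  have hρv : ∀ x, ρ t x • v x = ρ t x • u t x := fun x => by
    rcases eq_or_ne (ρ t x) 0 with h | h
    · simp [h]
    · rw [hv, smul_inv_smul₀ h]
  have hev : ∀ x, relEnergy γ (ρ t x) (v x) (r t x) (U t x)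
      = relEnergy γ (ρ t x) (u t x) (r t x) (U t x) := fun x => by
    rcases eq_or_ne (ρ t x) 0 with h | h
    · simp [relEnergy, h]
    · rw [hv]
      simp only [inv_smul_smul₀ h]
  have hρm := (hS.density_cw.1 t ht').1.aemeasurable
  have hvm : AEMeasurable v (volume.restrict Ω) :=
    hρm.inv.smul (hS.momentum_cw.1 t ht').1.aemeasurable
  have hwm : AEMeasurable (fun x => v x - U t x) (volume.restrict Ω) :=
    hvm.sub (hR.velocity.meas_slice hΩ.isOpen ht').aemeasurable
  have hrm := (hR.density.meas_slice hΩ.isOpen ht').aemeasurable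
  have hpm := hwm.prodMk hρm
  classical
  -- The optimal tangent where the state is bounded by `k`, and elsewhere the tangent at the Euler
  -- state, which vanishes identically. So `φ k` is the relative energy truncated to bounded states,
  -- and Fatou removes the truncation.
  set ξ : ℕ → E3 → E3 := fun k x => if (v x - U t x, ρ t x) ∈ A k then v x - U t x else 0 with hξ
  set σ : ℕ → E3 → ℝ := fun k x => if (v x - U t x, ρ t x) ∈ A k then ρ t x else r t x with hσ
  have hξm : ∀ k, AEStronglyMeasurable (ξ k) (volume.restrict Ω) := fun k =>
    ((Measurable.ite (hAm k) measurable_fst measurable_const).comp_aemeasurable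
      hpm).aestronglyMeasurable
  have hσm : ∀ k, AEStronglyMeasurable (σ k) (volume.restrict Ω) := fun k =>
    ((Measurable.ite (p := fun q : (E3 × ℝ) × ℝ => q.1 ∈ A k) (measurable_fst (hAm k))
      (measurable_snd.comp measurable_fst) measurable_snd).comp_aemeasurable
      (hpm.prodMk hrm)).aestronglyMeasurable
  have hb : 0 < b := hR.pos.trans_le hR.le
  have hξb : ∀ k, ∀ x ∈ Ω, ‖ξ k x‖ ≤ k + b := fun k x _ => by
    simp only [hξ]
    split_ifs with h
    · exact h.1.trans (by linarith)
    · rw [norm_zero]; positivity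
  have hσb : ∀ k, ∀ x ∈ Ω, |σ k x| ≤ k + b := fun k x hx => by
    simp only [hσ]
    split_ifs with h
    · exact h.2.trans (by linarith)
    · have h1 := hR.lower t ht' x (subset_closure hx)
      have h2 := hR.upper t ht' x (subset_closure hx)
      rw [abs_of_nonneg (hR.pos.le.trans h1)]
      linarith [Nat.cast_nonneg (α := ℝ) k]
  have hσ0 : ∀ k, ∀ᵐ x ∂(volume.restrict Ω), 0 ≤ σ k x := fun k => by
    filter_upwards [hS.density_nonneg t ht', ae_restrict_mem hΩm] with x hx hxΩ
    simp only [hσ]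
    split_ifs
    · exact hx
    · exact hR.pos.le.trans (hR.lower t ht' x (subset_closure hxΩ))
  set φ : ℕ → E3 → ℝ := fun k x => inner ℝ (ρ t x • u t x) (ξ k x)
    + ρ t x * (γ / (γ - 1) * σ k x ^ (γ - 1) - 1 / 2 * ‖ξ k x‖ ^ 2 - inner ℝ (U t x) (ξ k x)
      - γ / (γ - 1) * r t x ^ (γ - 1)) + (r t x ^ γ - σ k x ^ γ) with hφ
  have hφle : ∀ k, Integrable (φ k) (volume.restrict Ω) ∧ ∫ x in Ω, φ k x ≤ κ := fun k =>
    hR.integral_tangent_le hΩ hγ hS hκ (hξm k) (hσm k) (hξb k) (hσ0 k) (hσb k) ht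
  have hφ1 : ∀ k x, 0 ≤ ρ t x → x ∈ Ω → (v x - U t x, ρ t x) ∈ A k →
      φ k x = relEnergy γ (ρ t x) (u t x) (r t x) (U t x) := fun k x hx hxΩ h => by
    simp only [hφ, hξ, hσ, if_pos h]
    rw [← hev, ← hρv]
    exact tangent_eq_relEnergy hγ hx (hR.pos.le.trans (hR.lower t ht' x (subset_closure hxΩ))) _ _
  have hφ2 : ∀ k x, (v x - U t x, ρ t x) ∉ A k → φ k x = 0 := fun k x h => by
    simp only [hφ, hξ, hσ, if_neg h]
    simp
  have hφ0 : ∀ k, 0 ≤ᵐ[volume.restrict Ω] φ k := fun k => by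
    filter_upwards [hS.density_nonneg t ht', ae_restrict_mem hΩm] with x hx hxΩ
    by_cases h : (v x - U t x, ρ t x) ∈ A k
    · rw [hφ1 k x hx hxΩ h]
      exact relEnergy_nonneg hγ hx (hR.pos.le.trans (hR.lower t ht' x (subset_closure hxΩ))) _ _
    · exact (hφ2 k x h).ge
  calc ∫⁻ x in Ω, ENNReal.ofReal (relEnergy γ (ρ t x) (u t x) (r t x) (U t x))
      = ∫⁻ x in Ω, liminf (fun k => ENNReal.ofReal (φ k x)) atTop := by
        refine lintegral_congr_ae ?_
        filter_upwards [hS.density_nonneg t ht', ae_restrict_mem hΩm] with x hx hxΩ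
        refine (Tendsto.liminf_eq (tendsto_const_nhds.congr' ?_)).symm
        obtain ⟨n, hn⟩ := exists_nat_ge (max ‖v x - U t x‖ |ρ t x|)
        filter_upwards [eventually_ge_atTop n] with k hk
        have hnk : (n : ℝ) ≤ k := by exact_mod_cast hk
        rw [hφ1 k x hx hxΩ ⟨(le_max_left _ _).trans (hn.trans hnk),
          (le_max_right _ _).trans (hn.trans hnk)⟩]
    _ ≤ liminf (fun k => ∫⁻ x in Ω, ENNReal.ofReal (φ k x)) atTop :=
        lintegral_liminf_le' fun k => (hφle k).1.1.aemeasurable.ennreal_ofReal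
    _ ≤ liminf (fun _ : ℕ => ENNReal.ofReal κ) atTop := by
        refine liminf_le_liminf (Eventually.of_forall fun k => ?_)
        rw [← ofReal_integral_eq_lintegral_ofReal (hφle k).1 (hφ0 k)]
        exact ENNReal.ofReal_le_ofReal (hφle k).2
    _ = ENNReal.ofReal κ := liminf_const _

end

end CompressibleFlow

/-! ### Choice of the parameters. -/

namespace CompressibleFlow

/-- The parameters in the relative energy inequality can be chosen to make its right-hand side
small. -/
lemma exists_parameters {γ C C₀ L M T V c X θ : ℝ} (hγ : 1 < γ) (hC : 0 ≤ C) (hC₀ : 0 ≤ C₀)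
    (hL : 0 ≤ L) (hM : 0 ≤ M) (hT : 0 ≤ T) (hV : 0 ≤ V) (hc : 0 < c) (hX : 0 < X) (hθ : 0 < θ) :
    ∃ e l K d ε₁, 0 < e ∧ 0 < l ∧ 0 < K ∧ 0 < d ∧ 0 < ε₁ ∧ ∀ E₀ ε, E₀ ≤ e → 0 < ε → ε < ε₁ →
      (E₀ + 2 * (L * (l * (2 * M) + l⁻¹ * (K * (C₀ * (c * ε)) + K ^ (1 - γ) * ((γ - 1) * M))))
        + (C * ε * (T * V) + (C + C * l * (ε / (c * ε) ^ 2)) * (T * (C₀ * (c * ε)))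
          + (C * c + C / l) * d)) * X ≤ θ := by
  set q := θ / X with hq
  have hqp : 0 < q := by positivity
  -- Five contributions receive `q / 5` each. `l` comes first, since `K`, `d` and `ε₁` have to beat
  -- negative powers of it.
  set l := q / (5 * (4 * L * M + C * T * C₀ / c + 1)) with hl
  have hlp : 0 < l := by positivity
  have hl1 : l * (4 * L * M + C * T * C₀ / c) ≤ q / 5 := by
    have h0 : 0 < 4 * L * M + C * T * C₀ / c + 1 := by positivity
    have : l * (4 * L * M + C * T * C₀ / c + 1) = q / 5 := by
      rw [hl]
      field_simp
    linarith
  have hg : 0 < γ - 1 := by linarith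
  obtain ⟨K, hK0, hK⟩ : ∃ K : ℝ, 0 < K ∧ 2 * L * l⁻¹ * ((γ - 1) * M) * K ^ (1 - γ) ≤ q / 5 := by
    have h1 : Tendsto (fun K : ℝ => 2 * L * l⁻¹ * ((γ - 1) * M) * K ^ (1 - γ)) atTop (𝓝 0) := by
      have := (tendsto_rpow_neg_atTop hg).const_mul (2 * L * l⁻¹ * ((γ - 1) * M))
      simpa using this
    exact ((eventually_gt_atTop 0).and
      (h1.eventually_le_const (by positivity : (0 : ℝ) < q / 5))).exists
  set A := 2 * L * l⁻¹ * K * C₀ * c + C * T * V + C * T * C₀ * c with hA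
  have hAp : 0 ≤ A := by positivity
  set D := C * c + C / l with hD
  have hDp : 0 ≤ D := by positivity
  refine ⟨q / 5, l, K, q / (5 * (D + 1)), q / (5 * (A + 1)), by positivity, hlp, hK0, by positivity,
    by positivity, fun E₀ ε hE hε hε₁ => ?_⟩
  have h1 : D * (q / (5 * (D + 1))) ≤ q / 5 := by
    have : (D + 1) * (q / (5 * (D + 1))) = q / 5 := by field_simp
    have : 0 < q / (5 * (D + 1)) := by positivity
    linarith
  have h2 : A * ε ≤ q / 5 := by
    have h3 : (A + 1) * (q / (5 * (A + 1))) = q / 5 := by field_simp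
    have h4 : (A + 1) * ε ≤ (A + 1) * (q / (5 * (A + 1))) := by gcongr
    linarith
  have h5 : E₀ + 2 * (L * (l * (2 * M) + l⁻¹ * (K * (C₀ * (c * ε)) + K ^ (1 - γ) * ((γ - 1) * M))))
        + (C * ε * (T * V) + (C + C * l * (ε / (c * ε) ^ 2)) * (T * (C₀ * (c * ε)))
          + D * (q / (5 * (D + 1))))
      = E₀ + A * ε + l * (4 * L * M + C * T * C₀ / c)
        + 2 * L * l⁻¹ * ((γ - 1) * M) * K ^ (1 - γ) + D * (q / (5 * (D + 1))) := by
    -- The viscous cost of the cutoff is of order one at width `cε`: it does not decay with `ε`, and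
    -- only `l` makes it small.
    have h6 : C * l * (ε / (c * ε) ^ 2) * (T * (C₀ * (c * ε))) = l * (C * T * C₀ / c) := by
      field_simp
    rw [add_mul C, h6, hA]
    ring
  rw [h5]
  calc _ ≤ q * X := by gcongr; linarith
    _ = θ := by rw [hq]; field_simp

end CompressibleFlow
-- Conclusion.
theorem mainTheorem1 (Ω : Set E3) (hΩ : IsSmoothBoundedOpen Ω)
    (γ μ η c T : ℝ) (hγ : 3 / 2 < γ) (hμ : 0 < μ) (hη : 0 ≤ η) (hc : 0 < c) (hT : 0 < T)
    (ρE : ℝ → E3 → ℝ) (uE : ℝ → E3 → E3) (hE : IsSmoothEulerSolution Ω T γ ρE uE)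
    (ρ₀ : ℝ → E3 → ℝ) (u₀ : ℝ → E3 → E3)
    (ρ : ℝ → ℝ → E3 → ℝ) (u : ℝ → ℝ → E3 → E3) (Du : ℝ → ℝ → E3 → E3 →L[ℝ] E3)
    (hdata : ∀ ε ∈ Ioo (0 : ℝ) 1, IsInitialData Ω γ (ρ₀ ε) (u₀ ε))
    (hsol : ∀ ε ∈ Ioo (0 : ℝ) 1,
      IsFiniteEnergyWeakSolution Ω T γ μ η ε (ρ₀ ε) (u₀ ε) (ρ ε) (u ε) (Du ε))
    (hinit : Tendsto (fun ε : ℝ => flowError Ω γ (ρ₀ ε) (u₀ ε) (ρE 0) (uE 0))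
      (𝓝[>] 0) (𝓝 0))
    (hKato : Tendsto
      (fun ε : ℝ => ENNReal.ofReal ε * layerDissipation Ω T (c * ε) (ρ ε) (u ε) (Du ε))
      (𝓝[>] 0) (𝓝 0)) :
    Tendsto (fun ε : ℝ => ⨆ t ∈ Ioo 0 T, flowError Ω γ (ρ ε t) (u ε t) (ρE t) (uE t))
      (𝓝[>] 0) (𝓝 0) := by

  have hγ1 : 1 < γ := by linarith
  obtain ⟨a, b, L, hR⟩ := hE.exists_isReferenceFlow hΩ hT
  obtain ⟨C₀, δ₀, hC₀, hδ₀, hcut⟩ := hasCutoffs_frontier hΩ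
  obtain ⟨C, hC, hmain⟩ := hR.exists_ae_relEnergy_le hΩ hT hγ1 hμ.le hη hc hC₀
  obtain ⟨M, hM, henergy⟩ := hR.exists_energy_le hΩ hγ1 hT
  rw [ENNReal.tendsto_nhds_zero] at hinit hKato ⊢
  intro e' he'
  obtain ⟨e, he, hee'⟩ : ∃ e : ℝ, 0 < e ∧ ENNReal.ofReal e ≤ e' := by
    obtain ⟨q, hq, hqe⟩ := ENNReal.lt_iff_exists_nnreal_btwn.1 he'
    exact ⟨q, by exact_mod_cast hq, by simpa using hqe.le⟩
  obtain ⟨θ, hθ, hflow⟩ := hR.exists_flowError_le hΩ hγ1 he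
  obtain ⟨e₀, l, K, d, ε₁, he₀, hl, hK, hd, hε₁, hpar⟩ := exists_parameters (T := T)
    (V := volume.real Ω) hγ1 hC hC₀ hR.bound_nonneg hM hT.le measureReal_nonneg hc
    (Real.exp_pos (C * T)) hθ
  -- Initial relative energy below `1` gives the uniform energy bound `M`; below `e₀` it meets the
  -- smallness required by the parameters, which depend on `M`.
  obtain ⟨θ₀, hθ₀, hdat⟩ := hR.exists_integral_relEnergy_le hΩ hγ1 hT (lt_min one_pos he₀)
  have hsmall : ∀ᶠ ε : ℝ in 𝓝[>] 0, ε ∈ Ioo 0 (min 1 (min ε₁ (δ₀ / c))) :=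
    Ioo_mem_nhdsGT (by positivity)
  filter_upwards [hsmall, hinit _ (ENNReal.ofReal_pos.2 hθ₀), hKato _ (ENNReal.ofReal_pos.2 hd)]
    with ε hε hi hk
  have hε0 : 0 < ε := hε.1
  have hε1 : ε ∈ Ioo (0 : ℝ) 1 := ⟨hε0, hε.2.trans_le (min_le_left _ _)⟩
  have hε2 : ε < ε₁ := hε.2.trans_le ((min_le_right _ _).trans (min_le_left _ _))
  have hε3 : c * ε < δ₀ := by
    have : ε < δ₀ / c := hε.2.trans_le ((min_le_right _ _).trans (min_le_right _ _))
    rwa [lt_div_iff₀ hc, mul_comm] at this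
  obtain ⟨χ, S, hχ⟩ := hcut (c * ε) ⟨by positivity, hε3⟩
  have hE₀ := hdat _ _ (hdata ε hε1) hi
  have hen := henergy _ _ ((hdata ε hε1).isState hγ1) (hE₀.trans (min_le_left _ _))
  have hae := hmain ε l K M d χ S _ _ _ _ _ hε0 hl hK hM hd.le hχ (hdata ε hε1) (hsol ε hε1) hen hk
  have hκ := hpar _ ε (hE₀.trans (min_le_right _ _)) hε0 hε2
  refine iSup₂_le fun t ht => (hflow t (Ioo_subset_Icc_self ht) _ _
    ((hsol ε hε1).density_nonneg t (Ioo_subset_Icc_self ht)) ?_).trans hee'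
  exact hR.lintegral_relEnergy_le hΩ hγ1 (hsol ε hε1)
    (hae.mono fun τ hτ => ⟨hτ.1, hτ.2.trans hκ⟩) ht
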